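/- Let $k$ be a field with $\mathrm{char}(k)\neq 2$ and let $\mathcal C$ be a $k$-linear additive idempotent-complete ribbon category with bilinear tensor product and $\mathrm{End}_{\mathcal C}(1)=k\,\mathrm{id}_1$ (the natural map $k\to\mathrm{End}_{\mathcal C}(1)$ is bijective). Write $c$ for the braiding, $\theta$ for the twist, $\mathrm{ev}_X:X^*\otimes X\to 1$ and $\mathrm{coev}_X:1\to X\otimes X^*$ for the duality, and $\widetilde{\mathrm{ev}}_X=\mathrm{ev}_X\circ c_{X,X^*}\circ(\theta_X\otimes\mathrm{id})$, $\widetilde{\mathrm{coev}}_X=(\mathrm{id}\otimes\theta_X)\circ c_{X,X^*}\circ\mathrm{coev}_X$ for the duality of opposite handedness (associators and unitors are suppressed). Let $(A,\mu,\eta,\Delta,\epsilon)$ be a commutative Frobenius algebra in $\mathcal C$ with $\mu\circ\Delta=\mathrm{id}_A$ and $\epsilon\circ\eta\in k^\times\mathrm{id}_1$, and let $$N_A=(\mathrm{ev}_A\otimes\mathrm{id}_A)\circ\big(\mathrm{id}_{A^*}\otimes(\Delta\circ\eta\circ\epsilon\circ\mu)\big)\circ(\widetilde{\mathrm{coev}}_A\otimes\mathrm{id}_A)$$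 be its Nakayama automorphism. A left $A$-module $(M,\rho_M)$ is Nakayama-local if $\rho_M\circ c_{M,A}\circ c_{A,M}=\rho_M\circ(N_A^\nu\otimes\mathrm{id}_M)$ for some $\nu\in\{0,1\}$; the minimal such $\nu$ is its degree. A module has pure degree $\nu$, written $\deg M=\nu$, if each of its non-zero direct summands is Nakayama-local of degree $\nu$. Let $\mathcal C_A^{\mathrm{N\text{-}loc}}$ be the category of $A$-modules that are finite direct sums of Nakayama-local modules, with $\mathbb Z_2$ acting by $T(M,\rho_M)=(M,\rho_M\circ(N_A\otimes\mathrm{id}_M))$, and let $\mathcal L_A^{\mathrm{spin}}$ be its $\mathbb Z_2$-equivariantisation: objects are triples $(M,\rho_M,t_M)$ with $(M,\rho_M)\in\mathcal C_A^{\mathrm{N\text{-}loc}}$ and $t_M:M\to M$ satisfying $t_M\circ\rho_M=\rho_M\circ(N_A\otimes t_M)$ and $t_M^2=\mathrm{id}_M$; morphisms are the module maps commuting with the $t$'s. Then every object of $\mathcal L_A^{\mathrm{spin}}$ is a direct sum of an object of pure degree $0$ and an object of pure degree $1$, and $\mathcal L_A^{\mathrm{spin}}$ is a ribbon category with the following structure.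 * The tensor product $M\otimes_A N$ is the image, with inclusion $\iota_{M\otimes_A N}$ and projection $\pi_{M\otimes_A N}$, of the idempotent $(\rho_M\otimes\rho_N)\circ(\mathrm{id}_A\otimes c_{A,M}\otimes\mathrm{id}_N)\circ((\Delta\circ\eta)\otimes\mathrm{id}_M\otimes\mathrm{id}_N)$ of $M\otimes N$; its action is $\pi\circ(\rho_M\otimes\mathrm{id}_N)\circ(\mathrm{id}_A\otimes\iota)$, its equivariant structure is $\pi\circ(t_M\otimes t_N)\circ\iota$, and $f\otimes_A g=\pi\circ(f\otimes g)\circ\iota$. The unit is $(A,\mu,N_A)$. The associator is induced by that of $\mathcal C$, and the unit isomorphisms are $\rho_M\circ\iota_{A\otimes_A M}$ and $\rho_M\circ c_{A,M}^{-1}\circ\iota_{M\otimes_A A}$. * For $M$ of pure degree, the braiding is $\hat c_{M,N}=\pi_{N\otimes_A M}\circ(t_N^{\deg M}\otimes\mathrm{id}_M)\circ c_{M,N}\circ\iota_{M\otimes_A N}$. * The dual of $M$ is $M^*$ with the action determined by $\mathrm{ev}_M\circ(\rho_{M^*}\otimes\mathrm{id}_M)=\mathrm{ev}_M\circ(\mathrm{id}_{M^*}\otimes\rho_M)\circ(c_{A,M^*}\otimes\mathrm{id}_M)$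 and with $t_{M^*}=(t_M)^*$, and $$\widehat{\mathrm{coev}}_M=\pi_{M\otimes_A M^*}\circ(\rho_M\otimes\mathrm{id}_{M^*})\circ(\mathrm{id}_A\otimes\mathrm{coev}_M),$$ $$\widehat{\mathrm{ev}}_M=\big(\mathrm{id}_A\otimes\mathrm{ev}_M\circ(\mathrm{id}_{M^*}\otimes\rho_M)\circ(c_{A,M^*}\otimes\mathrm{id}_M)\big)\circ\big((\Delta\circ\eta)\otimes\iota_{M^*\otimes_A M}\big).$$ * For $M$ of pure degree, the twist is $\hat\theta_M=t_M^{1+\deg M}\circ\theta_M$ (exponent modulo $2$). * The (co)evaluations of the opposite handedness, obtained from $\hat c$, $\hat\theta$, $\widehat{\mathrm{ev}}$, $\widehat{\mathrm{coev}}$ by the same formulas as in $\mathcal C$, are $$\pi_{M^*\otimes_A M}\circ(\rho_{M^*}\otimes t_M)\circ(\mathrm{id}_A\otimes\widetilde{\mathrm{coev}}_M)\quad\text{and}\quad\big(\mathrm{id}_A\otimes\widetilde{\mathrm{ev}}_M\circ((t_M\circ\rho_M)\otimes\mathrm{id}_{M^*})\big)\circ\big((\Delta\circ\eta)\otimes\iota_{M\otimes_A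 M^*}\big).$$ -/

import Mathlib

open CategoryTheory MonoidalCategory MonObj ComonObj Limits

universe w v u

noncomputable section

namespace SpinDefects

/-! ### Ribbon categories -/

section Ribbon

/-- A ribbon structure on a braided monoidal category in which every object `X` has a dual `Xᘁ`,
with (co)evaluations `ε_ X Xᘁ : Xᘁ ⊗ X ⟶ 𝟙_ C` and `η_ X Xᘁ : 𝟙_ C ⟶ X ⊗ Xᘁ`: a natural family of
isomorphisms `θ_X : X ⟶ X` (the twist) with `θ_{X ⊗ Y} = c_{Y,X} ∘ c_{X,Y} ∘ (θ_X ⊗ θ_Y)`,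
`θ_1 = id` and `θ_{X*} = (θ_X)*`. -/
class RibbonCategory (C : Type u) [Category.{v} C] [MonoidalCategory C] [BraidedCategory C]
    [RightRigidCategory C] where
  twist : ∀ X : C, X ≅ X
  twist_naturality : ∀ {X Y : C} (f : X ⟶ Y), (twist X).hom ≫ f = f ≫ (twist Y).hom
  twist_tensor : ∀ X Y : C, (twist (X ⊗ Y)).hom =
    ((twist X).hom ⊗ₘ (twist Y).hom) ≫ (β_ X Y).hom ≫ (β_ Y X).hom
  twist_unit : (twist (𝟙_ C)).hom = 𝟙 (𝟙_ C)
  twist_dual : ∀ X : C, (twist (Xᘁ)).hom = rightAdjointMate (twist X).hom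

variable {C : Type u} [Category.{v} C] [MonoidalCategory C] [BraidedCategory C]
  [RightRigidCategory C] [RibbonCategory C]

/-- The ribbon twist `θ_X`. -/
def twist (X : C) : X ⟶ X := (RibbonCategory.twist X).hom

/-- The evaluation of the opposite handedness in a ribbon category,
`ev_X ∘ c_{X,X*} ∘ (θ_X ⊗ id) : X ⊗ X* ⟶ 1`. -/
def oppEv (X : C) : X ⊗ Xᘁ ⟶ 𝟙_ C :=
  (twist X ▷ Xᘁ) ≫ (β_ X Xᘁ).hom ≫ ε_ X Xᘁ

/-- The coevaluation of the opposite handedness in a ribbon category,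
`(id ⊗ θ_X) ∘ c_{X,X*} ∘ coev_X : 1 ⟶ X* ⊗ X`. -/
def oppCoev (X : C) : 𝟙_ C ⟶ Xᘁ ⊗ X :=
  η_ X Xᘁ ≫ (β_ X Xᘁ).hom ≫ (Xᘁ ◁ twist X)

end Ribbon

/-! ### Frobenius algebras -/

section Frobenius

variable {C : Type u} [Category.{v} C] [MonoidalCategory C]

/-- The Frobenius relation
`(id ⊗ μ) ∘ (Δ ⊗ id) = Δ ∘ μ = (μ ⊗ id) ∘ (id ⊗ Δ)` between an algebra structure and a coalgebra
structure on the same object. -/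
class IsFrobenius (A : C) [MonObj A] [ComonObj A] : Prop where
  comul_mul_right : (Δ[A] ▷ A) ≫ (α_ A A A).hom ≫ (A ◁ μ[A]) = μ[A] ≫ Δ[A]
  comul_mul_left : (A ◁ Δ[A]) ≫ (α_ A A A).inv ≫ (μ[A] ▷ A) = μ[A] ≫ Δ[A]

/-- The copairing `Δ ∘ η : 1 ⟶ A ⊗ A`. -/
def copairing (A : C) [MonObj A] [ComonObj A] : 𝟙_ C ⟶ A ⊗ A := η[A] ≫ Δ[A]

/-- The Frobenius pairing `ε ∘ μ : A ⊗ A ⟶ 1`. -/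
def pairing (A : C) [MonObj A] [ComonObj A] : A ⊗ A ⟶ 𝟙_ C := μ[A] ≫ ε[A]

/-- The Nakayama automorphism of a Frobenius algebra `A` in a ribbon category,
`N_A = (ev_A ⊗ id) ∘ (id ⊗ (Δ ∘ η)) ∘ (id ⊗ (ε ∘ μ)) ∘ (oppCoev_A ⊗ id)`. It is the endomorphism
with `Φ ∘ N_A = Φ'`, where `Φ, Φ' : A ⟶ A*` are the two isomorphisms obtained from the pairing
`ε ∘ μ` by bending the second, respectively the first argument. -/
def nakayama [BraidedCategory C] [RightRigidCategory C] [RibbonCategory C]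
    (A : C) [MonObj A] [ComonObj A] : A ⟶ A :=
  (λ_ A).inv ≫ (oppCoev A ▷ A) ≫ (α_ (Aᘁ) A A).hom ≫
    (Aᘁ ◁ (pairing A ≫ copairing A)) ≫
    (α_ (Aᘁ) A A).inv ≫ (ε_ A Aᘁ ▷ A) ≫ (λ_ A).hom

/-- The power `f ^ ν` of an endomorphism for an exponent `ν ∈ ℤ/2`, with representatives `0, 1`. -/
def pow2 {X : C} (f : X ⟶ X) (ν : ZMod 2) : X ⟶ X := if ν = 0 then 𝟙 X else f

end Frobenius

/-! ### Nakayama-local modules -/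

section Modules

variable {C : Type u} [Category.{v} C] [MonoidalCategory C]

/-- The action `ρ_M : A ⊗ M ⟶ M` of a left module. -/
def act {A : C} [MonObj A] (M : Mod C A) : A ⊗ M.X ⟶ M.X := ModObj.smul (M := A) (X := M.X)

variable [BraidedCategory C] [RightRigidCategory C] [RibbonCategory C]
  {A : C} [MonObj A] [ComonObj A]

/-- The locality condition `ρ_M ∘ c_{M,A} ∘ c_{A,M} = ρ_M ∘ (N_A ^ ν ⊗ id)`. -/
def IsNakayamaLocalAt (M : Mod C A) (ν : ZMod 2) : Prop :=
  (β_ A M.X).hom ≫ (β_ M.X A).hom ≫ act M = (pow2 (nakayama A) ν ▷ M.X) ≫ act M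

/-- A module is Nakayama-local if the locality condition holds for some `ν ∈ ℤ/2`. -/
def IsNakayamaLocal (M : Mod C A) : Prop := ∃ ν : ZMod 2, IsNakayamaLocalAt M ν

/-- The degree of a Nakayama-local module is the minimal `ν` in the locality condition. -/
def IsDegree (M : Mod C A) (ν : ZMod 2) : Prop :=
  IsNakayamaLocalAt M ν ∧ ∀ ν' : ZMod 2, IsNakayamaLocalAt M ν' → ν.val ≤ ν'.val

/-- `M` is of pure degree `ν`: every non-zero direct summand of `M` has degree `ν`. (If `A` is
haploid, this holds for every Nakayama-local module of degree `ν`. If `A` is a product of a symmetric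
and a non-symmetric algebra, an odd module can have an even summand.) -/
def IsPure (M : Mod C A) (ν : ZMod 2) : Prop :=
  ∀ S : Mod C A, Nonempty (Retract S M) → ¬ IsZero S.X → IsDegree S ν

/-- `M` is a finite direct sum, in the category of `A`-modules, of Nakayama-local modules. -/
def IsNLoc [Preadditive C] (M : Mod C A) : Prop :=
  ∃ (n : ℕ) (S : Fin n → Mod C A) (i : ∀ j, S j ⟶ M) (p : ∀ j, M ⟶ S j),
    (∀ j, IsNakayamaLocal (S j)) ∧
    (∀ j, i j ≫ p j = 𝟙 (S j)) ∧
    (∀ j l, j ≠ l → (i j ≫ p l).hom = 0) ∧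
    ∑ j, (p j).hom ≫ (i j).hom = 𝟙 M.X

end Modules

/-! ### The category of spin line defects -/

section SpinLine

variable {C : Type u} [Category.{v} C] [Preadditive C] [MonoidalCategory C] [BraidedCategory C]
  [RightRigidCategory C] [RibbonCategory C]

/-- An object of the `ℤ/2`-equivariantisation of the category of (direct sums of) Nakayama-local
`A`-modules, where the generator of `ℤ/2` acts by sending `(M, ρ_M)` to `T(M) = (M, ρ_M ∘ (N_A ⊗ id))`.
The equivariant structure is a module map `t_M : M ⟶ T(M)` with `t_M ∘ t_M = id`. -/
structure SpinLine (A : C) [MonObj A] [ComonObj A] where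
  toMod : Mod C A
  nloc : IsNLoc toMod
  t : toMod.X ⟶ toMod.X
  act_t : act toMod ≫ t = (A ◁ t) ≫ (nakayama A ▷ toMod.X) ≫ act toMod
  t_t : t ≫ t = 𝟙 toMod.X

namespace SpinLine

variable {A : C} [MonObj A] [ComonObj A]

/-- The underlying object of `C`. -/
abbrev X (M : SpinLine A) : C := M.toMod.X

/-- The action `ρ_M`. -/
abbrev ρ (M : SpinLine A) : A ⊗ M.X ⟶ M.X := act M.toMod

/-- Morphisms of the equivariantisation: `A`-module maps commuting with the `t`'s. -/
@[ext]
structure Hom (M N : SpinLine A) where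
  hom : M.X ⟶ N.X
  act_hom : M.ρ ≫ hom = (A ◁ hom) ≫ N.ρ
  t_hom : M.t ≫ hom = hom ≫ N.t

instance : Category (SpinLine A) where
  Hom M N := Hom M N
  id M := ⟨𝟙 M.X, by simp, by simp⟩
  comp f g := ⟨f.hom ≫ g.hom,
    by rw [← Category.assoc, f.act_hom, Category.assoc, g.act_hom, MonoidalCategory.whiskerLeft_comp,
      Category.assoc],
    by rw [← Category.assoc, f.t_hom, Category.assoc, g.t_hom, Category.assoc]⟩
  id_comp f := Hom.ext (Category.id_comp f.hom)
  comp_id f := Hom.ext (Category.comp_id f.hom)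
  assoc f g h := Hom.ext (Category.assoc f.hom g.hom h.hom)

/-- `M` is the direct sum of a spin line defect of pure degree `0` and one of pure degree `1`. -/
def IsSumOfPure (M : SpinLine A) : Prop :=
  ∃ (S : ZMod 2 → SpinLine A) (i : ∀ ν, S ν ⟶ M) (p : ∀ ν, M ⟶ S ν),
    (∀ ν, IsPure (S ν).toMod ν) ∧
    (∀ ν, i ν ≫ p ν = 𝟙 (S ν)) ∧
    (∀ ν ν', ν ≠ ν' → (i ν ≫ p ν').hom = 0) ∧
    ∑ ν, (p ν).hom ≫ (i ν).hom = 𝟙 M.X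

/-- The idempotent `(ρ_M ⊗ ρ_N) ∘ (id ⊗ c_{A,M} ⊗ id) ∘ ((Δ ∘ η) ⊗ id ⊗ id)` of `M ⊗ N` whose image
is `M ⊗_A N`. -/
def projector (M N : SpinLine A) : M.X ⊗ N.X ⟶ M.X ⊗ N.X :=
  (λ_ (M.X ⊗ N.X)).inv ≫ (copairing A ▷ (M.X ⊗ N.X)) ≫
    (α_ A A (M.X ⊗ N.X)).hom ≫ (A ◁ (α_ A M.X N.X).inv) ≫
    (A ◁ ((β_ A M.X).hom ▷ N.X)) ≫ (A ◁ (α_ M.X A N.X).hom) ≫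
    (α_ A M.X (A ⊗ N.X)).inv ≫ (M.ρ ⊗ₘ N.ρ)

/-- `ev_M ∘ (id ⊗ ρ_M) ∘ (c_{A,M*} ⊗ id) : A ⊗ M* ⊗ M ⟶ 1`. -/
def actEv (M : SpinLine A) : A ⊗ (M.X)ᘁ ⊗ M.X ⟶ 𝟙_ C :=
  (α_ A ((M.X)ᘁ) M.X).inv ≫ ((β_ A ((M.X)ᘁ)).hom ▷ M.X) ≫ (α_ ((M.X)ᘁ) A M.X).hom ≫
    ((M.X)ᘁ ◁ M.ρ) ≫ ε_ M.X (M.X)ᘁ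

/-- The action of `A` on `M*`, dual to `ρ_M`: it is determined by
`ev_M ∘ (ρ_{M*} ⊗ id) = ev_M ∘ (id ⊗ ρ_M) ∘ (c_{A,M*} ⊗ id)`. -/
def dualAct (M : SpinLine A) : A ⊗ (M.X)ᘁ ⟶ (M.X)ᘁ :=
  (ρ_ (A ⊗ (M.X)ᘁ)).inv ≫ ((A ⊗ (M.X)ᘁ) ◁ η_ M.X (M.X)ᘁ) ≫
    (α_ (A ⊗ (M.X)ᘁ) M.X ((M.X)ᘁ)).inv ≫ ((α_ A ((M.X)ᘁ) M.X).hom ▷ (M.X)ᘁ) ≫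
    (M.actEv ▷ (M.X)ᘁ) ≫ (λ_ ((M.X)ᘁ)).hom

/-- `(id_A ⊗ (ev_M ∘ (id ⊗ ρ_M) ∘ (c_{A,M*} ⊗ id))) ∘ ((Δ ∘ η) ⊗ id) : M* ⊗ M ⟶ A`. -/
def evA (M : SpinLine A) : (M.X)ᘁ ⊗ M.X ⟶ A :=
  (λ_ ((M.X)ᘁ ⊗ M.X)).inv ≫ (copairing A ▷ ((M.X)ᘁ ⊗ M.X)) ≫
    (α_ A A ((M.X)ᘁ ⊗ M.X)).hom ≫ (A ◁ M.actEv) ≫ (ρ_ A).hom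

/-- `(ρ_M ⊗ id) ∘ (id_A ⊗ coev_M) : A ⟶ M ⊗ M*`. -/
def coevA (M : SpinLine A) : A ⟶ M.X ⊗ (M.X)ᘁ :=
  (ρ_ A).inv ≫ (A ◁ η_ M.X (M.X)ᘁ) ≫ (α_ A M.X ((M.X)ᘁ)).inv ≫ (M.ρ ▷ (M.X)ᘁ)

/-- `(id_A ⊗ (oppEv_M ∘ (t_M ∘ ρ_M ⊗ id))) ∘ ((Δ ∘ η) ⊗ id) : M ⊗ M* ⟶ A`. -/
def oppEvA (M : SpinLine A) : M.X ⊗ (M.X)ᘁ ⟶ A :=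
  (λ_ (M.X ⊗ (M.X)ᘁ)).inv ≫ (copairing A ▷ (M.X ⊗ (M.X)ᘁ)) ≫
    (α_ A A (M.X ⊗ (M.X)ᘁ)).hom ≫
    (A ◁ ((α_ A M.X ((M.X)ᘁ)).inv ≫ ((M.ρ ≫ M.t) ▷ (M.X)ᘁ) ≫ oppEv M.X)) ≫ (ρ_ A).hom

/-- `(ρ_{M*} ⊗ t_M) ∘ (id_A ⊗ oppCoev_M) : A ⟶ M* ⊗ M`. -/
def oppCoevA (M : SpinLine A) : A ⟶ (M.X)ᘁ ⊗ M.X :=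
  (ρ_ A).inv ≫ (A ◁ oppCoev M.X) ≫ (α_ A ((M.X)ᘁ) M.X).inv ≫ (M.dualAct ⊗ₘ M.t)

/-- The given ribbon category structure on `SpinLine A` is the one determined by the listed
structure maps. Here `incl M N`, `proj M N` exhibit the underlying object of `M ⊗ N` as the image
`M ⊗_A N` of the projector, and `e`, `d M` identify the underlying objects of the tensor unit and
of the dual of `M` with `A` and with the dual of `M` in `C`. -/
structure IsSpinRibbonStructure (A : C) [MonObj A] [ComonObj A]
    [MonoidalCategory (SpinLine A)] [BraidedCategory (SpinLine A)]
    [RightRigidCategory (SpinLine A)] [RibbonCategory (SpinLine A)]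
    (incl : ∀ M N : SpinLine A, (M ⊗ N).X ⟶ M.X ⊗ N.X)
    (proj : ∀ M N : SpinLine A, M.X ⊗ N.X ⟶ (M ⊗ N).X)
    (e : (𝟙_ (SpinLine A)).X ≅ A)
    (d : ∀ M : SpinLine A, (Mᘁ).X ≅ (M.X)ᘁ) : Prop where
  incl_proj : ∀ M N : SpinLine A, incl M N ≫ proj M N = 𝟙 (M ⊗ N).X
  proj_incl : ∀ M N : SpinLine A, proj M N ≫ incl M N = projector M N
  tensor_act : ∀ M N : SpinLine A, (M ⊗ N).ρ =
    (A ◁ incl M N) ≫ (α_ A M.X N.X).inv ≫ (M.ρ ▷ N.X) ≫ proj M N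
  tensor_t : ∀ M N : SpinLine A, (M ⊗ N).t = incl M N ≫ (M.t ⊗ₘ N.t) ≫ proj M N
  tensor_hom : ∀ {M M' N N' : SpinLine A} (f : M ⟶ M') (g : N ⟶ N'),
    (f ⊗ₘ g).hom = incl M N ≫ (f.hom ⊗ₘ g.hom) ≫ proj M' N'
  unit_act : (𝟙_ (SpinLine A)).ρ ≫ e.hom = (A ◁ e.hom) ≫ μ[A]
  unit_t : (𝟙_ (SpinLine A)).t ≫ e.hom = e.hom ≫ nakayama A
  associator : ∀ M N P : SpinLine A, (α_ M N P).hom.hom =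
    incl (M ⊗ N) P ≫ (incl M N ▷ P.X) ≫ (α_ M.X N.X P.X).hom ≫ (M.X ◁ proj N P) ≫ proj M (N ⊗ P)
  left_unitor : ∀ M : SpinLine A, (λ_ M).hom.hom =
    incl (𝟙_ (SpinLine A)) M ≫ (e.hom ▷ M.X) ≫ M.ρ
  right_unitor : ∀ M : SpinLine A, (ρ_ M).hom.hom =
    incl M (𝟙_ (SpinLine A)) ≫ (M.X ◁ e.hom) ≫ (β_ A M.X).inv ≫ M.ρ
  braiding : ∀ (M N : SpinLine A) (ν : ZMod 2), IsPure M.toMod ν →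
    (β_ M N).hom.hom = incl M N ≫ (β_ M.X N.X).hom ≫ (pow2 N.t ν ▷ M.X) ≫ proj N M
  dual_act : ∀ M : SpinLine A, (Mᘁ).ρ ≫ (d M).hom = (A ◁ (d M).hom) ≫ M.dualAct
  dual_t : ∀ M : SpinLine A, (Mᘁ).t ≫ (d M).hom = (d M).hom ≫ rightAdjointMate M.t
  coev : ∀ M : SpinLine A, e.inv ≫ (η_ M Mᘁ).hom =
    M.coevA ≫ (M.X ◁ (d M).inv) ≫ proj M (Mᘁ)
  ev : ∀ M : SpinLine A, (ε_ M Mᘁ).hom ≫ e.hom =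
    incl (Mᘁ) M ≫ ((d M).hom ▷ M.X) ≫ M.evA
  twist : ∀ (M : SpinLine A) (ν : ZMod 2), IsPure M.toMod ν →
    (twist M).hom = SpinDefects.twist M.X ≫ pow2 M.t (1 + ν)
  opp_coev : ∀ M : SpinLine A, e.inv ≫ (oppCoev M).hom =
    M.oppCoevA ≫ ((d M).inv ▷ M.X) ≫ proj (Mᘁ) M
  opp_ev : ∀ M : SpinLine A, (oppEv M).hom ≫ e.hom =
    incl M (Mᘁ) ≫ (M.X ◁ (d M).hom) ≫ M.oppEvA

end SpinLine

end SpinLine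

end SpinDefects

end

/-! For a commutative Frobenius algebra the Nakayama automorphism is the twist: `nakayama_eq_twist`
gives N_A = θ_A. Naturality of the twist against pairing, copairing and multiplication makes θ_A an
involutive algebra automorphism (`twist_twist`, `twist_mul`) and the copairing invariant under the
braiding (`copairing_braiding`).

Write the copairing as Σ x_i ⊗ y_i. Every module carries the canonical endomorphism `qop`: act with
the monodromy action of y_i, then with x_i. It is the identity on a local module of degree 0. If the
locality condition holds with ν = 1, it is `aop`, the action of Σ x_i θ(y_i), an idempotent
projecting onto the part on which θ_A acts trivially. That part is also local of degree 0, and it is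
exactly the obstruction to pure degree 1. So `qop` and its complement split every finite sum of
Nakayama-local modules into pure parts (`isGrading_of_isNLoc`). Given by a formula natural in module
maps, the grading is unique (`IsGrading.eq_gr`) and respected by morphisms and by t. Conversely a
graded module is a sum of local ones (`isNLoc_of_isGrading`), so membership of tensor products and
duals is proved by exhibiting a grading.

M ⊗_A N is the image of the separability idempotent of two commuting actions. A map out of M ⊗ N
descends if it does not distinguish the two actions, and identities are checked after precomposing
with the split projections, which reduces the coherence axioms to those of C. Degrees add because
the monodromy around M ⊗ N is composed of those around M and N (`mact_tρ`).

The braiding of C fails to descend when M is odd: it turns the action on N into the monodromy action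
on M, which differs by θ_A. Since t_N is θ_A-semilinear, inserting t_N to the power of the degree of
M (the operator `deg`) repairs this (`deg_braiding_balanced`). One hexagon then expresses that t on
N ⊗_A K is t_N ⊗ t_K, the other that degrees add.

By the balancing axiom, locality of degree ν says that θ_M is semilinear over θ_A^{1+ν} (`loc_iff`).
Hence t^{1+ν} θ_M is linear, which gives the twist. The same criterion mentions no monodromy and is
self-dual, so it also grades the dual. In the duality maps of opposite handedness, t^ν from the
braiding and t^{1+ν} from the twist multiply to t. -/

set_option linter.unusedSectionVars false

noncomputable section

namespace SpinDefects

/-! ### String calculus at the head of right-nested tensor products -/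

section Nested

variable {C : Type u} [Category.{v} C] [MonoidalCategory C]

/-- A morphism `X ⊗ Y ⟶ W` applied to the first two factors of `X ⊗ (Y ⊗ Z)`. -/
def tail {X Y W : C} (f : X ⊗ Y ⟶ W) (Z : C) : X ⊗ Y ⊗ Z ⟶ W ⊗ Z := (α_ X Y Z).inv ≫ f ▷ Z

/-- A pairing applied to the first two factors of `X ⊗ (Y ⊗ Z)`. -/
def cap {X Y : C} (f : X ⊗ Y ⟶ 𝟙_ C) (Z : C) : X ⊗ Y ⊗ Z ⟶ Z :=
  (α_ X Y Z).inv ≫ f ▷ Z ≫ (λ_ Z).hom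

/-- A copairing inserted to the left of `Z`. -/
def cup {X Y : C} (f : 𝟙_ C ⟶ X ⊗ Y) (Z : C) : Z ⟶ X ⊗ Y ⊗ Z :=
  (λ_ Z).inv ≫ f ▷ Z ≫ (α_ X Y Z).hom

/-- A morphism `𝟙 ⟶ X` inserted to the left of `Z`. -/
def ins {X : C} (f : 𝟙_ C ⟶ X) (Z : C) : Z ⟶ X ⊗ Z := (λ_ Z).inv ≫ f ▷ Z

theorem tail_nat {X Y W Z Z' : C} (f : X ⊗ Y ⟶ W) (g : Z ⟶ Z') :
    X ◁ Y ◁ g ≫ tail f Z' = tail f Z ≫ W ◁ g := by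
  rw [tail, tail, associator_inv_naturality_right_assoc, whisker_exchange, Category.assoc]

theorem cap_nat {X Y Z Z' : C} (f : X ⊗ Y ⟶ 𝟙_ C) (g : Z ⟶ Z') :
    X ◁ Y ◁ g ≫ cap f Z' = cap f Z ≫ g := by
  rw [cap, cap, associator_inv_naturality_right_assoc, whisker_exchange_assoc]
  simp

theorem cup_nat {X Y Z Z' : C} (f : 𝟙_ C ⟶ X ⊗ Y) (g : Z ⟶ Z') :
    cup f Z ≫ X ◁ Y ◁ g = g ≫ cup f Z' := by
  simp only [cup, Category.assoc]
  rw [← associator_naturality_right, ← whisker_exchange_assoc]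
  simp

theorem ins_nat {X Z Z' : C} (f : 𝟙_ C ⟶ X) (g : Z ⟶ Z') :
    ins f Z ≫ X ◁ g = g ≫ ins f Z' := by
  simp [ins, ← whisker_exchange]

theorem tail_comp {X Y W W' : C} (f : X ⊗ Y ⟶ W) (g : W ⟶ W') (Z : C) :
    tail (f ≫ g) Z = tail f Z ≫ g ▷ Z := by
  simp [tail]

theorem tail_whiskerLeft_comp {X Y Y' W : C} (g : Y ⟶ Y') (f : X ⊗ Y' ⟶ W) (Z : C) :
    tail (X ◁ g ≫ f) Z = X ◁ g ▷ Z ≫ tail f Z := by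
  simp [tail]

theorem tail_whiskerRight_comp {X X' Y W : C} (g : X ⟶ X') (f : X' ⊗ Y ⟶ W) (Z : C) :
    tail (g ▷ Y ≫ f) Z = g ▷ (Y ⊗ Z) ≫ tail f Z := by
  simp [tail]

/-- The digits in these names count the factors on the two sides of the equation, 0 standing for the
identity. They whisker an equation while keeping each factor separate, so that the result can be
rewritten inside longer composites. -/
theorem whisker20 (X : C) {Y P0 : C} {f0 : Y ⟶ P0} {f1 : P0 ⟶ Y}
    (h : f0 ≫ f1 = 𝟙 Y) :
    X ◁ f0 ≫ X ◁ f1 = 𝟙 (X ⊗ Y) := by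
  simpa using congrArg (X ◁ ·) h

theorem whisker21 (X : C) {Y P0 Z : C} {f0 : Y ⟶ P0} {f1 : P0 ⟶ Z}
    {g0 : Y ⟶ Z} (h : f0 ≫ f1 = g0) :
    X ◁ f0 ≫ X ◁ f1 = X ◁ g0 := by
  simpa using congrArg (X ◁ ·) h

theorem whisker22 (X : C) {Y P0 Z Q0 : C} {f0 : Y ⟶ P0} {f1 : P0 ⟶ Z}
    {g0 : Y ⟶ Q0} {g1 : Q0 ⟶ Z} (h : f0 ≫ f1 = g0 ≫ g1) :
    X ◁ f0 ≫ X ◁ f1 = X ◁ g0 ≫ X ◁ g1 := by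
  simpa using congrArg (X ◁ ·) h

theorem whisker23 (X : C) {Y P0 Z Q0 Q1 : C} {f0 : Y ⟶ P0} {f1 : P0 ⟶ Z}
    {g0 : Y ⟶ Q0} {g1 : Q0 ⟶ Q1} {g2 : Q1 ⟶ Z} (h : f0 ≫ f1 = g0 ≫ g1 ≫ g2) :
    X ◁ f0 ≫ X ◁ f1 = X ◁ g0 ≫ X ◁ g1 ≫ X ◁ g2 := by
  simpa using congrArg (X ◁ ·) h

theorem whisker30 (X : C) {Y P0 P1 : C} {f0 : Y ⟶ P0} {f1 : P0 ⟶ P1} {f2 : P1 ⟶ Y}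
    (h : f0 ≫ f1 ≫ f2 = 𝟙 Y) :
    X ◁ f0 ≫ X ◁ f1 ≫ X ◁ f2 = 𝟙 (X ⊗ Y) := by
  simpa using congrArg (X ◁ ·) h

theorem whisker31 (X : C) {Y P0 P1 Z : C} {f0 : Y ⟶ P0} {f1 : P0 ⟶ P1} {f2 : P1 ⟶ Z}
    {g0 : Y ⟶ Z} (h : f0 ≫ f1 ≫ f2 = g0) :
    X ◁ f0 ≫ X ◁ f1 ≫ X ◁ f2 = X ◁ g0 := by
  simpa using congrArg (X ◁ ·) h

theorem whisker32 (X : C) {Y P0 P1 Z Q0 : C} {f0 : Y ⟶ P0} {f1 : P0 ⟶ P1} {f2 : P1 ⟶ Z}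
    {g0 : Y ⟶ Q0} {g1 : Q0 ⟶ Z} (h : f0 ≫ f1 ≫ f2 = g0 ≫ g1) :
    X ◁ f0 ≫ X ◁ f1 ≫ X ◁ f2 = X ◁ g0 ≫ X ◁ g1 := by
  simpa using congrArg (X ◁ ·) h

theorem whisker33 (X : C) {Y P0 P1 Z Q0 Q1 : C} {f0 : Y ⟶ P0} {f1 : P0 ⟶ P1} {f2 : P1 ⟶ Z}
    {g0 : Y ⟶ Q0} {g1 : Q0 ⟶ Q1} {g2 : Q1 ⟶ Z} (h : f0 ≫ f1 ≫ f2 = g0 ≫ g1 ≫ g2) :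
    X ◁ f0 ≫ X ◁ f1 ≫ X ◁ f2 = X ◁ g0 ≫ X ◁ g1 ≫ X ◁ g2 := by
  simpa using congrArg (X ◁ ·) h

theorem whisker43 (X : C) {Y P0 P1 P2 Z Q0 Q1 : C} {f0 : Y ⟶ P0} {f1 : P0 ⟶ P1} {f2 : P1 ⟶ P2} {f3 : P2 ⟶ Z}
    {g0 : Y ⟶ Q0} {g1 : Q0 ⟶ Q1} {g2 : Q1 ⟶ Z} (h : f0 ≫ f1 ≫ f2 ≫ f3 = g0 ≫ g1 ≫ g2) :
    X ◁ f0 ≫ X ◁ f1 ≫ X ◁ f2 ≫ X ◁ f3 = X ◁ g0 ≫ X ◁ g1 ≫ X ◁ g2 := by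
  simpa using congrArg (X ◁ ·) h

theorem whisker41 (X : C) {Y P0 P1 P2 Z : C} {f0 : Y ⟶ P0} {f1 : P0 ⟶ P1} {f2 : P1 ⟶ P2} {f3 : P2 ⟶ Z}
    {g0 : Y ⟶ Z} (h : f0 ≫ f1 ≫ f2 ≫ f3 = g0) :
    X ◁ f0 ≫ X ◁ f1 ≫ X ◁ f2 ≫ X ◁ f3 = X ◁ g0 := by
  simpa using congrArg (X ◁ ·) h

theorem whisker44 (X : C) {Y P0 P1 P2 Z Q0 Q1 Q2 : C} {f0 : Y ⟶ P0} {f1 : P0 ⟶ P1} {f2 : P1 ⟶ P2} {f3 : P2 ⟶ Z}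
    {g0 : Y ⟶ Q0} {g1 : Q0 ⟶ Q1} {g2 : Q1 ⟶ Q2} {g3 : Q2 ⟶ Z} (h : f0 ≫ f1 ≫ f2 ≫ f3 = g0 ≫ g1 ≫ g2 ≫ g3) :
    X ◁ f0 ≫ X ◁ f1 ≫ X ◁ f2 ≫ X ◁ f3 = X ◁ g0 ≫ X ◁ g1 ≫ X ◁ g2 ≫ X ◁ g3 := by
  simpa using congrArg (X ◁ ·) h

theorem whisker40 (X : C) {Y P0 P1 P2 : C} {f0 : Y ⟶ P0} {f1 : P0 ⟶ P1} {f2 : P1 ⟶ P2} {f3 : P2 ⟶ Y}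
    (h : f0 ≫ f1 ≫ f2 ≫ f3 = 𝟙 Y) :
    X ◁ f0 ≫ X ◁ f1 ≫ X ◁ f2 ≫ X ◁ f3 = 𝟙 (X ⊗ Y) := by
  simpa using congrArg (X ◁ ·) h

variable [BraidedCategory C]

/-- The braiding of the first two factors of `X ⊗ (Y ⊗ Z)`. -/
def brd (X Y Z : C) : X ⊗ Y ⊗ Z ⟶ Y ⊗ X ⊗ Z :=
  (α_ X Y Z).inv ≫ (β_ X Y).hom ▷ Z ≫ (α_ Y X Z).hom

/-- The inverse of `brd`. -/
def brdInv (X Y Z : C) : Y ⊗ X ⊗ Z ⟶ X ⊗ Y ⊗ Z :=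
  (α_ Y X Z).inv ≫ (β_ X Y).inv ▷ Z ≫ (α_ X Y Z).hom

theorem brd_brdInv (X Y Z : C) : brd X Y Z ≫ brdInv X Y Z = 𝟙 _ := by
  simp [brd, brdInv]

theorem brdInv_brd (X Y Z : C) : brdInv X Y Z ≫ brd X Y Z = 𝟙 _ := by
  simp [brd, brdInv]

theorem brd_nat {X Y Z Z' : C} (g : Z ⟶ Z') :
    X ◁ Y ◁ g ≫ brd X Y Z' = brd X Y Z ≫ Y ◁ X ◁ g := by
  simp only [brd, Category.assoc]
  rw [associator_inv_naturality_right_assoc, whisker_exchange_assoc, associator_naturality_right]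

theorem brd_nat_left {X X' : C} (f : X ⟶ X') (Y Z : C) :
    f ▷ (Y ⊗ Z) ≫ brd X' Y Z = brd X Y Z ≫ Y ◁ f ▷ Z := by
  simp [brd, ← comp_whiskerRight_assoc]

theorem brd_nat_mid {Y Y' : C} (X : C) (f : Y ⟶ Y') (Z : C) :
    X ◁ f ▷ Z ≫ brd X Y' Z = brd X Y Z ≫ f ▷ (X ⊗ Z) := by
  have h := congrArg (· ▷ Z) (BraidedCategory.braiding_naturality_right X f)
  simp only [comp_whiskerRight] at h
  simp only [brd, Category.assoc]
  rw [associator_inv_naturality_middle_assoc, reassoc_of% h]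
  simp

theorem brdInv_nat {X Y Z Z' : C} (g : Z ⟶ Z') :
    Y ◁ X ◁ g ≫ brdInv X Y Z' = brdInv X Y Z ≫ X ◁ Y ◁ g := by
  simp only [brdInv, Category.assoc]
  rw [associator_inv_naturality_right_assoc, whisker_exchange_assoc, associator_naturality_right]

theorem brdInv_nat_left {Y Y' : C} (X : C) (f : Y ⟶ Y') (Z : C) :
    f ▷ (X ⊗ Z) ≫ brdInv X Y' Z = brdInv X Y Z ≫ X ◁ f ▷ Z := by
  simp [brdInv, ← comp_whiskerRight_assoc]

theorem brdInv_nat_mid {X X' : C} (f : X ⟶ X') (Y Z : C) :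
    Y ◁ f ▷ Z ≫ brdInv X' Y Z = brdInv X Y Z ≫ f ▷ (Y ⊗ Z) := by
  have h := congrArg (· ▷ Z) (BraidedCategory.braiding_inv_naturality_right Y f)
  simp only [comp_whiskerRight] at h
  simp only [brdInv, Category.assoc]
  rw [associator_inv_naturality_middle_assoc, reassoc_of% h]
  simp

theorem brd_tensor_left (X Y V Z : C) : brd (X ⊗ Y) V Z =
    (α_ X Y (V ⊗ Z)).hom ≫ X ◁ brd Y V Z ≫ brd X V (Y ⊗ Z) ≫ V ◁ (α_ X Y Z).inv := by
  simp [brd, BraidedCategory.braiding_tensor_left_hom]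

theorem brd_tensor_right (V X Y Z : C) : brd V (X ⊗ Y) Z =
    V ◁ (α_ X Y Z).hom ≫ brd V X (Y ⊗ Z) ≫ X ◁ brd V Y Z ≫ (α_ X Y (V ⊗ Z)).inv := by
  simp [brd, BraidedCategory.braiding_tensor_right_hom]

theorem tail_brd {X Y W : C} (f : X ⊗ Y ⟶ W) (V Z : C) :
    tail f (V ⊗ Z) ≫ brd W V Z = X ◁ brd Y V Z ≫ brd X V (Y ⊗ Z) ≫ V ◁ tail f Z := by
  rw [tail, Category.assoc, brd_nat_left, brd_tensor_left]
  simp [tail]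

theorem brd_tail {X Y W : C} (f : X ⊗ Y ⟶ W) (V Z : C) :
    V ◁ tail f Z ≫ brd V W Z = brd V X (Y ⊗ Z) ≫ X ◁ brd V Y Z ≫ tail f (V ⊗ Z) := by
  simp [tail, brd_nat_mid, brd_tensor_right]

theorem brd_unit_left (V Z : C) : brd (𝟙_ C) V Z = (λ_ (V ⊗ Z)).hom ≫ V ◁ (λ_ Z).inv := by
  simp [brd]

theorem brd_unit_right (V Z : C) : brd V (𝟙_ C) Z = V ◁ (λ_ Z).hom ≫ (λ_ (V ⊗ Z)).inv := by
  simp [brd]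

/-- Crossing the unit is trivial, so by naturality a strand V passes freely through a cup; the
hexagon splits the crossing with X ⊗ Y in two. -/
theorem cup_brd {X Y : C} (f : 𝟙_ C ⟶ X ⊗ Y) (V Z : C) :
    cup f (V ⊗ Z) ≫ X ◁ brd Y V Z ≫ brd X V (Y ⊗ Z) = V ◁ cup f Z := by
  have h := brd_nat_left f V Z
  rw [brd_tensor_left, brd_unit_left] at h
  simp only [cup, Category.assoc]
  rw [← cancel_mono (V ◁ (α_ X Y Z).inv), ← cancel_epi (λ_ (V ⊗ Z)).hom]
  simpa using h

theorem brd_cup {X Y : C} (f : 𝟙_ C ⟶ X ⊗ Y) (V Z : C) :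
    V ◁ cup f Z ≫ brd V X (Y ⊗ Z) ≫ X ◁ brd V Y Z = cup f (V ⊗ Z) := by
  have h := brd_nat_mid V f Z
  rw [brd_tensor_right, brd_unit_right] at h
  simp only [cup, MonoidalCategory.whiskerLeft_comp, Category.assoc]
  rw [← cancel_mono (α_ X Y (V ⊗ Z)).inv, ← cancel_epi (V ◁ (λ_ Z).hom)]
  simpa using h

theorem brd_cap {X Y : C} (f : X ⊗ Y ⟶ 𝟙_ C) (V Z : C) :
    brd V X (Y ⊗ Z) ≫ X ◁ brd V Y Z ≫ cap f (V ⊗ Z) = V ◁ cap f Z := by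
  have h := brd_nat_mid V f Z
  rw [brd_tensor_right, brd_unit_right] at h
  simp only [cap, MonoidalCategory.whiskerLeft_comp]
  rw [← cancel_mono (λ_ (V ⊗ Z)).inv, ← cancel_epi (V ◁ (α_ X Y Z).hom)]
  simpa using h.symm

theorem ins_brd {X : C} (f : 𝟙_ C ⟶ X) (V Z : C) :
    ins f (V ⊗ Z) ≫ brd X V Z = V ◁ ins f Z := by
  rw [ins, Category.assoc, brd_nat_left, brd_unit_left]
  simp [ins]

theorem brd_ins {X : C} (f : 𝟙_ C ⟶ X) (V Z : C) :
    V ◁ ins f Z ≫ brd V X Z = ins f (V ⊗ Z) := by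
  simp [ins, brd_nat_mid, brd_unit_right]

/-- Naturality of the braiding in its first argument, applied to the crossing of X and Y itself. -/
theorem brd_yang_baxter (X Y V Z : C) :
    brd X Y (V ⊗ Z) ≫ Y ◁ brd X V Z ≫ brd Y V (X ⊗ Z) =
      X ◁ brd Y V Z ≫ brd X V (Y ⊗ Z) ≫ V ◁ brd X Y Z := by
  have h := brd_nat_left (β_ X Y).hom V Z
  rw [brd_tensor_left, brd_tensor_left] at h
  rw [← cancel_mono (V ◁ (α_ Y X Z).inv), ← cancel_epi (α_ X Y (V ⊗ Z)).hom]
  simp only [Category.assoc] at h ⊢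
  rw [brd, Category.assoc, Category.assoc, Iso.hom_inv_id_assoc, h]
  simp [brd]

theorem whiskerRight_braiding {X Y W : C} (f : X ⊗ Y ⟶ W) (N : C) :
    tail f N ≫ (β_ W N).hom = X ◁ (β_ Y N).hom ≫ brd X N Y ≫ N ◁ f := by
  simp [tail, brd, BraidedCategory.braiding_tensor_left_hom]

theorem whiskerLeft_braiding {X Y W : C} (f : X ⊗ Y ⟶ W) (N : C) :
    N ◁ f ≫ (β_ N W).hom = brd N X Y ≫ X ◁ (β_ N Y).hom ≫ tail f N := by
  simp [tail, brd, BraidedCategory.braiding_tensor_right_hom]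

theorem whiskerRight_braiding_inv {X Y W : C} (f : X ⊗ Y ⟶ W) (N : C) :
    tail f N ≫ (β_ N W).inv = X ◁ (β_ N Y).inv ≫ brdInv N X Y ≫ N ◁ f := by
  simp [tail, brdInv, BraidedCategory.braiding_tensor_right_inv]

theorem whiskerLeft_braiding_inv {X Y W : C} (f : X ⊗ Y ⟶ W) (N : C) :
    N ◁ f ≫ (β_ W N).inv = brdInv X N Y ≫ X ◁ (β_ Y N).inv ≫ tail f N := by
  simp [tail, brdInv, BraidedCategory.braiding_tensor_left_inv]

end Nested

/-! ### Cups, caps and duality in nested form -/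

section Duality

variable {C : Type u} [Category.{v} C] [MonoidalCategory C]

theorem cap_whiskerLeft {X Y Y' : C} (f : Y ⟶ Y') (b : X ⊗ Y' ⟶ 𝟙_ C) (Z : C) :
    X ◁ f ▷ Z ≫ cap b Z = cap (X ◁ f ≫ b) Z := by
  simp [cap]

theorem cap_whiskerRight {X X' Y : C} (f : X ⟶ X') (b : X' ⊗ Y ⟶ 𝟙_ C) (Z : C) :
    f ▷ (Y ⊗ Z) ≫ cap b Z = cap (f ▷ Y ≫ b) Z := by
  simp [cap]

theorem cup_whiskerLeft {X Y Y' : C} (g : 𝟙_ C ⟶ X ⊗ Y) (f : Y ⟶ Y') (Z : C) :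
    cup g Z ≫ X ◁ f ▷ Z = cup (g ≫ X ◁ f) Z := by
  simp [cup]

theorem cup_whiskerRight {X X' Y : C} (g : 𝟙_ C ⟶ X ⊗ Y) (f : X ⟶ X') (Z : C) :
    cup g Z ≫ f ▷ (Y ⊗ Z) = cup (g ≫ f ▷ Y) Z := by
  simp [cup]

theorem cup_unit_injective {X Y : C} {g h : 𝟙_ C ⟶ X ⊗ Y} (H : cup g (𝟙_ C) = cup h (𝟙_ C)) :
    g = h := by
  simpa [cup, unitors_equal] using H

theorem whiskerRight_unit_injective {X Y : C} {g h : X ⟶ Y} (H : g ▷ 𝟙_ C = h ▷ 𝟙_ C) : g = h := by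
  simpa using H

theorem whiskerLeft_leftUnitor_inv (X Z : C) :
    X ◁ (λ_ Z).hom ≫ (ρ_ X).inv ▷ Z = (α_ X (𝟙_ C) Z).inv := by monoidal

variable (X : C) [HasRightDual X]

theorem coev_ev (Z : C) :
    cup (η_ X Xᘁ) (X ⊗ Z) ≫ X ◁ cap (ε_ X Xᘁ) Z = 𝟙 _ := by
  have h := congrArg (· ▷ Z) (ExactPairing.evaluation_coevaluation X Xᘁ)
  simp only [comp_whiskerRight] at h
  rw [← cancel_mono ((ρ_ X).inv ▷ Z ), ← cancel_epi ((λ_ X).hom ▷ Z)]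
  simp only [Category.id_comp]
  rw [← h]
  simp [cup, cap, whiskerLeft_leftUnitor_inv]

end Duality

section Braid
variable {C : Type u} [Category.{v} C] [MonoidalCategory C] [BraidedCategory C]

theorem cup_braiding {X Y : C} (g : 𝟙_ C ⟶ X ⊗ Y) (Z : C) :
    cup g Z ≫ brd X Y Z = cup (g ≫ (β_ X Y).hom) Z := by
  simp [cup, brd]

theorem cap_braiding {X Y : C} (b : Y ⊗ X ⟶ 𝟙_ C) (Z : C) :
    brd X Y Z ≫ cap b Z = cap ((β_ X Y).hom ≫ b) Z := by
  simp [cap, brd]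

theorem tail_braiding {X Y W : C} (b : Y ⊗ X ⟶ W) (Z : C) :
    brd X Y Z ≫ tail b Z = tail ((β_ X Y).hom ≫ b) Z := by
  simp [tail, brd]

theorem brdInv_cap {X Y : C} (f : X ⊗ Y ⟶ 𝟙_ C) (V Z : C) :
    brdInv V X (Y ⊗ Z) ≫ V ◁ cap f Z = X ◁ brd V Y Z ≫ cap f (V ⊗ Z) := by
  rw [← brd_cap, reassoc_of% (brdInv_brd V X (Y ⊗ Z))]

end Braid

/-! ### Frobenius algebras: the nondegenerate pairing -/

section Alg

variable {C : Type u} [Category.{v} C] [MonoidalCategory C] {A : C} [MonObj A] [ComonObj A]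

variable (A) in
/-- The copairing of `A` inserted to the left of `Z`. -/
abbrev cop (Z : C) : Z ⟶ A ⊗ A ⊗ Z := cup (copairing A) Z

variable (A) in
/-- The multiplication applied to the first two factors of `A ⊗ (A ⊗ Z)`. -/
abbrev mulT (Z : C) : A ⊗ A ⊗ Z ⟶ A ⊗ Z := tail μ[A] Z

theorem cop_mul_right [IsFrobenius A] (Z : C) :
    cop A (A ⊗ Z) ≫ A ◁ mulT A Z = Δ[A] ▷ Z ≫ (α_ A A Z).hom := by
  have h := congrArg (fun f => (λ_ (A ⊗ Z)).inv ≫ (α_ _ _ _).inv ≫ η[A] ▷ A ▷ Z ≫ f ▷ Z ≫ (α_ _ _ _).hom)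
    (IsFrobenius.comul_mul_right (A := A))
  simp only [comp_whiskerRight, Category.assoc] at h
  rw [← comp_whiskerRight_assoc (η[A] ▷ A) μ[A], MonObj.one_mul] at h
  simp only [cup, copairing, tail]
  simpa using h

theorem mul_cop [IsFrobenius A] (Z : C) :
    A ◁ cop A Z ≫ mulT A (A ⊗ Z) = Δ[A] ▷ Z ≫ (α_ A A Z).hom := by
  have h := congrArg (fun f => A ◁ (λ_ Z).inv ≫ (α_ _ _ _).inv ≫ (A ◁ η[A]) ▷ Z ≫ f ▷ Z ≫ (α_ _ _ _).hom)
    (IsFrobenius.comul_mul_left (A := A))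
  simp only [comp_whiskerRight, Category.assoc] at h
  rw [← comp_whiskerRight_assoc (A ◁ η[A]) μ[A], MonObj.mul_one] at h
  simp only [cup, copairing, tail]
  simpa using h

theorem mul_cop_eq [IsFrobenius A] (Z : C) :
    A ◁ cop A Z ≫ mulT A (A ⊗ Z) = cop A (A ⊗ Z) ≫ A ◁ mulT A Z := by
  rw [mul_cop, cop_mul_right]

theorem cap_pairing (Z : C) : cap (pairing A) Z = mulT A Z ≫ ε[A] ▷ Z ≫ (λ_ Z).hom := by
  simp [cap, tail, pairing]

theorem cop_pairing [IsFrobenius A] (Z : C) :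
    cop A (A ⊗ Z) ≫ A ◁ cap (pairing A) Z = 𝟙 _ := by
  have h := congrArg (· ▷ Z) (ComonObj.comul_counit A)
  simp only [comp_whiskerRight] at h
  rw [cap_pairing, MonoidalCategory.whiskerLeft_comp, reassoc_of% (cop_mul_right (A := A) Z)]
  rw [← cancel_mono ((ρ_ A).inv ▷ Z)]
  simpa [whiskerLeft_leftUnitor_inv] using h

theorem pairing_cop [IsFrobenius A] (Z : C) :
    A ◁ cop A Z ≫ cap (pairing A) (A ⊗ Z) = 𝟙 _ := by
  have h := congrArg (· ▷ Z) (ComonObj.counit_comul A)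
  simp only [comp_whiskerRight] at h
  rw [cap_pairing, reassoc_of% (mul_cop (A := A) Z)]
  rw [← cancel_mono ((λ_ A).inv ▷ Z)]
  simpa using h

/-- Nondegeneracy: inserting the copairing recovers u from its pairing with A. -/
theorem pairing_ext_right [IsFrobenius A] {Z W : C} {u v : Z ⟶ A ⊗ W}
    (h : A ◁ u ≫ cap (pairing A) W = A ◁ v ≫ cap (pairing A) W) : u = v := by
  have key : ∀ u : Z ⟶ A ⊗ W, u = cop A Z ≫ A ◁ (A ◁ u ≫ cap (pairing A) W) := fun u => by
    rw [MonoidalCategory.whiskerLeft_comp, reassoc_of% (cup_nat (copairing A) u), cop_pairing,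
      Category.comp_id]
  rw [key u, key v, h]

theorem pairing_ext_left [IsFrobenius A] {X : C} {u v : 𝟙_ C ⟶ X ⊗ A}
    (h : ∀ Z, cup u (A ⊗ Z) ≫ X ◁ cap (pairing A) Z = cup v (A ⊗ Z) ≫ X ◁ cap (pairing A) Z) :
    u = v := by
  apply cup_unit_injective
  have key : ∀ u : 𝟙_ C ⟶ X ⊗ A, cup u (𝟙_ C) = cop A (𝟙_ C) ≫
      cup u (A ⊗ A ⊗ 𝟙_ C) ≫ X ◁ cap (pairing A) (A ⊗ 𝟙_ C) := fun u => by
    rw [← reassoc_of% (cup_nat u (cop A (𝟙_ C))), ← MonoidalCategory.whiskerLeft_comp,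
      pairing_cop, MonoidalCategory.whiskerLeft_id, Category.comp_id]
  rw [key u, key v, h]

end Alg

/-! ### The twist of a commutative Frobenius algebra is its Nakayama automorphism -/

section Twist

variable {C : Type u} [Category.{v} C] [MonoidalCategory C] [BraidedCategory C]
  [RightRigidCategory C] [RibbonCategory C]

theorem twist_nat {X Y : C} (f : X ⟶ Y) : twist X ≫ f = f ≫ twist Y :=
  RibbonCategory.twist_naturality f

theorem twist_unit : twist (𝟙_ C) = 𝟙 _ := RibbonCategory.twist_unit

theorem twist_tensor (X Y : C) :
    twist (X ⊗ Y) = (twist X ⊗ₘ twist Y) ≫ (β_ X Y).hom ≫ (β_ Y X).hom :=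
  RibbonCategory.twist_tensor X Y

variable {A : C} [MonObj A] [ComonObj A]

/-- A form b is the same as a map from A to its dual. The twist is natural for that map, and the
twist of the dual is the dual of the twist, so it moves to the other argument. -/
theorem twist_pairing (b : A ⊗ A ⟶ 𝟙_ C) : twist A ▷ A ≫ b = A ◁ twist A ≫ b := by
  let Φ : A ⟶ Aᘁ := (ρ_ A).inv ≫ A ◁ η_ A Aᘁ ≫ (α_ _ _ _).inv ≫ b ▷ Aᘁ ≫ (λ_ _).hom
  have hΦ : Φ ▷ A ≫ ε_ A Aᘁ = b := by
    have h := (tensorRightHomEquiv A A Aᘁ (𝟙_ C)).symm_apply_apply b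
    simp only [tensorRightHomEquiv, Equiv.coe_fn_mk, Equiv.coe_fn_symm_mk] at h
    rw [← h]
    simp [Φ, unitors_inv_equal]
  have h2 : twist Aᘁ ▷ A ≫ ε_ A Aᘁ = Aᘁ ◁ twist A ≫ ε_ A Aᘁ := by
    rw [show twist Aᘁ = rightAdjointMate (twist A) from RibbonCategory.twist_dual A]
    exact rightAdjointMate_comp_evaluation _
  rw [← hΦ, ← comp_whiskerRight_assoc, twist_nat, comp_whiskerRight_assoc, h2,
    whisker_exchange_assoc]

variable [IsFrobenius A] [IsCommMonObj A]

theorem braiding_pairing : (β_ A A).hom ≫ pairing A = pairing A := by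
  simp [pairing, ← Category.assoc, IsCommMonObj.mul_comm]

/-- The twist of the unit is trivial and the pairing absorbs the monodromy by commutativity, so
naturality gives invariance under θ ⊗ θ; both twists are then collected on one leg. -/
theorem twist_twist_pairing : A ◁ (twist A ≫ twist A) ≫ pairing A = pairing A := by
  have h := twist_nat (pairing A)
  rw [twist_tensor, twist_unit, Category.comp_id, Category.assoc, Category.assoc, braiding_pairing,
    braiding_pairing, tensorHom_def', Category.assoc, twist_pairing] at h
  simpa using h

variable (A) in
theorem twist_twist : twist A ≫ twist A = 𝟙 A := by
  apply whiskerRight_unit_injective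
  rw [← Category.comp_id ((twist A ≫ twist A) ▷ 𝟙_ C), ← cop_pairing,
    ← reassoc_of% (cup_nat (copairing A) ((twist A ≫ twist A) ▷ 𝟙_ C)),
    ← MonoidalCategory.whiskerLeft_comp, cap_whiskerLeft, twist_twist_pairing, cop_pairing]
  simp

theorem cop_twist (Z : C) : cop A Z ≫ twist A ▷ (A ⊗ Z) = cop A Z ≫ A ◁ twist A ▷ Z := by
  apply pairing_ext_right
  rw [MonoidalCategory.whiskerLeft_comp, Category.assoc, cap_whiskerLeft, ← twist_pairing,
    ← cap_whiskerRight, whisker_exchange_assoc, pairing_cop, MonoidalCategory.whiskerLeft_comp,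
    Category.assoc, cap_nat, reassoc_of% (pairing_cop (A := A) Z), Category.comp_id]

theorem copairing_twist : copairing A ≫ twist A ▷ A = copairing A ≫ A ◁ twist A := by
  apply cup_unit_injective
  rw [← cup_whiskerRight, cop_twist, cup_whiskerLeft]

theorem copairing_twist_twist :
    copairing A ≫ twist A ▷ A ≫ A ◁ twist A = copairing A := by
  rw [reassoc_of% (copairing_twist (A := A)), ← MonoidalCategory.whiskerLeft_comp, twist_twist]
  simp

/-- Naturality of the twist for the copairing: θ ⊗ θ already fixes the copairing, so the monodromy
in the balancing axiom must fix it too. -/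
theorem copairing_braiding_braiding :
    copairing A ≫ (β_ A A).hom ≫ (β_ A A).hom = copairing A := by
  have h := twist_nat (copairing A)
  rw [twist_tensor, twist_unit, Category.id_comp, MonoidalCategory.tensorHom_def, Category.assoc] at h
  rw [reassoc_of% (copairing_twist_twist (A := A))] at h
  exact h.symm

theorem cop_brd_brd (Z : C) : cop A Z ≫ brd A A Z ≫ brd A A Z = cop A Z := by
  rw [reassoc_of% (cup_braiding (copairing A) Z), cup_braiding, Category.assoc,
    copairing_braiding_braiding]

/-- A copairing inverse to a symmetric pairing is symmetric up to monodromy, and the monodromy has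
just been removed. The Yang-Baxter relation brings the crossings into the position where a strand
slides through the cup. -/
theorem copairing_braiding : copairing A ≫ (β_ A A).hom = copairing A := by
  apply pairing_ext_left
  intro Z
  have h := brd_yang_baxter A A A Z
  have h2 : brd A A (A ⊗ Z) ≫ A ◁ brd A A Z =
      A ◁ brd A A Z ≫ brd A A (A ⊗ Z) ≫ A ◁ brd A A Z ≫ brdInv A A (A ⊗ Z) := by
    rw [← reassoc_of% h, brd_brdInv, Category.comp_id]
  rw [← cup_braiding, cop_pairing, Category.assoc, ← braiding_pairing, ← cap_braiding,
    MonoidalCategory.whiskerLeft_comp, reassoc_of% h2,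
    reassoc_of% (cup_brd (copairing A) A Z), brdInv_cap, ← MonoidalCategory.whiskerLeft_comp_assoc,
    ← MonoidalCategory.whiskerLeft_comp_assoc, Category.assoc, cop_brd_brd, pairing_cop]

theorem cop_brd (Z : C) : cop A Z ≫ brd A A Z = cop A Z := by
  rw [cup_braiding, copairing_braiding]

theorem nakayama_whiskerRight (Z : C) : nakayama A ▷ Z =
    cup (oppCoev A) (A ⊗ Z) ≫ Aᘁ ◁ cap (pairing A) Z ≫ Aᘁ ◁ cop A Z ≫
      cap (ε_ A Aᘁ) (A ⊗ Z) := by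
  simp [nakayama, cup, cap]

/-- Bending one leg replaces the coevaluation of A by the copairing. The opposite coevaluation then
becomes the braided, twisted copairing; symmetry removes the braiding, and the zigzag of pairing and
copairing leaves only the twist. -/
theorem nakayama_eq_twist : nakayama A = twist A := by
  apply whiskerRight_unit_injective
  -- Ψ is chosen so that applying it to the dual leg of the coevaluation yields the copairing
  -- (`h2`).
  let Ψ : Aᘁ ⟶ A := (ρ_ Aᘁ).inv ≫ Aᘁ ◁ copairing A ≫ (α_ _ _ _).inv ≫ ε_ A Aᘁ ▷ A ≫ (λ_ A).hom
  have hΨ : ∀ Z, Aᘁ ◁ cop A Z ≫ cap (ε_ A Aᘁ) (A ⊗ Z) = Ψ ▷ Z := by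
    intro Z
    simp [cup, cap, Ψ]
  have h1 : cup (η_ A Aᘁ) (𝟙_ C) ≫ A ◁ Ψ ▷ 𝟙_ C = cop A (𝟙_ C) := by
    rw [← hΨ, MonoidalCategory.whiskerLeft_comp, reassoc_of% (cup_nat (η_ A Aᘁ) (cop A (𝟙_ C))),
      coev_ev, Category.comp_id]
  have h2 : η_ A Aᘁ ≫ A ◁ Ψ = copairing A := by
    apply cup_unit_injective
    rw [← cup_whiskerLeft, h1]
  have h3 : cup (oppCoev A) (A ⊗ 𝟙_ C) =
      cup (η_ A Aᘁ) (A ⊗ 𝟙_ C) ≫ brd A Aᘁ (A ⊗ 𝟙_ C) ≫ Aᘁ ◁ twist A ▷ (A ⊗ 𝟙_ C) := by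
    rw [reassoc_of% (cup_braiding (η_ A Aᘁ) (A ⊗ 𝟙_ C)), cup_whiskerLeft, oppCoev, Category.assoc]
  rw [nakayama_whiskerRight, hΨ, h3, Category.assoc, Category.assoc,
    ← MonoidalCategory.whiskerLeft_comp_assoc, whisker_exchange,
    cap_whiskerRight, twist_pairing, ← cap_whiskerLeft,
    ← reassoc_of% (brd_nat_mid A Ψ (A ⊗ 𝟙_ C)),
    reassoc_of% (cup_whiskerLeft (η_ A Aᘁ) Ψ (A ⊗ 𝟙_ C)), h2, reassoc_of% (cop_brd (A := A)),
    MonoidalCategory.whiskerLeft_comp, reassoc_of% (cup_nat (copairing A) (twist A ▷ 𝟙_ C)),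
    cop_pairing, Category.comp_id]

/-- Naturality of the twist for μ: the monodromy in the twist of A ⊗ A is absorbed by commutativity,
so θ_A is multiplicative. -/
theorem twist_mul (Z : C) :
    A ◁ twist A ▷ Z ≫ twist A ▷ (A ⊗ Z) ≫ mulT A Z = mulT A Z ≫ twist A ▷ Z := by
  rw [← tail_comp, ← twist_nat, twist_tensor, Category.assoc, Category.assoc,
    IsCommMonObj.mul_comm, IsCommMonObj.mul_comm, tensorHom_def', Category.assoc,
    tail_whiskerLeft_comp, tail_whiskerRight_comp]

end Twist

/-! ### Actions of the algebra -/

section Action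

variable {C : Type u} [Category.{v} C] [MonoidalCategory C] {A : C} [MonObj A]

/-- A left action of the algebra `A` on the object `Y`. -/
structure IsAct {Y : C} (r : A ⊗ Y ⟶ Y) : Prop where
  unit : ins η[A] Y ≫ r = 𝟙 Y
  assoc : A ◁ r ≫ r = mulT A Y ≫ r

theorem IsAct.tail {Y : C} {r : A ⊗ Y ⟶ Y} (h : IsAct r) (Z : C) : IsAct (tail r Z) where
  unit := by
    have := congrArg (· ▷ Z) h.unit
    simp only [ins, comp_whiskerRight, Category.assoc] at this
    simpa [ins, SpinDefects.tail] using this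
  assoc := by
    have := congrArg (fun f => (α_ _ _ _).inv ≫ (α_ _ _ _).inv ≫
      (α_ _ _ _).hom ▷ Z ≫ f ▷ Z) h.assoc
    simpa [SpinDefects.tail] using this

theorem isAct_mul : IsAct μ[A] where
  unit := by simp [ins]
  assoc := by simp [tail]

variable [BraidedCategory C]

theorem IsAct.brd_whiskerLeft {Y : C} {r : A ⊗ Y ⟶ Y} (h : IsAct r) (M : C) :
    IsAct (brd A M Y ≫ M ◁ r) where
  unit := by
    rw [reassoc_of% (ins_brd η[A] M Y), ← MonoidalCategory.whiskerLeft_comp, h.unit]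
    simp
  assoc := by
    rw [MonoidalCategory.whiskerLeft_comp, Category.assoc, reassoc_of% (brd_nat (X := A) (Y := M) r),
      reassoc_of% (tail_brd μ[A] M Y), ← MonoidalCategory.whiskerLeft_comp,
      ← MonoidalCategory.whiskerLeft_comp, h.assoc]

theorem brd_mul [IsCommMonObj A] (Z : C) : brd A A Z ≫ mulT A Z = mulT A Z := by
  rw [tail_braiding, IsCommMonObj.mul_comm]

theorem IsAct.comm [IsCommMonObj A] {Y : C} {r : A ⊗ Y ⟶ Y} (h : IsAct r) :
    brd A A Y ≫ A ◁ r ≫ r = A ◁ r ≫ r := by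
  rw [h.assoc, reassoc_of% (brd_mul (A := A) Y)]

end Action

/-! ### Separability -/

section Separable

variable {C : Type u} [Category.{v} C] [MonoidalCategory C]

/-- A Frobenius algebra whose comultiplication is a section of its multiplication. -/
class IsSeparableFrobenius (A : C) [MonObj A] [ComonObj A] : Prop extends IsFrobenius A where
  comul_mul : Δ[A] ≫ μ[A] = 𝟙 A

variable {A : C} [MonObj A] [ComonObj A] [IsSeparableFrobenius A]

theorem cop_mul (Z : C) : cop A Z ≫ mulT A Z = ins η[A] Z := by
  have h : η[A] ≫ Δ[A] ≫ μ[A] = η[A] := by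
    rw [IsSeparableFrobenius.comul_mul, Category.comp_id]
  have h := congrArg (· ▷ Z) h
  simpa [cup, tail, ins, copairing] using h

theorem IsAct.cop_act_act {Y : C} {r : A ⊗ Y ⟶ Y} (h : IsAct r) :
    cop A Y ≫ A ◁ r ≫ r = 𝟙 Y := by
  rw [h.assoc, reassoc_of% (cop_mul (A := A) Y), h.unit]

end Separable

/-! ### The idempotent onto the part where the twist acts trivially -/

section TwistedTrace

variable {C : Type u} [Category.{v} C] [MonoidalCategory C] [BraidedCategory C]
  [RightRigidCategory C] [RibbonCategory C] {A : C} [MonObj A] [ComonObj A]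

/-- The action of the element `μ ∘ (id ⊗ θ_A) ∘ Δ ∘ η` of `A`. -/
def aop {Y : C} (r : A ⊗ Y ⟶ Y) : Y ⟶ Y := cop A Y ≫ A ◁ twist A ▷ Y ≫ A ◁ r ≫ r

theorem aop_nat {Y Y' : C} {r : A ⊗ Y ⟶ Y} {r' : A ⊗ Y' ⟶ Y'} {f : Y ⟶ Y'}
    (hf : r ≫ f = A ◁ f ≫ r') : aop r ≫ f = f ≫ aop r' := by
  simp only [aop, Category.assoc]
  rw [hf, ← reassoc_of% (cup_nat (copairing A) f), reassoc_of% (whisker22 A hf),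
    reassoc_of% (whisker22 A (whisker_exchange (twist A) f))]

variable [IsCommMonObj A] {Y : C} {r : A ⊗ Y ⟶ Y}

theorem IsAct.act_aop (h : IsAct r) : r ≫ aop r = A ◁ aop r ≫ r := by
  have e1 : A ◁ cop A Y = cop A (A ⊗ Y) ≫ A ◁ brd A A Y ≫ brd A A (A ⊗ Y) := by
    rw [cup_brd]
  symm
  simp only [aop, MonoidalCategory.whiskerLeft_comp, Category.assoc]
  rw [e1]
  simp only [Category.assoc]
  rw [← reassoc_of% (brd_nat (X := A) (Y := A) (twist A ▷ Y)),
    ← reassoc_of% (brd_nat (X := A) (Y := A) r), h.comm,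
    ← reassoc_of% (whisker22 A (brd_nat_left (twist A) A Y)),
    reassoc_of% (whisker32 A h.comm), ← reassoc_of% (cup_nat (copairing A) r),
    reassoc_of% (whisker22 A (whisker_exchange (twist A) r))]

theorem IsAct.act_aop_eq : r ≫ aop r =
    cop A (A ⊗ Y) ≫ A ◁ twist A ▷ (A ⊗ Y) ≫ A ◁ A ◁ r ≫ A ◁ r ≫ r := by
  rw [aop, ← reassoc_of% (cup_nat (copairing A) r),
    reassoc_of% (whisker22 A (whisker_exchange (twist A) r))]

/-- The Frobenius relation moves a from x_i to y_i: a Σ x_i θ(y_i) = Σ x_i θ(y_i a) = Σ x_i θ(y_i)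
θ(a). So a and θ(a) act alike on the image of `aop`. -/
theorem IsAct.twist_act_aop [IsFrobenius A] (h : IsAct r) :
    twist A ▷ Y ≫ r ≫ aop r = r ≫ aop r := by
  have e : A ◁ aop r ≫ r = A ◁ cop A Y ≫ mulT A (A ⊗ Y) ≫ A ◁ twist A ▷ Y ≫ A ◁ r ≫ r := by
    simp only [aop, MonoidalCategory.whiskerLeft_comp, Category.assoc]
    rw [h.assoc, reassoc_of% (tail_nat μ[A] r), reassoc_of% (tail_nat μ[A] (twist A ▷ Y)), ← h.assoc]
  conv_rhs => rw [h.act_aop, e, reassoc_of% (mul_cop_eq (A := A) Y),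
    ← reassoc_of% (whisker32 A (twist_mul (A := A) Y)), ← reassoc_of% (whisker22 A h.assoc)]
  rw [IsAct.act_aop_eq, ← reassoc_of% (cup_nat (copairing A) (twist A ▷ Y))]

theorem IsAct.aop_eq_id [IsSeparableFrobenius A] (h : IsAct r) (ht : twist A ▷ Y ≫ r = r) :
    aop r = 𝟙 Y := by
  rw [aop, reassoc_of% (whisker21 A ht), h.cop_act_act]

/-- In front of the second `aop` the twist inside the first may be dropped, and what remains is the
action of Σ x_i y_i = 1. -/
theorem IsAct.aop_aop [IsSeparableFrobenius A] (h : IsAct r) : aop r ≫ aop r = aop r := by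
  conv_lhs => enter [1]; rw [aop]
  simp only [Category.assoc]
  rw [h.act_aop, reassoc_of% (whisker32 A h.twist_act_aop), ← h.act_aop,
    reassoc_of% h.cop_act_act]

end TwistedTrace

/-! ### Commuting actions and the balancing idempotent -/

section CommActs

variable {C : Type u} [Category.{v} C] [MonoidalCategory C] [BraidedCategory C]
  {A : C} [MonObj A] [ComonObj A]

/-- Two commuting `A`-actions on `Y`. -/
structure CommActs {Y : C} (l r : A ⊗ Y ⟶ Y) : Prop where
  left : IsAct l
  right : IsAct r
  comm : A ◁ l ≫ r = brd A A Y ≫ A ◁ r ≫ l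

/-- The idempotent projecting onto the coequaliser of two commuting actions. -/
def balProj {Y : C} (l r : A ⊗ Y ⟶ Y) : Y ⟶ Y := cop A Y ≫ A ◁ r ≫ l

variable {Y : C} {l r : A ⊗ Y ⟶ Y} [IsSeparableFrobenius A]

theorem CommActs.balProj_comp (h : CommActs l r) {W : C} {f : Y ⟶ W} (hf : l ≫ f = r ≫ f) :
    balProj l r ≫ f = f := by
  rw [balProj, Category.assoc, Category.assoc, hf, reassoc_of% h.right.cop_act_act]

theorem CommActs.whiskerLeft_balProj_comp (h : CommActs l r) {B W : C} {f : B ⊗ Y ⟶ W}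
    (hf : B ◁ l ≫ f = B ◁ r ≫ f) : B ◁ balProj l r ≫ f = f := by
  simp only [balProj, MonoidalCategory.whiskerLeft_comp, Category.assoc]
  rw [hf, reassoc_of% (whisker30 B h.right.cop_act_act)]

theorem cop_brd_mul [IsCommMonObj A] (Z : C) :
    cop A (A ⊗ Z) ≫ A ◁ brd A A Z ≫ mulT A (A ⊗ Z) = cop A (A ⊗ Z) ≫ A ◁ mulT A Z := by
  rw [← mul_cop_eq, ← brd_mul (A := A) (A ⊗ Z), reassoc_of% (cup_brd (copairing A) A Z), brd_mul]

/-- An element a entering through l is multiplied onto x_i, and one entering through r onto y_i; the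
Frobenius relation and commutativity identify the two. -/
theorem CommActs.act_balProj [IsCommMonObj A] (h : CommActs l r) :
    l ≫ balProj l r = r ≫ balProj l r := by
  simp only [balProj]
  rw [← reassoc_of% (cup_nat (copairing A) l), ← reassoc_of% (cup_nat (copairing A) r),
    reassoc_of% (whisker23 A h.comm), h.left.assoc, reassoc_of% (tail_nat μ[A] r),
    reassoc_of% (cop_brd_mul (A := A) Y), reassoc_of% (whisker22 A h.right.assoc)]

theorem CommActs.balProj_idem [IsCommMonObj A] (h : CommActs l r) :
    balProj l r ≫ balProj l r = balProj l r :=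
  h.balProj_comp h.act_balProj

/-- This is what lets the action l descend to the image of the idempotent. -/
theorem CommActs.act_left_balanced [IsCommMonObj A] (h : CommActs l r) {W : C} {f : Y ⟶ W}
    (hf : l ≫ f = r ≫ f) : A ◁ l ≫ l ≫ f = A ◁ r ≫ l ≫ f := by
  have h1 : A ◁ r ≫ l ≫ f = brdInv A A Y ≫ A ◁ l ≫ r ≫ f := by
    rw [reassoc_of% h.comm, reassoc_of% (brdInv_brd A A Y)]
  rw [h1, ← hf, reassoc_of% h.left.assoc, ← reassoc_of% (brd_mul (A := A) Y),
    reassoc_of% (brdInv_brd A A Y), reassoc_of% (brd_mul (A := A) Y)]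

theorem commActs_tensor {M N : C} {rM : A ⊗ M ⟶ M} {rN : A ⊗ N ⟶ N} (hM : IsAct rM)
    (hN : IsAct rN) : CommActs (tail rM N) (brd A M N ≫ M ◁ rN) where
  left := hM.tail N
  right := hN.brd_whiskerLeft M
  comm := by
    rw [reassoc_of% (brd_tail rM A N), ← tail_nat, MonoidalCategory.whiskerLeft_comp]
    simp only [Category.assoc]

end CommActs

theorem zmod2_cases : ∀ ν : ZMod 2, ν = 0 ∨ ν = 1 := by decide

/-- In ℤ/2 subtraction is addition, so the complementary degree to i in total degree ν can be
written ν + i. -/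
theorem zmod2_add_eq_iff : ∀ i j ν : ZMod 2, j = ν + i ↔ i + j = ν := by decide

section Pow

variable {C : Type u} [Category.{v} C] [MonoidalCategory C]

theorem pow2_zero {X : C} (f : X ⟶ X) : pow2 f 0 = 𝟙 X := if_pos rfl

theorem pow2_one {X : C} (f : X ⟶ X) : pow2 f 1 = f := if_neg (by decide)

end Pow

/-! ### The canonical even-odd grading of a module -/

section Grading

variable {C : Type u} [Category.{v} C] [Preadditive C] [MonoidalCategory C] [MonoidalPreadditive C]
  [BraidedCategory C] [RightRigidCategory C] [RibbonCategory C]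
  {A : C} [MonObj A] [ComonObj A]

/-- The monodromy action `ρ ∘ c_{M,A} ∘ c_{A,M}`. -/
def mact {M : C} (r : A ⊗ M ⟶ M) : A ⊗ M ⟶ M := (β_ A M).hom ≫ (β_ M A).hom ≫ r

/-- The operator on a module given by the action of one leg of the copairing after the monodromy
action of the other. -/
def qop {M : C} (r : A ⊗ M ⟶ M) : M ⟶ M := cop A M ≫ A ◁ mact r ≫ r

/-- A decomposition of a module into an even part and an odd part, given by idempotent module
endomorphisms. -/
structure IsGrading {M : C} (r : A ⊗ M ⟶ M) (e : ZMod 2 → (M ⟶ M)) : Prop where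
  sum : e 0 + e 1 = 𝟙 M
  idem : ∀ ν, e ν ≫ e ν = e ν
  orth : ∀ ν ν', ν ≠ ν' → e ν ≫ e ν' = 0
  act : ∀ ν, r ≫ e ν = A ◁ e ν ≫ r
  loc : ∀ ν, A ◁ e ν ≫ mact r = A ◁ e ν ≫ pow2 (twist A) ν ▷ M ≫ r
  odd : e 1 ≫ aop r = 0

/-- The canonical candidate for a grading. -/
def gr {M : C} (r : A ⊗ M ⟶ M) (ν : ZMod 2) : M ⟶ M := if ν = 0 then qop r else 𝟙 M - qop r

theorem whiskerLeft_sub (X : C) {Y Z : C} (f g : Y ⟶ Z) : X ◁ (f - g) = X ◁ f - X ◁ g :=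
  (tensorLeft X).map_sub

theorem mact_nat {M N : C} {r : A ⊗ M ⟶ M} {r' : A ⊗ N ⟶ N} {f : M ⟶ N}
    (hf : r ≫ f = A ◁ f ≫ r') : mact r ≫ f = A ◁ f ≫ mact r' := by
  simp [mact, hf]

theorem qop_nat {M N : C} {r : A ⊗ M ⟶ M} {r' : A ⊗ N ⟶ N} {f : M ⟶ N}
    (hf : r ≫ f = A ◁ f ≫ r') : qop r ≫ f = f ≫ qop r' := by
  simp only [qop, Category.assoc]
  rw [hf, ← reassoc_of% (cup_nat (copairing A) f), reassoc_of% (whisker22 A (mact_nat hf))]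

theorem gr_nat {M N : C} {r : A ⊗ M ⟶ M} {r' : A ⊗ N ⟶ N} {f : M ⟶ N}
    (hf : r ≫ f = A ◁ f ≫ r') (ν : ZMod 2) : gr r ν ≫ f = f ≫ gr r' ν := by
  unfold gr
  split_ifs <;> simp [Preadditive.sub_comp, Preadditive.comp_sub, qop_nat hf]

variable {M : C} {r : A ⊗ M ⟶ M} {e : ZMod 2 → (M ⟶ M)}

/-- The idempotents sum to the identity, so maps may be compared on homogeneous components;
degree-dependent identities are verified this way. -/
theorem IsGrading.ext_left (h : IsGrading r e) {W : C} {f g : M ⟶ W}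
    (H : ∀ ν, e ν ≫ f = e ν ≫ g) : f = g := by
  rw [← Category.id_comp f, ← Category.id_comp g, ← h.sum, Preadditive.add_comp,
    Preadditive.add_comp, H 0, H 1]

theorem IsGrading.ext_whiskerLeft (h : IsGrading r e) {B W : C} {f g : B ⊗ M ⟶ W}
    (H : ∀ ν, B ◁ e ν ≫ f = B ◁ e ν ≫ g) : f = g := by
  rw [← Category.id_comp f, ← Category.id_comp g, ← MonoidalCategory.whiskerLeft_id, ← h.sum,
    MonoidalPreadditive.whiskerLeft_add, Preadditive.add_comp, Preadditive.add_comp, H 0, H 1]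

theorem IsGrading.ext_whiskerRight (h : IsGrading r e) {B W : C} {f g : M ⊗ B ⟶ W}
    (H : ∀ ν, e ν ▷ B ≫ f = e ν ▷ B ≫ g) : f = g := by
  rw [← Category.id_comp f, ← Category.id_comp g, ← MonoidalCategory.id_whiskerRight, ← h.sum,
    MonoidalPreadditive.add_whiskerRight, Preadditive.add_comp, Preadditive.add_comp, H 0, H 1]

variable [IsSeparableFrobenius A] [IsCommMonObj A]

/-- On the even part the monodromy action is the action and separability gives the identity; on the
odd part `qop` becomes `aop`, which vanishes there by the condition `odd`. Without that condition
the grading would not be unique. -/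
theorem IsGrading.eq_qop (hr : IsAct r) (h : IsGrading r e) : e 0 = qop r := by
  apply h.ext_left
  intro ν
  have h1 : e ν ≫ qop r = e ν ≫ cop A M ≫ A ◁ pow2 (twist A) ν ▷ M ≫ A ◁ r ≫ r := by
    rw [qop, ← reassoc_of% (cup_nat (copairing A) (e ν)), reassoc_of% (whisker23 A (h.loc ν)),
      reassoc_of% (cup_nat (copairing A) (e ν))]
  rw [h1]
  obtain rfl | rfl : ν = 0 ∨ ν = 1 := zmod2_cases ν
  · rw [h.idem]
    simp [pow2, hr.cop_act_act]
  · rw [h.orth 1 0 (by decide)]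
    have := h.odd
    simp only [aop] at this
    simp [pow2, this]

theorem IsGrading.eq_gr (hr : IsAct r) (h : IsGrading r e) : e = gr r := by
  funext ν
  obtain rfl | rfl : ν = 0 ∨ ν = 1 := zmod2_cases ν
  · simp [gr, h.eq_qop hr]
  · simp [gr, ← h.eq_qop hr, ← h.sum]

theorem qop_of_even (hr : IsAct r) (h : mact r = r) : qop r = 𝟙 M := by
  rw [qop, h, hr.cop_act_act]

theorem qop_of_odd (h : mact r = twist A ▷ M ≫ r) : qop r = aop r := by
  rw [qop, h, aop]
  simp

theorem isGrading_of_even (hr : IsAct r) (h : mact r = r) : IsGrading r (gr r) := by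
  have h0 : gr r 0 = 𝟙 M := by simp [gr, qop_of_even hr h]
  have h1 : gr r 1 = 0 := by simp [gr, qop_of_even hr h]
  constructor
  · simp [h0, h1]
  · intro ν; rcases zmod2_cases ν with rfl | rfl <;> simp [h0, h1]
  · intro ν ν' hν
    rcases zmod2_cases ν with rfl | rfl <;> rcases zmod2_cases ν' with rfl | rfl <;> simp_all
  · intro ν; rcases zmod2_cases ν with rfl | rfl <;> simp [h0, h1]
  · intro ν; rcases zmod2_cases ν with rfl | rfl <;> simp [h0, h1, pow2, h]
  · simp [h1]

/-- A module of this kind need not be purely odd. The image of `aop` is split off as even: there θ_A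
acts trivially, so the same module satisfies the condition of degree 0. -/
theorem isGrading_of_odd (hr : IsAct r) (h : mact r = twist A ▷ M ≫ r) : IsGrading r (gr r) := by
  have h0 : gr r 0 = aop r := by simp [gr, qop_of_odd h]
  have h1 : gr r 1 = 𝟙 M - aop r := by simp [gr, qop_of_odd h]
  have ha := hr.aop_aop
  constructor
  · simp [h0, h1]
  · intro ν; rcases zmod2_cases ν with rfl | rfl <;>
      simp [h0, h1, ha, Preadditive.sub_comp, Preadditive.comp_sub]
  · intro ν ν' hν
    rcases zmod2_cases ν with rfl | rfl <;> rcases zmod2_cases ν' with rfl | rfl <;>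
      simp_all [Preadditive.sub_comp, Preadditive.comp_sub]
  · intro ν; rcases zmod2_cases ν with rfl | rfl <;>
      simp [h0, h1, Preadditive.sub_comp, Preadditive.comp_sub, hr.act_aop, whiskerLeft_sub]
  · intro ν
    rcases zmod2_cases ν with rfl | rfl
    · simp only [h0, pow2, h, if_true, MonoidalCategory.id_whiskerRight, Category.id_comp]
      rw [whisker_exchange_assoc, ← hr.act_aop, hr.twist_act_aop]
    · simp [pow2, h]
  · simp [h1, ha, Preadditive.sub_comp]

/-- `gr` is natural in module maps, so every axiom may be tested after composing with the jointly
epimorphic maps from the S_j. -/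
theorem isGrading_of_cover {n : ℕ} {S : Fin n → C} {rS : ∀ j, A ⊗ S j ⟶ S j}
    {i : ∀ j, S j ⟶ M} {p : ∀ j, M ⟶ S j}
    (hi : ∀ j, rS j ≫ i j = A ◁ i j ≫ r) (hp : ∑ j, p j ≫ i j = 𝟙 M)
    (hS : ∀ j, IsGrading (rS j) (gr (rS j))) : IsGrading r (gr r) := by
  have ext1 : ∀ {W : C} {f g : M ⟶ W}, (∀ j, i j ≫ f = i j ≫ g) → f = g := by
    intro W f g H
    rw [← Category.id_comp f, ← Category.id_comp g, ← hp, Preadditive.sum_comp,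
      Preadditive.sum_comp]
    simp [H]
  have ext2 : ∀ {W : C} {f g : A ⊗ M ⟶ W}, (∀ j, A ◁ i j ≫ f = A ◁ i j ≫ g) → f = g := by
    intro W f g H
    rw [← Category.id_comp f, ← Category.id_comp g, ← MonoidalCategory.whiskerLeft_id, ← hp,
      whiskerLeft_sum, Preadditive.sum_comp, Preadditive.sum_comp]
    simp [H]
  have hn : ∀ j ν, i j ≫ gr r ν = gr (rS j) ν ≫ i j := fun j ν => (gr_nat (hi j) ν).symm
  constructor
  · simp [gr]
  · intro ν
    apply ext1; intro j
    rw [reassoc_of% (hn j ν), hn, reassoc_of% ((hS j).idem ν)]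
  · intro ν ν' h
    apply ext1; intro j
    rw [reassoc_of% (hn j ν), hn, reassoc_of% ((hS j).orth ν ν' h)]
    simp
  · intro ν
    apply ext2; intro j
    rw [← reassoc_of% (hi j), hn, reassoc_of% ((hS j).act ν), hi,
      reassoc_of% (whisker22 A (hn j ν))]
  · intro ν
    apply ext2; intro j
    rw [reassoc_of% (whisker22 A (hn j ν)), reassoc_of% (whisker22 A (hn j ν)),
      ← mact_nat (hi j), reassoc_of% ((hS j).loc ν), hi, whisker_exchange_assoc,
      whisker_exchange_assoc, whisker_exchange_assoc]
  · apply ext1; intro j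
    rw [reassoc_of% (hn j 1), ← aop_nat (hi j), reassoc_of% (hS j).odd]
    simp

end Grading

/-! ### Modules from actions, and retracts -/

section ModuleObjects

variable {C : Type u} [Category.{v} C] [MonoidalCategory C] {A : C} [MonObj A]

theorem isAct_act (M : Mod C A) : IsAct (act M) where
  unit := by
    have h := ModObj.one_smul_self A M.X
    rw [ins, Category.assoc, Iso.inv_comp_eq, Category.comp_id]
    exact h
  assoc := by
    have h := ModObj.mul_smul_self_flip (M := A) M.X
    rw [mulT, SpinDefects.tail, Category.assoc]
    exact h

/-- The module given by an action. -/
def modOf {X : C} (r : A ⊗ X ⟶ X) (h : IsAct r) : Mod C A :=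
  letI : ModObj A X :=
    { smul := r
      one_smul := by
        have h1 := h.unit
        rw [ins, Category.assoc, Iso.inv_comp_eq, Category.comp_id] at h1
        exact h1
      mul_smul := by
        have h1 := h.assoc
        rw [mulT, SpinDefects.tail, Category.assoc, Iso.eq_inv_comp] at h1
        exact h1.symm }
  ⟨X⟩

theorem act_comp_hom {M N : Mod C A} (f : M ⟶ N) : act M ≫ f.hom = A ◁ f.hom ≫ act N :=
  f.isModHom.smul_hom

/-- A morphism of modules given by a morphism compatible with the actions. -/
def modHom {M N : Mod C A} (f : M.X ⟶ N.X) (h : act M ≫ f = A ◁ f ≫ act N) : M ⟶ N :=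
  Mod.Hom.mk' f h

theorem isAct_retract {M : C} {r : A ⊗ M ⟶ M} (hr : IsAct r) {S : C} {i : S ⟶ M} {p : M ⟶ S}
    {e : M ⟶ M} (he : r ≫ e = A ◁ e ≫ r) (hip : i ≫ p = 𝟙 S) (hpi : p ≫ i = e) :
    IsAct (A ◁ i ≫ r ≫ p) where
  unit := by
    rw [reassoc_of% (ins_nat η[A] i), reassoc_of% hr.unit, hip]
  assoc := by
    have h1 : i ≫ e = i := by rw [← hpi, reassoc_of% hip]
    simp only [MonoidalCategory.whiskerLeft_comp, Category.assoc]
    rw [reassoc_of% (whisker21 A hpi), ← reassoc_of% he, ← hpi, Category.assoc, hip,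
      Category.comp_id, reassoc_of% hr.assoc, reassoc_of% (tail_nat μ[A] i)]

theorem act_retract_incl {M : C} {r : A ⊗ M ⟶ M} {S : C} {i : S ⟶ M} {p : M ⟶ S}
    {e : M ⟶ M} (he : r ≫ e = A ◁ e ≫ r) (hip : i ≫ p = 𝟙 S) (hpi : p ≫ i = e) :
    (A ◁ i ≫ r ≫ p) ≫ i = A ◁ i ≫ r := by
  simp only [Category.assoc]
  rw [hpi, he, ← hpi, MonoidalCategory.whiskerLeft_comp, Category.assoc,
    reassoc_of% (whisker20 A hip)]

theorem act_retract_proj {M : C} {r : A ⊗ M ⟶ M} {S : C} {i : S ⟶ M} {p : M ⟶ S}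
    {e : M ⟶ M} (he : r ≫ e = A ◁ e ≫ r) (hip : i ≫ p = 𝟙 S) (hpi : p ≫ i = e) :
    r ≫ p = A ◁ p ≫ A ◁ i ≫ r ≫ p := by
  rw [reassoc_of% (whisker21 A hpi), ← reassoc_of% he, ← hpi, Category.assoc, hip,
      Category.comp_id]

end ModuleObjects

/-! ### Nakayama-locality and purity in terms of the grading -/

section Local

variable {C : Type u} [Category.{v} C] [Preadditive C] [MonoidalCategory C] [MonoidalPreadditive C]
  [BraidedCategory C] [RightRigidCategory C] [RibbonCategory C]
  {A : C} [MonObj A] [ComonObj A] [IsSeparableFrobenius A] [IsCommMonObj A]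

theorem isNakayamaLocalAt_iff (M : Mod C A) (ν : ZMod 2) :
    IsNakayamaLocalAt M ν ↔ mact (act M) = pow2 (twist A) ν ▷ M.X ≫ act M := by
  rw [IsNakayamaLocalAt, mact, nakayama_eq_twist]

theorem isNakayamaLocalAt_zero (M : Mod C A) : IsNakayamaLocalAt M 0 ↔ mact (act M) = act M := by
  rw [isNakayamaLocalAt_iff, pow2_zero, MonoidalCategory.id_whiskerRight, Category.id_comp]

theorem isNakayamaLocalAt_one (M : Mod C A) :
    IsNakayamaLocalAt M 1 ↔ mact (act M) = twist A ▷ M.X ≫ act M := by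
  rw [isNakayamaLocalAt_iff, pow2_one]

theorem isGrading_of_isNakayamaLocal {M : Mod C A} (h : IsNakayamaLocal M) :
    IsGrading (act M) (gr (act M)) := by
  obtain ⟨ν, h⟩ := h
  rcases zmod2_cases ν with rfl | rfl
  · exact isGrading_of_even (isAct_act M) ((isNakayamaLocalAt_zero M).1 h)
  · exact isGrading_of_odd (isAct_act M) ((isNakayamaLocalAt_one M).1 h)

theorem isGrading_of_isNLoc {M : Mod C A} (h : IsNLoc M) : IsGrading (act M) (gr (act M)) := by
  obtain ⟨n, S, i, p, hS, -, -, hp⟩ := h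
  exact isGrading_of_cover (rS := fun j => act (S j)) (fun j => act_comp_hom (i j)) hp
    fun j => isGrading_of_isNakayamaLocal (hS j)

theorem IsGrading.loc_of_retract {M : C} {r : A ⊗ M ⟶ M} {e : ZMod 2 → (M ⟶ M)}
    (h : IsGrading r e) {S : C} {i : S ⟶ M} {p : M ⟶ S} (ν : ZMod 2) (hip : i ≫ p = 𝟙 S)
    (hpi : p ≫ i = e ν) :
    mact (A ◁ i ≫ r ≫ p) = pow2 (twist A) ν ▷ S ≫ (A ◁ i ≫ r ≫ p) := by
  have hi : i ≫ e ν = i := by rw [← hpi, reassoc_of% hip]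
  have h1 := congrArg (· ≫ p) (mact_nat (act_retract_incl (h.act ν) hip hpi))
  simp only [Category.assoc, hip, Category.comp_id] at h1
  rw [h1, ← reassoc_of% (whisker21 A hi), reassoc_of% (h.loc ν), reassoc_of% (whisker21 A hi),
    whisker_exchange_assoc]

/-- The idempotents split, and their images are the local summands. -/
theorem isNLoc_of_isGrading [IsIdempotentComplete C] {M : Mod C A} {e : ZMod 2 → (M.X ⟶ M.X)}
    (h : IsGrading (act M) e) : IsNLoc M := by
  have hs : ∀ ν, ∃ (Y : C) (i : Y ⟶ M.X) (p : M.X ⟶ Y), i ≫ p = 𝟙 Y ∧ p ≫ i = e ν := fun ν =>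
    IsIdempotentComplete.idempotents_split M.X (e ν) (h.idem ν)
  choose Y i p hip hpi using hs
  let S : ZMod 2 → Mod C A := fun ν =>
    modOf (A ◁ i ν ≫ act M ≫ p ν) (isAct_retract (isAct_act M) (h.act ν) (hip ν) (hpi ν))
  -- `ZMod 2` unfolds to `Fin 2`; this only switches between summand indices and degrees.
  let c : Fin 2 → ZMod 2 := id
  refine ⟨2, fun j => S (c j), fun j => modHom (N := M) (M := S (c j)) (i (c j))
      (act_retract_incl (h.act (c j)) (hip (c j)) (hpi (c j))),
    fun j => modHom (M := M) (N := S (c j)) (p (c j))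
      (act_retract_proj (h.act (c j)) (hip (c j)) (hpi (c j))), fun j => ⟨c j, ?_⟩, ?_, ?_, ?_⟩
  · rw [isNakayamaLocalAt_iff]
    exact h.loc_of_retract (c j) (hip (c j)) (hpi (c j))
  · intro j
    ext
    exact hip (c j)
  · intro j l hjl
    change i (c j) ≫ p (c l) = 0
    have hi : i (c j) ≫ e (c j) = i (c j) := by rw [← hpi, reassoc_of% (hip (c j))]
    have hp : e (c l) ≫ p (c l) = p (c l) := by rw [← hpi, Category.assoc, hip, Category.comp_id]
    rw [← hi, ← hp, Category.assoc, reassoc_of% (h.orth (c j) (c l) hjl)]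
    simp
  · rw [Fin.sum_univ_two]
    change p 0 ≫ i 0 + p 1 ≫ i 1 = 𝟙 M.X
    rw [hpi, hpi, h.sum]

theorem retract_act {S M : Mod C A} (R : Retract S M) : (act S ≫ R.i.hom = A ◁ R.i.hom ≫ act M) ∧
    R.i.hom ≫ R.r.hom = 𝟙 S.X :=
  ⟨act_comp_hom R.i, by rw [← Mod.comp_hom', R.retract, Mod.id_hom']⟩

theorem retract_mact {S M : Mod C A} (R : Retract S M) (ν : ZMod 2)
    (h : IsNakayamaLocalAt M ν) : IsNakayamaLocalAt S ν := by
  rw [isNakayamaLocalAt_iff] at h ⊢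
  obtain ⟨h1, h2⟩ := retract_act R
  have h3 := congrArg (· ≫ R.r.hom) (mact_nat h1)
  simp only [Category.assoc, h2, Category.comp_id] at h3
  rw [h3, h, Category.assoc, whisker_exchange_assoc, ← reassoc_of% h1, h2, Category.comp_id]

theorem isDegree_zero {M : Mod C A} : IsDegree M 0 ↔ IsNakayamaLocalAt M 0 :=
  ⟨fun h => h.1, fun h => ⟨h, fun ν' _ => by simp⟩⟩

theorem isDegree_one {M : Mod C A} :
    IsDegree M 1 ↔ IsNakayamaLocalAt M 1 ∧ ¬ IsNakayamaLocalAt M 0 := by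
  constructor
  · rintro ⟨h, h'⟩
    exact ⟨h, fun h0 => by have := h' 0 h0; revert this; decide⟩
  · rintro ⟨h, h'⟩
    refine ⟨h, fun ν hν => ?_⟩
    rcases zmod2_cases ν with rfl | rfl
    · exact absurd hν h'
    · exact le_rfl

theorem isPure_zero_of_mact {M : Mod C A} (h : mact (act M) = act M) : IsPure M 0 := by
  rintro S ⟨R⟩ -
  exact isDegree_zero.2 (retract_mact R 0 ((isNakayamaLocalAt_zero M).2 h))

/-- A summand satisfying both locality conditions has trivial θ_A-action, hence `aop` is its
identity. By naturality `aop` is also 0 there, so the summand is zero. -/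
theorem isPure_one_of_mact {M : Mod C A} (h : mact (act M) = twist A ▷ M.X ≫ act M)
    (h' : aop (act M) = 0) : IsPure M 1 := by
  rintro S ⟨R⟩ hS
  have hS1 := retract_mact R 1 ((isNakayamaLocalAt_one M).2 h)
  refine isDegree_one.2 ⟨hS1, fun hS0 => hS ?_⟩
  obtain ⟨h1, h2⟩ := retract_act R
  have h3 : aop (act S) = 𝟙 S.X := (isAct_act S).aop_eq_id (by
    rw [← (isNakayamaLocalAt_one S).1 hS1, (isNakayamaLocalAt_zero S).1 hS0])
  have h4 := congrArg (· ≫ R.r.hom) (aop_nat h1)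
  simp only [Category.assoc, h2, h', h3, comp_zero, zero_comp, Category.comp_id] at h4
  exact (IsZero.iff_id_eq_zero _).2 h4

theorem qop_of_isPure_zero {M : Mod C A} (h : IsPure M 0) : qop (act M) = 𝟙 M.X := by
  -- Purity says nothing about a zero module, but there all endomorphisms agree.
  by_cases hM : IsZero M.X
  · exact hM.eq_of_src _ _
  · exact qop_of_even (isAct_act M) ((isNakayamaLocalAt_zero M).1
      (isDegree_zero.1 (h M ⟨Retract.refl M⟩ hM)))

/-- Here `qop` is `aop`. Its image is a summand with trivial θ_A-action, so it is also local for ν =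
0; purity of degree 1 forces it to vanish. -/
theorem qop_of_isPure_one [IsIdempotentComplete C] {M : Mod C A} (h : IsPure M 1) :
    qop (act M) = 0 := by
  by_cases hM : IsZero M.X
  · exact hM.eq_of_src _ _
  have h1 := (isDegree_one.1 (h M ⟨Retract.refl M⟩ hM)).1
  rw [qop_of_odd ((isNakayamaLocalAt_one M).1 h1)]
  obtain ⟨Y, i, p, hip, hpi⟩ :=
    IsIdempotentComplete.idempotents_split M.X (aop (act M)) (isAct_act M).aop_aop
  have ha := (isAct_act M).act_aop
  let S : Mod C A := modOf (A ◁ i ≫ act M ≫ p) (isAct_retract (isAct_act M) ha hip hpi)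
  let R : Retract S M :=
    { i := modHom (M := S) (N := M) i (act_retract_incl ha hip hpi)
      r := modHom (M := M) (N := S) p (act_retract_proj ha hip hpi)
      retract := by ext; exact hip }
  have hS : IsZero S.X := by
    by_contra hS
    obtain ⟨h2, h3⟩ := isDegree_one.1 (h S ⟨R⟩ hS)
    refine h3 ((isNakayamaLocalAt_zero S).2 ?_)
    rw [(isNakayamaLocalAt_one S).1 h2]
    change twist A ▷ Y ≫ A ◁ i ≫ act M ≫ p = A ◁ i ≫ act M ≫ p
    have hp : aop (act M) ≫ p = p := by rw [← hpi, Category.assoc, hip, Category.comp_id]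
    rw [← whisker_exchange_assoc, ← hp, reassoc_of% (isAct_act M).twist_act_aop]
  have hp : p = 0 := hS.eq_of_tgt p 0
  rw [← hpi, hp, zero_comp]

end Local

/-! ### The grading of a spin line defect and its pure summands -/

namespace SpinLine

variable {C : Type u} [Category.{v} C] [Preadditive C] [MonoidalCategory C] [MonoidalPreadditive C]
  [BraidedCategory C] [RightRigidCategory C] [RibbonCategory C]
  {A : C} [MonObj A] [ComonObj A] [IsSeparableFrobenius A] [IsCommMonObj A]

/-- The projections of a spin line defect onto its even and odd parts. -/
def e (M : SpinLine A) (ν : ZMod 2) : M.X ⟶ M.X := gr M.ρ ν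

theorem isAct (M : SpinLine A) : IsAct M.ρ := isAct_act M.toMod

theorem grading (M : SpinLine A) : IsGrading M.ρ M.e := isGrading_of_isNLoc M.nloc

theorem ρ_t (M : SpinLine A) : M.ρ ≫ M.t = A ◁ M.t ≫ twist A ▷ M.X ≫ M.ρ := by
  rw [M.act_t, nakayama_eq_twist]

theorem id_hom (M : SpinLine A) : Hom.hom (𝟙 M) = 𝟙 M.X := rfl

theorem comp_hom {M N K : SpinLine A} (f : M ⟶ N) (g : N ⟶ K) :
    Hom.hom (f ≫ g) = f.hom ≫ g.hom := rfl

theorem hom_ext {M N : SpinLine A} {f g : M ⟶ N} (h : f.hom = g.hom) : f = g := Hom.ext h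

theorem e_hom {M N : SpinLine A} (f : M ⟶ N) (ν : ZMod 2) : M.e ν ≫ f.hom = f.hom ≫ N.e ν :=
  gr_nat f.act_hom ν

/-- Twisting the action puts θ on both legs of the copairing, which is invariant under θ ⊗ θ. This
is why the semilinear map t preserves the grading in `e_t`. -/
theorem qop_twist {M : C} (r : A ⊗ M ⟶ M) : qop (twist A ▷ M ≫ r) = qop r := by
  have h : mact (twist A ▷ M ≫ r) = twist A ▷ M ≫ mact r := by simp [mact]
  rw [qop, qop, h, MonoidalCategory.whiskerLeft_comp, Category.assoc, whisker_exchange_assoc,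
    whisker_exchange_assoc, reassoc_of% (cop_twist (A := A) M),
    reassoc_of% (whisker20 A (show twist A ▷ M ≫ twist A ▷ M = 𝟙 _ by
      rw [← comp_whiskerRight, twist_twist, MonoidalCategory.id_whiskerRight]))]

theorem e_t (M : SpinLine A) (ν : ZMod 2) : M.e ν ≫ M.t = M.t ≫ M.e ν := by
  have h : M.ρ ≫ M.t = A ◁ M.t ≫ (twist A ▷ M.X ≫ M.ρ) := M.ρ_t
  have := gr_nat h ν
  unfold gr at this
  rw [qop_twist] at this
  exact this

/-- A spin line defect from an action, a grading and an equivariant structure. -/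
def ofGrading [IsIdempotentComplete C] {X : C} (r : A ⊗ X ⟶ X) (hr : IsAct r)
    (e : ZMod 2 → (X ⟶ X)) (he : IsGrading r e) (t : X ⟶ X)
    (hrt : r ≫ t = A ◁ t ≫ twist A ▷ X ≫ r) (htt : t ≫ t = 𝟙 X) : SpinLine A where
  toMod := modOf r hr
  nloc := isNLoc_of_isGrading (e := e) he
  t := t
  act_t := by rw [nakayama_eq_twist]; exact hrt
  t_t := htt

theorem e_of_isPure [IsIdempotentComplete C] (M : SpinLine A) (ν : ZMod 2)
    (h : IsPure M.toMod ν) : M.e ν = 𝟙 M.X := by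
  rcases zmod2_cases ν with rfl | rfl
  · simpa [e, gr] using qop_of_isPure_zero h
  · simp [e, gr, qop_of_isPure_one h]

theorem isPure_of_retract [IsIdempotentComplete C] {M : C} {r : A ⊗ M ⟶ M}
    {e : ZMod 2 → (M ⟶ M)} (h : IsGrading r e) {S : C} {i : S ⟶ M} {p : M ⟶ S} (ν : ZMod 2)
    (hr : IsAct r) (hip : i ≫ p = 𝟙 S) (hpi : p ≫ i = e ν) :
    IsPure (modOf (A ◁ i ≫ r ≫ p) (isAct_retract hr (h.act ν) hip hpi)) ν := by
  have h1 := h.loc_of_retract ν hip hpi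
  rcases zmod2_cases ν with rfl | rfl
  · apply isPure_zero_of_mact
    change mact (A ◁ i ≫ r ≫ p) = (A ◁ i ≫ r ≫ p)
    rw [h1, pow2_zero, MonoidalCategory.id_whiskerRight, Category.id_comp]
  · apply isPure_one_of_mact
    · change mact (A ◁ i ≫ r ≫ p) = _
      rw [h1, pow2_one]
      rfl
    · change aop (A ◁ i ≫ r ≫ p) = 0
      have h2 := congrArg (· ≫ p) (aop_nat (act_retract_incl (h.act 1) hip hpi))
      simp only [Category.assoc, hip, Category.comp_id] at h2
      have hi : i ≫ e 1 = i := by rw [← hpi, reassoc_of% hip]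
      rw [h2, ← hi, Category.assoc, reassoc_of% h.odd]
      simp

/-- The grading idempotents are linear and commute with t, so both structures restrict to their
images. -/
theorem isSumOfPure [IsIdempotentComplete C] (M : SpinLine A) : M.IsSumOfPure := by
  have h := M.grading
  have hs : ∀ ν, ∃ (Y : C) (i : Y ⟶ M.X) (p : M.X ⟶ Y), i ≫ p = 𝟙 Y ∧ p ≫ i = M.e ν := fun ν =>
    IsIdempotentComplete.idempotents_split M.X (M.e ν) (h.idem ν)
  choose Y i p hip hpi using hs
  have hi : ∀ ν, i ν ≫ M.e ν = i ν := fun ν => by rw [← hpi, reassoc_of% (hip ν)]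
  have hp : ∀ ν, M.e ν ≫ p ν = p ν := fun ν => by rw [← hpi, Category.assoc, hip, Category.comp_id]
  have hit : ∀ ν, i ν ≫ M.t ≫ p ν ≫ i ν = i ν ≫ M.t := fun ν => by
    rw [hpi, ← e_t, reassoc_of% (hi ν)]
  have hpt : ∀ ν, p ν ≫ i ν ≫ M.t ≫ p ν = M.t ≫ p ν := fun ν => by
    rw [reassoc_of% (hpi ν), reassoc_of% (e_t M ν), hp]
  let S : ZMod 2 → SpinLine A := fun ν =>
    { toMod := modOf (A ◁ i ν ≫ M.ρ ≫ p ν) (isAct_retract M.isAct (h.act ν) (hip ν) (hpi ν))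
      nloc := isNLoc_of_isGrading (isGrading_of_isNakayamaLocal
        ⟨ν, (isNakayamaLocalAt_iff _ ν).2 (h.loc_of_retract ν (hip ν) (hpi ν))⟩)
      t := i ν ≫ M.t ≫ p ν
      act_t := by
        rw [nakayama_eq_twist]
        change (A ◁ i ν ≫ M.ρ ≫ p ν) ≫ i ν ≫ M.t ≫ p ν =
          A ◁ (i ν ≫ M.t ≫ p ν) ≫ twist A ▷ Y ν ≫ (A ◁ i ν ≫ M.ρ ≫ p ν)
        simp only [Category.assoc]
        rw [hpt, ← whisker_exchange_assoc, ← MonoidalCategory.whiskerLeft_comp_assoc,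
          Category.assoc, Category.assoc, hit, reassoc_of% M.ρ_t]
        simp
      t_t := by
        change (i ν ≫ M.t ≫ p ν) ≫ i ν ≫ M.t ≫ p ν = 𝟙 (Y ν)
        simp only [Category.assoc]
        rw [hpt, reassoc_of% M.t_t, hip] }
  refine ⟨S, fun ν => ⟨i ν, act_retract_incl (h.act ν) (hip ν) (hpi ν), ?_⟩,
    fun ν => ⟨p ν, act_retract_proj (h.act ν) (hip ν) (hpi ν), ?_⟩, ?_, ?_, ?_, ?_⟩
  · change (i ν ≫ M.t ≫ p ν) ≫ i ν = _
    simp only [Category.assoc, hit]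
    rfl
  · exact (hpt ν).symm
  · intro ν
    exact isPure_of_retract h ν M.isAct (hip ν) (hpi ν)
  · intro ν
    exact hom_ext (hip ν)
  · intro ν ν' hν
    change i ν ≫ p ν' = 0
    rw [← hi, ← hp, Category.assoc, reassoc_of% (h.orth ν ν' hν)]
    simp
  · rw [show (Finset.univ : Finset (ZMod 2)) = {0, 1} by decide, Finset.sum_pair (by decide)]
    change p 0 ≫ i 0 + p 1 ≫ i 1 = 𝟙 M.X
    rw [hpi, hpi, h.sum]

end SpinLine

/-! ### Semilinear maps and powers with exponent in ℤ/2 -/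

section Pow

variable {C : Type u} [Category.{v} C] [MonoidalCategory C]

theorem pow2_pow2 {X : C} {f : X ⟶ X} (hf : f ≫ f = 𝟙 X) (i j : ZMod 2) :
    pow2 f i ≫ pow2 f j = pow2 f (i + j) := by
  rcases zmod2_cases i with rfl | rfl <;> rcases zmod2_cases j with rfl | rfl
  · simp [pow2_zero]
  · simp [pow2_zero]
  · simp [pow2_zero]
  · rw [show (1 + 1 : ZMod 2) = 0 by decide]
    simp [pow2_one, pow2_zero, hf]

theorem pow2_comp {X Y : C} {f : X ⟶ X} {g : Y ⟶ Y} {h : X ⟶ Y} (H : f ≫ h = h ≫ g)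
    (ν : ZMod 2) : pow2 f ν ≫ h = h ≫ pow2 g ν := by
  rcases zmod2_cases ν with rfl | rfl
  · simp [pow2_zero]
  · simpa [pow2_one] using H

/-- The parameter s covers linear maps (s the identity) and the equivariant structure (s the twist)
together. -/
theorem tail_tensorHom {A : C} {M N M' N' : C} {r : A ⊗ M ⟶ M} {r' : A ⊗ M' ⟶ M'} {s : A ⟶ A}
    {f : M ⟶ M'} (g : N ⟶ N') (hf : r ≫ f = A ◁ f ≫ s ▷ M' ≫ r') :
    tail r N ≫ (f ⊗ₘ g) = A ◁ (f ⊗ₘ g) ≫ s ▷ (M' ⊗ N') ≫ tail r' N' := by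
  rw [MonoidalCategory.tensorHom_def, ← reassoc_of% (tail_comp r f N), hf, tail_whiskerLeft_comp,
    tail_whiskerRight_comp, Category.assoc, Category.assoc, ← tail_nat,
    MonoidalCategory.whiskerLeft_comp, Category.assoc, ← whisker_exchange_assoc]

variable [BraidedCategory C]

theorem brd_whiskerLeft_tensorHom {A : C} {M N M' N' : C} {r : A ⊗ N ⟶ N} {r' : A ⊗ N' ⟶ N'}
    {s : A ⟶ A} (f : M ⟶ M') {g : N ⟶ N'} (hg : r ≫ g = A ◁ g ≫ s ▷ N' ≫ r') :
    (brd A M N ≫ M ◁ r) ≫ (f ⊗ₘ g) =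
      A ◁ (f ⊗ₘ g) ≫ s ▷ (M' ⊗ N') ≫ brd A M' N' ≫ M' ◁ r' := by
  rw [reassoc_of% (brd_nat_left s M' N'), tensorHom_def', Category.assoc,
    reassoc_of% (whisker23 M hg), MonoidalCategory.whiskerLeft_comp, Category.assoc,
    reassoc_of% (brd_nat_mid A f N'), reassoc_of% (brd_nat (X := A) (Y := M) g),
    whisker_exchange, whisker_exchange_assoc]

end Pow

/-! ### Monodromy around a tensor product -/

section Braid

variable {C : Type u} [Category.{v} C] [MonoidalCategory C]
  [BraidedCategory C] [RightRigidCategory C] [RibbonCategory C]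
  {A : C} [MonObj A] [ComonObj A]

theorem braiding_braiding_tensor (X M N : C) :
    (β_ X (M ⊗ N)).hom ≫ (β_ (M ⊗ N) X).hom =
      brd X M N ≫ M ◁ ((β_ X N).hom ≫ (β_ N X).hom) ≫ brd M X N := by
  simp [BraidedCategory.braiding_tensor_left_hom, BraidedCategory.braiding_tensor_right_hom, brd]

theorem aop_tail {M : C} (r : A ⊗ M ⟶ M) (N : C) : aop (tail r N) = aop r ▷ N := by
  simp [aop, tail, cup]

/-- Both legs of the copairing cross M, and as a cup they slide through it. -/
theorem aop_brd_whiskerLeft (M : C) {N : C} (r : A ⊗ N ⟶ N) :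
    aop (brd A M N ≫ M ◁ r) = M ◁ aop r := by
  simp only [aop, MonoidalCategory.whiskerLeft_comp, Category.assoc]
  rw [← cup_brd]
  simp only [Category.assoc]
  rw [reassoc_of% (whisker22 A (brd_nat_left (twist A) M N)),
    ← reassoc_of% (brd_nat (X := A) (Y := M) (twist A ▷ N)),
    ← reassoc_of% (brd_nat (X := A) (Y := M) r)]

theorem mact_twist {M : C} (r : A ⊗ M ⟶ M) (ν : ZMod 2) :
    mact (pow2 (twist A) ν ▷ M ≫ r) = pow2 (twist A) ν ▷ M ≫ mact r := by
  simp [mact]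

end Braid

/-! ### The relative tensor product and its grading -/

namespace SpinLine

variable {C : Type u} [Category.{v} C] [Preadditive C] [MonoidalCategory C] [MonoidalPreadditive C]
  [BraidedCategory C] [RightRigidCategory C] [RibbonCategory C] [IsIdempotentComplete C]
  {A : C} [MonObj A] [ComonObj A] [IsSeparableFrobenius A] [IsCommMonObj A]

/-- The action of `A` on the first factor of `M ⊗ N`. -/
def lact (M N : SpinLine A) : A ⊗ M.X ⊗ N.X ⟶ M.X ⊗ N.X := tail M.ρ N.X

/-- The action of `A` on the second factor of `M ⊗ N`. -/
def ract (M N : SpinLine A) : A ⊗ M.X ⊗ N.X ⟶ M.X ⊗ N.X := brd A M.X N.X ≫ M.X ◁ N.ρ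

theorem commActs (M N : SpinLine A) : CommActs (lact M N) (ract M N) :=
  commActs_tensor M.isAct N.isAct

theorem projector_eq (M N : SpinLine A) : projector M N = balProj (lact M N) (ract M N) := by
  simp [projector, balProj, cup, brd, tail, tensorHom_def', lact, ract]

theorem exists_splitting (M N : SpinLine A) :
    ∃ (T : C) (i : T ⟶ M.X ⊗ N.X) (p : M.X ⊗ N.X ⟶ T), i ≫ p = 𝟙 T ∧ p ≫ i = projector M N :=
  IsIdempotentComplete.idempotents_split _ _ (by
    rw [projector_eq]; exact (commActs M N).balProj_idem)

/-- The image of the projector of `M ⊗ N`. -/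
def tX (M N : SpinLine A) : C := (exists_splitting M N).choose

/-- The inclusion of the image of the projector. -/
def tι (M N : SpinLine A) : tX M N ⟶ M.X ⊗ N.X := (exists_splitting M N).choose_spec.choose

/-- The projection to the image of the projector. -/
def tπ (M N : SpinLine A) : M.X ⊗ N.X ⟶ tX M N :=
  (exists_splitting M N).choose_spec.choose_spec.choose

theorem tι_tπ (M N : SpinLine A) : tι M N ≫ tπ M N = 𝟙 _ :=
  (exists_splitting M N).choose_spec.choose_spec.choose_spec.1

theorem tπ_tι (M N : SpinLine A) : tπ M N ≫ tι M N = projector M N :=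
  (exists_splitting M N).choose_spec.choose_spec.choose_spec.2

theorem act_tπ (M N : SpinLine A) : lact M N ≫ tπ M N = ract M N ≫ tπ M N := by
  have h := (commActs M N).act_balProj
  rw [← projector_eq, ← tπ_tι] at h
  simpa [tι_tπ] using h =≫ tπ M N

theorem tπ_desc {M N : SpinLine A} {W : C} {f : M.X ⊗ N.X ⟶ W}
    (hf : lact M N ≫ f = ract M N ≫ f) : tπ M N ≫ tι M N ≫ f = f := by
  rw [reassoc_of% (tπ_tι M N), projector_eq, (commActs M N).balProj_comp hf]

theorem whiskerLeft_tπ_desc {M N : SpinLine A} {B W : C} {f : B ⊗ M.X ⊗ N.X ⟶ W}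
    (hf : B ◁ lact M N ≫ f = B ◁ ract M N ≫ f) : B ◁ tπ M N ≫ B ◁ tι M N ≫ f = f := by
  rw [reassoc_of% (whisker21 B (tπ_tι M N)), projector_eq,
    (commActs M N).whiskerLeft_balProj_comp hf]

theorem tπ_cancel {M N : SpinLine A} {W : C} {f g : tX M N ⟶ W}
    (h : tπ M N ≫ f = tπ M N ≫ g) : f = g := by
  simpa [reassoc_of% (tι_tπ M N)] using tι M N ≫= h

theorem whiskerLeft_tπ_cancel {M N : SpinLine A} {B W : C} {f g : B ⊗ tX M N ⟶ W}
    (h : B ◁ tπ M N ≫ f = B ◁ tπ M N ≫ g) : f = g := by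
  simpa [reassoc_of% (whisker20 B (tι_tπ M N))] using B ◁ tι M N ≫= h

theorem whiskerLeft_whiskerLeft_tπ_cancel {M N : SpinLine A} {B B' W : C}
    {f g : B ⊗ B' ⊗ tX M N ⟶ W} (h : B ◁ B' ◁ tπ M N ≫ f = B ◁ B' ◁ tπ M N ≫ g) : f = g := by
  simpa [reassoc_of% (whisker20 B (whisker20 B' (tι_tπ M N)))] using B ◁ B' ◁ tι M N ≫= h

theorem whiskerRight_tπ_cancel {M N : SpinLine A} {B W : C} {f g : tX M N ⊗ B ⟶ W}
    (h : tπ M N ▷ B ≫ f = tπ M N ▷ B ≫ g) : f = g := by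
  have h1 : tι M N ▷ B ≫ tπ M N ▷ B = 𝟙 _ := by
    rw [← comp_whiskerRight, tι_tπ, MonoidalCategory.id_whiskerRight]
  simpa [reassoc_of% h1] using tι M N ▷ B ≫= h

/-- The action on the relative tensor product. -/
def tρ (M N : SpinLine A) : A ⊗ tX M N ⟶ tX M N := A ◁ tι M N ≫ lact M N ≫ tπ M N

theorem tπ_tρ (M N : SpinLine A) : A ◁ tπ M N ≫ tρ M N = lact M N ≫ tπ M N :=
  whiskerLeft_tπ_desc ((commActs M N).act_left_balanced (act_tπ M N))

theorem isAct_tρ (M N : SpinLine A) : IsAct (tρ M N) where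
  unit := by
    apply tπ_cancel
    rw [← reassoc_of% (ins_nat η[A] (tπ M N)), tπ_tρ, reassoc_of% (commActs M N).left.unit,
      Category.comp_id]
  assoc := by
    apply whiskerLeft_whiskerLeft_tπ_cancel
    rw [reassoc_of% (whisker22 A (tπ_tρ M N)), tπ_tρ, reassoc_of% (commActs M N).left.assoc,
      reassoc_of% (tail_nat μ[A] (tπ M N)), tπ_tρ]

/-- The map of relative tensor products induced by a pair of maps. -/
def tmap {M N M' N' : SpinLine A} (f : M.X ⟶ M'.X) (g : N.X ⟶ N'.X) : tX M N ⟶ tX M' N' :=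
  tι M N ≫ (f ⊗ₘ g) ≫ tπ M' N'

section tmap

variable {M N M' N' : SpinLine A} {f : M.X ⟶ M'.X} {g : N.X ⟶ N'.X} {s : A ⟶ A}

/-- When f and g are semilinear over the same s, the two actions acquire the same factor, so f ⊗ g
still descends. -/
theorem tπ_tmap_of_semilinear (hf : M.ρ ≫ f = A ◁ f ≫ s ▷ M'.X ≫ M'.ρ)
    (hg : N.ρ ≫ g = A ◁ g ≫ s ▷ N'.X ≫ N'.ρ) : tπ M N ≫ tmap f g = (f ⊗ₘ g) ≫ tπ M' N' := by
  apply tπ_desc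
  have h1 := tail_tensorHom (N := N.X) g hf
  have h2 := brd_whiskerLeft_tensorHom (M := M.X) f hg
  have h3 := act_tπ M' N'
  simp only [lact, ract] at h3 ⊢
  rw [reassoc_of% h1, h3, ← Category.assoc (_ ≫ _), h2]
  simp

theorem tρ_tmap_of_semilinear (hf : M.ρ ≫ f = A ◁ f ≫ s ▷ M'.X ≫ M'.ρ)
    (hg : N.ρ ≫ g = A ◁ g ≫ s ▷ N'.X ≫ N'.ρ) :
    tρ M N ≫ tmap f g = A ◁ tmap f g ≫ s ▷ tX M' N' ≫ tρ M' N' := by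
  apply whiskerLeft_tπ_cancel
  have h1 := tail_tensorHom (N := N.X) g hf
  have h2 := tπ_tmap_of_semilinear hf hg
  rw [reassoc_of% (tπ_tρ M N), h2, reassoc_of% (whisker22 A h2), whisker_exchange_assoc, tπ_tρ]
  simp only [lact]
  rw [reassoc_of% h1]

theorem tπ_tmap (hf : M.ρ ≫ f = A ◁ f ≫ M'.ρ) (hg : N.ρ ≫ g = A ◁ g ≫ N'.ρ) :
    tπ M N ≫ tmap f g = (f ⊗ₘ g) ≫ tπ M' N' :=
  tπ_tmap_of_semilinear (s := 𝟙 A) (by simpa using hf) (by simpa using hg)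

theorem tρ_tmap (hf : M.ρ ≫ f = A ◁ f ≫ M'.ρ) (hg : N.ρ ≫ g = A ◁ g ≫ N'.ρ) :
    tρ M N ≫ tmap f g = A ◁ tmap f g ≫ tρ M' N' := by
  simpa using tρ_tmap_of_semilinear (s := 𝟙 A) (by simpa using hf) (by simpa using hg)

end tmap

theorem ρ_e (M : SpinLine A) (ν : ZMod 2) : M.ρ ≫ M.e ν = A ◁ M.e ν ≫ M.ρ := M.grading.act ν

theorem e_e (M : SpinLine A) (i j : ZMod 2) : M.e i ≫ M.e j = if i = j then M.e i else 0 := by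
  split_ifs with h
  · subst h; exact M.grading.idem i
  · exact M.grading.orth i j h

theorem tπ_tmap_e (M N : SpinLine A) (i j : ZMod 2) :
    tπ M N ≫ tmap (M.e i) (N.e j) = (M.e i ⊗ₘ N.e j) ≫ tπ M N :=
  tπ_tmap (M.ρ_e i) (N.ρ_e j)

theorem sum_e_tensor (M N : SpinLine A) : ∑ i, ∑ j, (M.e i ⊗ₘ N.e j) = 𝟙 (M.X ⊗ N.X) := by
  have hu : (Finset.univ : Finset (ZMod 2)) = {0, 1} := by decide
  have hs : ∀ M : SpinLine A, ∑ i, M.e i = 𝟙 M.X := fun M => by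
    rw [hu, Finset.sum_pair (by decide), M.grading.sum]
  simp_rw [← tensor_sum, ← sum_tensor, hs]
  simp

theorem ext_tensor {M N : SpinLine A} {W : C} {f g : M.X ⊗ N.X ⟶ W}
    (h : ∀ i j, (M.e i ⊗ₘ N.e j) ≫ f = (M.e i ⊗ₘ N.e j) ≫ g) : f = g := by
  rw [← Category.id_comp f, ← Category.id_comp g, ← sum_e_tensor]
  simp only [Preadditive.sum_comp, h]

theorem ext_whiskerLeft_tensor {M N : SpinLine A} {B W : C} {f g : B ⊗ M.X ⊗ N.X ⟶ W}
    (h : ∀ i j, B ◁ (M.e i ⊗ₘ N.e j) ≫ f = B ◁ (M.e i ⊗ₘ N.e j) ≫ g) : f = g := by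
  rw [← Category.id_comp f, ← Category.id_comp g, ← MonoidalCategory.whiskerLeft_id,
    ← sum_e_tensor]
  simp only [whiskerLeft_sum, Preadditive.sum_comp, h]

/-- The grading of the relative tensor product. -/
def te (M N : SpinLine A) (ν : ZMod 2) : tX M N ⟶ tX M N := ∑ i, tmap (M.e i) (N.e (ν + i))

theorem e_tπ_te (M N : SpinLine A) (i j ν : ZMod 2) :
    (M.e i ⊗ₘ N.e j) ≫ tπ M N ≫ te M N ν =
      if i + j = ν then (M.e i ⊗ₘ N.e j) ≫ tπ M N else 0 := by
  simp only [te, Preadditive.comp_sum, tπ_tmap_e, tensorHom_comp_tensorHom_assoc, e_e]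
  have h1 : ∀ x : ZMod 2, x ≠ i → ((if i = x then M.e i else 0) ⊗ₘ
      (if j = ν + x then N.e j else 0)) ≫ tπ M N = 0 := by
    intro x hx
    rw [if_neg (Ne.symm hx), MonoidalPreadditive.zero_tensor, zero_comp]
  rw [Finset.sum_eq_single i (fun x _ hx => h1 x hx) (by simp), if_pos rfl]
  simp only [zmod2_add_eq_iff]
  split_ifs <;> simp [MonoidalPreadditive.tensor_zero]

theorem e_mact (M : SpinLine A) (ν : ZMod 2) :
    A ◁ M.e ν ≫ mact M.ρ = A ◁ M.e ν ≫ pow2 (twist A) ν ▷ M.X ≫ M.ρ := M.grading.loc ν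

/-- Locality read as an exchange of crossings: on degree ν, replacing one crossing of A and M by the
opposite one costs θ_A^ν. -/
theorem e_braiding_act (M : SpinLine A) (ν : ZMod 2) :
    M.e ν ▷ A ≫ (β_ M.X A).hom ≫ M.ρ =
      M.e ν ▷ A ≫ (β_ A M.X).inv ≫ pow2 (twist A) ν ▷ M.X ≫ M.ρ := by
  have h := (β_ A M.X).inv ≫= M.e_mact ν
  rw [← BraidedCategory.braiding_inv_naturality_left_assoc,
    ← BraidedCategory.braiding_inv_naturality_left_assoc, mact, Iso.inv_hom_id_assoc] at h
  exact h

/-- After projection, A may act on N instead of M, but here it crosses M in the direction opposite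
to the balancing convention. Exchanging the crossing costs θ_A^i on degree i. -/
theorem e_brd_act_tπ (M N : SpinLine A) (i : ZMod 2) :
    M.e i ▷ (A ⊗ N.X) ≫ brd M.X A N.X ≫ tail M.ρ N.X ≫ tπ M N =
      M.e i ▷ (A ⊗ N.X) ≫ M.X ◁ pow2 (twist A) i ▷ N.X ≫ M.X ◁ N.ρ ≫ tπ M N := by
  have h : M.e i ▷ (A ⊗ N.X) ≫ brd M.X A N.X ≫ tail M.ρ N.X =
      M.e i ▷ (A ⊗ N.X) ≫ brdInv A M.X N.X ≫ pow2 (twist A) i ▷ (M.X ⊗ N.X) ≫ lact M N := by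
    rw [tail_braiding, ← tail_whiskerRight_comp, e_braiding_act, tail_whiskerRight_comp]
    simp [tail, brdInv, lact]
  rw [reassoc_of% h, act_tπ, ract, Category.assoc, reassoc_of% (brd_nat_left (pow2 (twist A) i)),
    reassoc_of% (brdInv_brd A M.X N.X)]

/-- The monodromy of A around M ⊗ N encloses that around N between two crossings with M. The inner
monodromy gives θ_A^j and the crossings with M give θ_A^i, so degrees add. -/
theorem mact_tρ (M N : SpinLine A) (i j : ZMod 2) :
    A ◁ (M.e i ⊗ₘ N.e j) ≫ A ◁ tπ M N ≫ mact (tρ M N) =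
      A ◁ (M.e i ⊗ₘ N.e j) ≫ pow2 (twist A) (i + j) ▷ (M.X ⊗ N.X) ≫ lact M N ≫ tπ M N := by
  have h1 : mact (lact M N) ≫ tπ M N = A ◁ tπ M N ≫ mact (tρ M N) :=
    mact_nat (by rw [tπ_tρ])
  have h2 : A ◁ N.e j ≫ ((β_ A N.X).hom ≫ (β_ N.X A).hom) ≫ pow2 (twist A) i ▷ N.X ≫ N.ρ =
      A ◁ N.e j ≫ pow2 (twist A) (i + j) ▷ N.X ≫ N.ρ := by
    have h3 := mact_twist N.ρ i
    rw [mact] at h3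
    rw [Category.assoc, h3, whisker_exchange_assoc, e_mact, ← whisker_exchange_assoc,
      ← comp_whiskerRight_assoc, pow2_pow2 (twist_twist A)]
  rw [← h1, act_tπ, mact, reassoc_of% (braiding_braiding_tensor A M.X N.X), lact, ract,
    tensorHom_def', MonoidalCategory.whiskerLeft_comp]
  simp only [Category.assoc]
  rw [reassoc_of% (brd_nat_left (pow2 (twist A) (i + j))), reassoc_of% (brd_nat_mid A (M.e i) N.X),
    ← whisker_exchange_assoc, e_brd_act_tπ, whisker_exchange_assoc,
    reassoc_of% (brd_nat (X := A) (Y := M.X) (N.e j)), whisker_exchange_assoc,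
    reassoc_of% (whisker43 M.X h2)]
  conv_rhs => rw [reassoc_of% (brd_nat_mid A (M.e i) N.X),
    reassoc_of% (brd_nat (X := A) (Y := M.X) (N.e j)), whisker_exchange_assoc]

theorem isGrading_te (M N : SpinLine A) : IsGrading (tρ M N) (te M N) where
  sum := by
    apply tπ_cancel
    apply ext_tensor
    intro i j
    rw [Preadditive.comp_add, Preadditive.comp_add, e_tπ_te, e_tπ_te, Category.comp_id]
    rcases zmod2_cases (i + j) with h | h <;> simp [h]
  idem ν := by
    apply tπ_cancel
    apply ext_tensor
    intro i j
    rw [reassoc_of% (e_tπ_te M N i j ν), e_tπ_te]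
    split_ifs with h <;> simp [e_tπ_te, h]
  orth ν ν' h := by
    apply tπ_cancel
    apply ext_tensor
    intro i j
    rw [reassoc_of% (e_tπ_te M N i j ν)]
    split_ifs with h1
    · subst h1
      simp [e_tπ_te, h]
    · simp
  act ν := by
    rw [te, Preadditive.comp_sum, whiskerLeft_sum, Preadditive.sum_comp]
    exact Finset.sum_congr rfl fun i _ => tρ_tmap (M.ρ_e i) (N.ρ_e _)
  loc ν := by
    apply whiskerLeft_tπ_cancel
    apply ext_whiskerLeft_tensor
    intro i j
    have h : A ◁ (M.e i ⊗ₘ N.e j) ≫ A ◁ tπ M N ≫ A ◁ te M N ν =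
        if i + j = ν then A ◁ (M.e i ⊗ₘ N.e j) ≫ A ◁ tπ M N else 0 := by
      simp only [← MonoidalCategory.whiskerLeft_comp, e_tπ_te]
      split_ifs <;> simp
    rw [reassoc_of% h, reassoc_of% h]
    split_ifs with hν
    · subst hν
      rw [Category.assoc, mact_tρ, Category.assoc, ← tπ_tρ, whisker_exchange_assoc,
        whisker_exchange_assoc, whisker_exchange_assoc]
    · simp
  odd := by
    apply tπ_cancel
    apply ext_tensor
    intro i j
    rw [reassoc_of% (e_tπ_te M N i j 1), comp_zero, comp_zero]
    split_ifs with h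
    · rw [Category.assoc]
      -- The total degree is 1, so exactly one factor is odd. On M ⊗_A N the operator `aop` can be
      -- computed from either action, and the odd factor is used.
      rcases zmod2_cases i with rfl | rfl
      · obtain rfl : j = 1 := by simpa using h
        have h1 : aop (ract M N) ≫ tπ M N = tπ M N ≫ aop (tρ M N) :=
          aop_nat (by rw [tπ_tρ, act_tπ])
        rw [← h1, ract, aop_brd_whiskerLeft, MonoidalCategory.tensorHom_def, Category.assoc,
          reassoc_of% (whisker21 M.X N.grading.odd)]
        simp
      · have h1 : aop (lact M N) ≫ tπ M N = tπ M N ≫ aop (tρ M N) :=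
          aop_nat (by rw [tπ_tρ])
        rw [← h1, lact, aop_tail, tensorHom_def', Category.assoc, ← comp_whiskerRight_assoc,
          M.grading.odd]
        simp
    · simp

/-- The relative tensor product of two spin line defects. -/
def tensor (M N : SpinLine A) : SpinLine A :=
  ofGrading (tρ M N) (isAct_tρ M N) (te M N) (isGrading_te M N) (tmap M.t N.t)
    (tρ_tmap_of_semilinear M.ρ_t N.ρ_t) (by
      apply tπ_cancel
      rw [reassoc_of% (tπ_tmap_of_semilinear M.ρ_t N.ρ_t), tπ_tmap_of_semilinear M.ρ_t N.ρ_t,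
        tensorHom_comp_tensorHom_assoc, M.t_t, N.t_t]
      simp)

end SpinLine

/-! ### Actions on triple tensor products -/

section Nested

variable {C : Type u} [Category.{v} C] [MonoidalCategory C]

theorem tail_tail {A M : C} (r : A ⊗ M ⟶ M) (N K : C) :
    tail (tail r N) K ≫ (α_ M N K).hom = A ◁ (α_ M N K).hom ≫ tail r (N ⊗ K) := by
  simp [tail]

theorem tail_whiskerLeft [BraidedCategory C] {A N : C} (M : C) (r : A ⊗ N ⟶ N) (K : C) :
    tail (brd A M N ≫ M ◁ r) K ≫ (α_ M N K).hom =
      A ◁ (α_ M N K).hom ≫ brd A M (N ⊗ K) ≫ M ◁ tail r K := by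
  simp [tail, brd]

theorem tail_associator_inv {A M : C} (r : A ⊗ M ⟶ M) (N K : C) :
    tail r (N ⊗ K) ≫ (α_ M N K).inv = A ◁ (α_ M N K).inv ≫ tail (tail r N) K := by
  simp [tail]

theorem whiskerLeft_tail_associator_inv [BraidedCategory C] {A N : C} (M : C) (r : A ⊗ N ⟶ N)
    (K : C) : brd A M (N ⊗ K) ≫ M ◁ tail r K ≫ (α_ M N K).inv =
      A ◁ (α_ M N K).inv ≫ tail (brd A M N ≫ M ◁ r) K := by
  simp [tail, brd]

theorem brd_brd_associator_inv [BraidedCategory C] {A K : C} (M N : C) (r : A ⊗ K ⟶ K) :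
    brd A M (N ⊗ K) ≫ M ◁ brd A N K ≫ M ◁ N ◁ r ≫ (α_ M N K).inv =
      A ◁ (α_ M N K).inv ≫ brd A (M ⊗ N) K ≫ (M ⊗ N) ◁ r := by
  simp [brd_tensor_right]

theorem whiskerRight_eq_tail {X Y W : C} (f : X ⊗ Y ⟶ W) (Z : C) :
    f ▷ Z = (α_ X Y Z).hom ≫ tail f Z := by
  simp [tail]

theorem mul_unit {A : C} [MonObj A] (Z : C) : A ◁ ins η[A] Z ≫ mulT A Z = 𝟙 _ := by
  have h := (α_ A (𝟙_ C) Z).inv ≫= congrArg (· ▷ Z) (MonObj.mul_one A)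
  simp only [comp_whiskerRight, whisker_assoc, Category.assoc, Iso.inv_hom_id_assoc,
    triangle_assoc_comp_right] at h
  simp only [ins, tail, MonoidalCategory.whiskerLeft_comp, Category.assoc, h]
  simp

theorem whiskerRight_tensorHom {X Y X' Y' Z Z' : C} {p : X ⟶ Y} {p' : X' ⟶ Y'} {F : Y ⟶ Y'}
    {f : X ⟶ X'} (h : p ≫ F = f ≫ p') (g : Z ⟶ Z') :
    p ▷ Z ≫ (F ⊗ₘ g) = (f ⊗ₘ g) ≫ p' ▷ Z' := by
  simp only [← tensorHom_id, tensorHom_comp_tensorHom, h, Category.id_comp, Category.comp_id]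

theorem whiskerLeft_tensorHom {X Y X' Y' Z Z' : C} {p : X ⟶ Y} {p' : X' ⟶ Y'} {F : Y ⟶ Y'}
    {f : X ⟶ X'} (h : p ≫ F = f ≫ p') (g : Z ⟶ Z') :
    Z ◁ p ≫ (g ⊗ₘ F) = (g ⊗ₘ f) ≫ Z' ◁ p' := by
  simp only [← id_tensorHom, tensorHom_comp_tensorHom, h, Category.id_comp, Category.comp_id]

end Nested

/-! ### The associator -/

namespace SpinLine

variable {C : Type u} [Category.{v} C] [Preadditive C] [MonoidalCategory C] [MonoidalPreadditive C]
  [BraidedCategory C] [RightRigidCategory C] [RibbonCategory C] [IsIdempotentComplete C]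
  {A : C} [MonObj A] [ComonObj A] [IsSeparableFrobenius A] [IsCommMonObj A]

/-- The inclusion `M ⊗_A N ⟶ M ⊗ N`. -/
def incl (M N : SpinLine A) : (tensor M N).X ⟶ M.X ⊗ N.X := tι M N

/-- The projection `M ⊗ N ⟶ M ⊗_A N`. -/
def proj (M N : SpinLine A) : M.X ⊗ N.X ⟶ (tensor M N).X := tπ M N

theorem incl_proj (M N : SpinLine A) : incl M N ≫ proj M N = 𝟙 (tensor M N).X := tι_tπ M N

theorem proj_incl (M N : SpinLine A) : proj M N ≫ incl M N = projector M N := tπ_tι M N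

theorem act_proj (M N : SpinLine A) : lact M N ≫ proj M N = ract M N ≫ proj M N := act_tπ M N

theorem tail_proj (M N : SpinLine A) :
    tail M.ρ N.X ≫ proj M N = brd A M.X N.X ≫ M.X ◁ N.ρ ≫ proj M N := by
  simpa [lact, ract] using act_proj M N

theorem proj_desc {M N : SpinLine A} {W : C} {f : M.X ⊗ N.X ⟶ W}
    (hf : lact M N ≫ f = ract M N ≫ f) : proj M N ≫ incl M N ≫ f = f := tπ_desc hf

theorem proj_cancel {M N : SpinLine A} {W : C} {f g : (tensor M N).X ⟶ W}
    (h : proj M N ≫ f = proj M N ≫ g) : f = g := tπ_cancel h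

theorem whiskerLeft_proj_cancel {M N : SpinLine A} {B W : C} {f g : B ⊗ (tensor M N).X ⟶ W}
    (h : B ◁ proj M N ≫ f = B ◁ proj M N ≫ g) : f = g := whiskerLeft_tπ_cancel h

theorem whiskerLeft_whiskerLeft_proj_cancel {M N : SpinLine A} {B B' W : C}
    {f g : B ⊗ B' ⊗ (tensor M N).X ⟶ W} (h : B ◁ B' ◁ proj M N ≫ f = B ◁ B' ◁ proj M N ≫ g) :
    f = g := whiskerLeft_whiskerLeft_tπ_cancel h

theorem whiskerRight_proj_cancel {M N : SpinLine A} {B W : C} {f g : (tensor M N).X ⊗ B ⟶ W}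
    (h : proj M N ▷ B ≫ f = proj M N ▷ B ≫ g) : f = g := whiskerRight_tπ_cancel h

theorem whiskerLeft_whiskerRight_proj_cancel {M N : SpinLine A} {B B' W : C}
    {f g : B' ⊗ (tensor M N).X ⊗ B ⟶ W}
    (h : B' ◁ proj M N ▷ B ≫ f = B' ◁ proj M N ▷ B ≫ g) : f = g := by
  have h1 : B' ◁ incl M N ▷ B ≫ B' ◁ proj M N ▷ B = 𝟙 _ := by
    rw [← MonoidalCategory.whiskerLeft_comp, ← comp_whiskerRight, incl_proj]
    simp
  simpa [reassoc_of% h1] using B' ◁ incl M N ▷ B ≫= h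

theorem proj_ρ (M N : SpinLine A) : A ◁ proj M N ≫ (tensor M N).ρ = tail M.ρ N.X ≫ proj M N :=
  tπ_tρ M N

theorem proj_ρ' (M N : SpinLine A) :
    A ◁ proj M N ≫ (tensor M N).ρ = brd A M.X N.X ≫ M.X ◁ N.ρ ≫ proj M N := by
  rw [proj_ρ, tail_proj]

theorem tensor_ρ (M N : SpinLine A) :
    (tensor M N).ρ = A ◁ incl M N ≫ tail M.ρ N.X ≫ proj M N := rfl

theorem tensor_t (M N : SpinLine A) :
    (tensor M N).t = incl M N ≫ (M.t ⊗ₘ N.t) ≫ proj M N := rfl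

theorem proj_t (M N : SpinLine A) : proj M N ≫ (tensor M N).t = (M.t ⊗ₘ N.t) ≫ proj M N :=
  tπ_tmap_of_semilinear M.ρ_t N.ρ_t

theorem tensor_e (M N : SpinLine A) (ν : ZMod 2) : (tensor M N).e ν = te M N ν :=
  (congrFun ((isGrading_te M N).eq_gr (isAct_tρ M N)) ν).symm

theorem e_proj_e (M N : SpinLine A) (i j ν : ZMod 2) :
    (M.e i ⊗ₘ N.e j) ≫ proj M N ≫ (tensor M N).e ν =
      if i + j = ν then (M.e i ⊗ₘ N.e j) ≫ proj M N else 0 := by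
  rw [tensor_e]
  exact e_tπ_te M N i j ν

/-- The map of relative tensor products induced by a pair of maps. -/
def tensorMapHom {M M' N N' : SpinLine A} (f : M.X ⟶ M'.X) (g : N.X ⟶ N'.X) :
    (tensor M N).X ⟶ (tensor M' N').X := incl M N ≫ (f ⊗ₘ g) ≫ proj M' N'

theorem proj_tensorMapHom {M M' N N' : SpinLine A} {f : M.X ⟶ M'.X} {g : N.X ⟶ N'.X}
    (hf : M.ρ ≫ f = A ◁ f ≫ M'.ρ) (hg : N.ρ ≫ g = A ◁ g ≫ N'.ρ) :
    proj M N ≫ tensorMapHom f g = (f ⊗ₘ g) ≫ proj M' N' := tπ_tmap hf hg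

/-- The relative tensor product of morphisms. -/
def tensorMap {M M' N N' : SpinLine A} (f : M ⟶ M') (g : N ⟶ N') : tensor M N ⟶ tensor M' N' :=
  ⟨tensorMapHom f.hom g.hom, tρ_tmap f.act_hom g.act_hom, by
    apply proj_cancel
    have h := proj_tensorMapHom f.act_hom g.act_hom
    rw [reassoc_of% h, reassoc_of% (proj_t M N), h, proj_t, tensorHom_comp_tensorHom_assoc,
      tensorHom_comp_tensorHom_assoc, f.t_hom, g.t_hom]⟩

theorem proj_tensorMap {M M' N N' : SpinLine A} (f : M ⟶ M') (g : N ⟶ N') :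
    proj M N ≫ (tensorMap f g).hom = (f.hom ⊗ₘ g.hom) ≫ proj M' N' :=
  proj_tensorMapHom f.act_hom g.act_hom

theorem tensorMap_hom {M M' N N' : SpinLine A} (f : M ⟶ M') (g : N ⟶ N') :
    (tensorMap f g).hom = incl M N ≫ (f.hom ⊗ₘ g.hom) ≫ proj M' N' := rfl

/-- An isomorphism of spin line defects from an isomorphism of the underlying objects. -/
def isoMk {M N : SpinLine A} (f : M.X ⟶ N.X) (g : N.X ⟶ M.X) (hfg : f ≫ g = 𝟙 _)
    (hgf : g ≫ f = 𝟙 _) (hρ : M.ρ ≫ f = A ◁ f ≫ N.ρ) (ht : M.t ≫ f = f ≫ N.t) : M ≅ N where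
  hom := ⟨f, hρ, ht⟩
  inv := ⟨g, by
      have h := A ◁ g ≫= hρ =≫ g
      simp only [Category.assoc, hfg, Category.comp_id] at h
      rw [h, reassoc_of% (whisker20 A hgf)], by
      have h := g ≫= ht =≫ g
      simp only [Category.assoc, hfg, Category.comp_id] at h
      rw [h, reassoc_of% hgf]⟩
  hom_inv_id := hom_ext hfg
  inv_hom_id := hom_ext hgf

theorem isoMk_hom_hom {M N : SpinLine A} (f : M.X ⟶ N.X) (g : N.X ⟶ M.X) (hfg : f ≫ g = 𝟙 _)
    (hgf : g ≫ f = 𝟙 _) (hρ : M.ρ ≫ f = A ◁ f ≫ N.ρ) (ht : M.t ≫ f = f ≫ N.t) :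
    (isoMk f g hfg hgf hρ ht).hom.hom = f := rfl

section Associator

variable (M N K : SpinLine A)

/-- This and the three lemmas after it show that the actions on M, N and K agree after either
iterated projection. That agreement is what makes the associator of C descend in both directions. -/
theorem tail_projR : tail M.ρ (N.X ⊗ K.X) ≫ M.X ◁ proj N K ≫ proj M (tensor N K) =
    brd A M.X (N.X ⊗ K.X) ≫ M.X ◁ tail N.ρ K.X ≫ M.X ◁ proj N K ≫ proj M (tensor N K) := by
  rw [← reassoc_of% (tail_nat M.ρ (proj N K)), tail_proj,
    reassoc_of% (brd_nat (X := A) (Y := M.X) (proj N K)), reassoc_of% (whisker22 M.X (proj_ρ N K))]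

theorem brd_projR : brd A M.X (N.X ⊗ K.X) ≫ M.X ◁ tail N.ρ K.X ≫
      M.X ◁ proj N K ≫ proj M (tensor N K) =
    brd A M.X (N.X ⊗ K.X) ≫ M.X ◁ brd A N.X K.X ≫ M.X ◁ N.X ◁ K.ρ ≫
      M.X ◁ proj N K ≫ proj M (tensor N K) := by
  rw [reassoc_of% (whisker23 M.X (tail_proj N K))]

theorem tail_projL : tail M.ρ (N.X ⊗ K.X) ≫ (α_ M.X N.X K.X).inv ≫
      proj M N ▷ K.X ≫ proj (tensor M N) K =
    brd A M.X (N.X ⊗ K.X) ≫ M.X ◁ tail N.ρ K.X ≫ (α_ M.X N.X K.X).inv ≫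
      proj M N ▷ K.X ≫ proj (tensor M N) K := by
  rw [reassoc_of% (tail_associator_inv M.ρ N.X K.X),
    reassoc_of% (whiskerLeft_tail_associator_inv M.X N.ρ K.X),
    ← reassoc_of% (tail_comp (tail M.ρ N.X) (proj M N) K.X), tail_proj,
    ← reassoc_of% (tail_comp (brd A M.X N.X ≫ M.X ◁ N.ρ) (proj M N) K.X)]

theorem projL_right : tail M.ρ (N.X ⊗ K.X) ≫ (α_ M.X N.X K.X).inv ≫
      proj M N ▷ K.X ≫ proj (tensor M N) K =
    brd A M.X (N.X ⊗ K.X) ≫ M.X ◁ brd A N.X K.X ≫ M.X ◁ N.X ◁ K.ρ ≫ (α_ M.X N.X K.X).inv ≫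
      proj M N ▷ K.X ≫ proj (tensor M N) K := by
  rw [reassoc_of% (tail_associator_inv M.ρ N.X K.X),
    reassoc_of% (brd_brd_associator_inv M.X N.X K.ρ),
    ← reassoc_of% (tail_comp (tail M.ρ N.X) (proj M N) K.X), ← proj_ρ, tail_whiskerLeft_comp,
    Category.assoc, tail_proj, reassoc_of% (brd_nat_mid A (proj M N) K.X), whisker_exchange_assoc]

/-- A map balanced between the actions on M and N absorbs the projector of M ⊗ N, by separability.
-/
theorem whiskerRight_desc {W : C} {f : M.X ⊗ N.X ⊗ K.X ⟶ W}
    (hf : tail M.ρ (N.X ⊗ K.X) ≫ f = brd A M.X (N.X ⊗ K.X) ≫ M.X ◁ tail N.ρ K.X ≫ f) :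
    proj M N ▷ K.X ≫ incl M N ▷ K.X ≫ (α_ M.X N.X K.X).hom ≫ f = (α_ M.X N.X K.X).hom ≫ f := by
  have h1 : lact M N ▷ K.X ≫ (α_ M.X N.X K.X).hom ≫ f =
      ract M N ▷ K.X ≫ (α_ M.X N.X K.X).hom ≫ f := by
    rw [whiskerRight_eq_tail, whiskerRight_eq_tail, Category.assoc, Category.assoc, lact, ract,
      reassoc_of% (tail_tail M.ρ N.X K.X), reassoc_of% (tail_whiskerLeft M.X N.ρ K.X), hf]
  rw [← comp_whiskerRight_assoc, proj_incl, projector_eq]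
  simp only [balProj, comp_whiskerRight, Category.assoc]
  rw [h1, ← comp_whiskerRight_assoc, ← comp_whiskerRight_assoc, Category.assoc,
    (commActs M N).right.cop_act_act]
  simp

theorem whiskerLeft_desc {W : C} {f : M.X ⊗ N.X ⊗ K.X ⟶ W}
    (hf : M.X ◁ tail N.ρ K.X ≫ f = M.X ◁ brd A N.X K.X ≫ M.X ◁ N.X ◁ K.ρ ≫ f) :
    M.X ◁ proj N K ≫ M.X ◁ incl N K ≫ f = f :=
  whiskerLeft_tπ_desc (by simpa [lact, ract] using hf)

/-- The underlying map of the associator. -/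
def assocHom : (tensor (tensor M N) K).X ⟶ (tensor M (tensor N K)).X :=
  incl (tensor M N) K ≫ incl M N ▷ K.X ≫ (α_ M.X N.X K.X).hom ≫ M.X ◁ proj N K ≫
    proj M (tensor N K)

/-- The underlying map of the inverse of the associator. -/
def assocInv : (tensor M (tensor N K)).X ⟶ (tensor (tensor M N) K).X :=
  incl M (tensor N K) ≫ M.X ◁ incl N K ≫ (α_ M.X N.X K.X).inv ≫ proj M N ▷ K.X ≫
    proj (tensor M N) K

/-- The iterated projection is split epi, so this equation determines the associator. Naturality,
pentagon and hexagons are deduced from it rather than from the formula with inclusions. -/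
theorem proj_assocHom : proj M N ▷ K.X ≫ proj (tensor M N) K ≫ assocHom M N K =
    (α_ M.X N.X K.X).hom ≫ M.X ◁ proj N K ≫ proj M (tensor N K) := by
  have h0 := whiskerRight_desc M N K (tail_projR M N K)
  rw [assocHom, proj_desc, h0]
  apply whiskerLeft_whiskerRight_proj_cancel
  rw [lact, ract, ← reassoc_of% (tail_whiskerLeft_comp (proj M N) (tensor M N).ρ K.X), proj_ρ,
    tail_comp, Category.assoc, h0, Category.assoc, reassoc_of% (brd_nat_mid A (proj M N) K.X),
    ← whisker_exchange_assoc, h0, reassoc_of% (tail_tail M.ρ N.X K.X), tail_projR, brd_projR,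
    brd_tensor_right]
  simp

theorem proj_assocInv : M.X ◁ proj N K ≫ proj M (tensor N K) ≫ assocInv M N K =
    (α_ M.X N.X K.X).inv ≫ proj M N ▷ K.X ≫ proj (tensor M N) K := by
  have h1 := (tail_projL M N K).symm.trans (projL_right M N K)
  have h0 := whiskerLeft_desc M N K (by
    simpa [reassoc_of% (brdInv_brd A M.X (N.X ⊗ K.X))] using brdInv A M.X (N.X ⊗ K.X) ≫= h1)
  rw [assocInv, proj_desc, h0]
  apply whiskerLeft_whiskerLeft_proj_cancel
  rw [lact, ract, reassoc_of% (tail_nat M.ρ (proj N K)), h0, tail_projL, Category.assoc,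
    reassoc_of% (brd_nat (X := A) (Y := M.X) (proj N K)), reassoc_of% (whisker22 M.X (proj_ρ N K)),
    h0]

theorem proj_proj_cancel {W : C} {f g : (tensor (tensor M N) K).X ⟶ W}
    (h : proj M N ▷ K.X ≫ proj (tensor M N) K ≫ f = proj M N ▷ K.X ≫ proj (tensor M N) K ≫ g) :
    f = g :=
  proj_cancel (whiskerRight_proj_cancel h)

theorem proj_proj_cancel' {W : C} {f g : (tensor M (tensor N K)).X ⟶ W}
    (h : M.X ◁ proj N K ≫ proj M (tensor N K) ≫ f = M.X ◁ proj N K ≫ proj M (tensor N K) ≫ g) :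
    f = g :=
  proj_cancel (whiskerLeft_proj_cancel h)

/-- The associator of the relative tensor product. -/
def assocIso : tensor (tensor M N) K ≅ tensor M (tensor N K) :=
  isoMk (assocHom M N K) (assocInv M N K)
    (by
      apply proj_proj_cancel
      rw [reassoc_of% (proj_assocHom M N K), proj_assocInv]
      simp)
    (by
      apply proj_proj_cancel'
      rw [reassoc_of% (proj_assocInv M N K), proj_assocHom]
      simp)
    (by
      apply whiskerLeft_proj_cancel
      apply whiskerLeft_whiskerRight_proj_cancel
      rw [reassoc_of% (proj_ρ (tensor M N) K),
        ← reassoc_of% (tail_whiskerLeft_comp (proj M N) (tensor M N).ρ K.X), proj_ρ,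
        tail_comp, Category.assoc, proj_assocHom, reassoc_of% (tail_tail M.ρ N.X K.X),
        reassoc_of% (whisker33 A (proj_assocHom M N K)), proj_ρ,
        reassoc_of% (tail_nat M.ρ (proj N K))])
    (by
      apply proj_proj_cancel
      rw [reassoc_of% (proj_t (tensor M N) K), reassoc_of% (proj_assocHom M N K), proj_t,
        reassoc_of% (whiskerRight_tensorHom (proj_t M N) K.t), proj_assocHom,
        reassoc_of% (whiskerLeft_tensorHom (proj_t N K) M.t), associator_naturality_assoc])

end Associator

end SpinLine

/-! ### The algebra as a module over itself -/

section Unit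

variable {C : Type u} [Category.{v} C] [MonoidalCategory C] [BraidedCategory C]
  {A : C} [MonObj A] [IsCommMonObj A]

theorem mact_mul : mact μ[A] = μ[A] := by
  rw [mact, IsCommMonObj.mul_comm, IsCommMonObj.mul_comm]

theorem brdInv_mul (Z : C) : brdInv A A Z ≫ mulT A Z = mulT A Z := by
  rw [← brd_mul, reassoc_of% (brdInv_brd A A Z), brd_mul]

theorem mul_twist [RightRigidCategory C] [RibbonCategory C] :
    μ[A] ≫ twist A = A ◁ twist A ≫ twist A ▷ A ≫ μ[A] := by
  rw [← twist_nat, twist_tensor, Category.assoc, Category.assoc, IsCommMonObj.mul_comm,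
    IsCommMonObj.mul_comm, tensorHom_def', Category.assoc]

end Unit

/-! ### The unit, the unitors and the monoidal structure -/

namespace SpinLine

variable {C : Type u} [Category.{v} C] [Preadditive C] [MonoidalCategory C] [MonoidalPreadditive C]
  [BraidedCategory C] [RightRigidCategory C] [RibbonCategory C] [IsIdempotentComplete C]
  {A : C} [MonObj A] [ComonObj A] [IsSeparableFrobenius A] [IsCommMonObj A]

variable (A) in
/-- The tensor unit: the algebra `A` with the Nakayama automorphism. -/
def unitObj : SpinLine A :=
  ofGrading μ[A] isAct_mul (gr μ[A]) (isGrading_of_even isAct_mul mact_mul) (twist A) mul_twist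
    (twist_twist A)

section LeftUnitor

variable (M : SpinLine A)

/-- The projection `A ⊗ M ⟶ A ⊗_A M`. -/
def projU : A ⊗ M.X ⟶ (tensor (unitObj A) M).X := proj (unitObj A) M

/-- The inclusion `A ⊗_A M ⟶ A ⊗ M`. -/
def inclU : (tensor (unitObj A) M).X ⟶ A ⊗ M.X := incl (unitObj A) M

theorem projU_desc {W : C} {f : A ⊗ M.X ⟶ W}
    (hf : mulT A M.X ≫ f = brd A A M.X ≫ A ◁ M.ρ ≫ f) : projU M ≫ inclU M ≫ f = f :=
  proj_desc (M := unitObj A) (hf.trans (Category.assoc _ _ f).symm)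

theorem projU_cancel {M : SpinLine A} {W : C} {f g : (tensor (unitObj A) M).X ⟶ W}
    (h : projU M ≫ f = projU M ≫ g) : f = g := proj_cancel h

theorem whiskerLeft_projU_cancel {M : SpinLine A} {B W : C}
    {f g : B ⊗ (tensor (unitObj A) M).X ⟶ W}
    (h : B ◁ projU M ≫ f = B ◁ projU M ≫ g) : f = g := whiskerLeft_proj_cancel h

theorem mul_projU : mulT A M.X ≫ projU M = brd A A M.X ≫ A ◁ M.ρ ≫ projU M :=
  tail_proj (unitObj A) M

theorem projU_ρ : A ◁ projU M ≫ (tensor (unitObj A) M).ρ = mulT A M.X ≫ projU M :=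
  proj_ρ (unitObj A) M

theorem projU_t : projU M ≫ (tensor (unitObj A) M).t = (twist A ⊗ₘ M.t) ≫ projU M :=
  proj_t (unitObj A) M

/-- The underlying map of the left unitor. -/
def leftHom : (tensor (unitObj A) M).X ⟶ M.X := inclU M ≫ M.ρ

/-- Associativity and commutativity make the action on M balanced. -/
theorem projU_leftHom : projU M ≫ leftHom M = M.ρ :=
  projU_desc M (by rw [M.isAct.comm, M.isAct.assoc])

/-- The left unitor of the relative tensor product. -/
def leftIso : tensor (unitObj A) M ≅ M :=
  isoMk (leftHom M) (ins η[A] M.X ≫ projU M)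
    (by
      apply projU_cancel
      rw [reassoc_of% (projU_leftHom M), ← reassoc_of% (ins_nat η[A] M.ρ),
        ← brd_ins, Category.assoc, ← mul_projU, reassoc_of% (mul_unit (A := A) M.X),
        Category.comp_id])
    (by rw [Category.assoc, projU_leftHom, M.isAct.unit])
    (by
      apply whiskerLeft_projU_cancel
      rw [reassoc_of% (projU_ρ M), projU_leftHom, reassoc_of% (whisker21 A (projU_leftHom M)),
        M.isAct.assoc])
    (by
      apply projU_cancel
      rw [reassoc_of% (projU_t M), projU_leftHom, reassoc_of% (projU_leftHom M), M.ρ_t,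
        tensorHom_def', Category.assoc])

end LeftUnitor

section RightUnitor

variable (M : SpinLine A)

/-- The projection `M ⊗ A ⟶ M ⊗_A A`. -/
def projV : M.X ⊗ A ⟶ (tensor M (unitObj A)).X := proj M (unitObj A)

/-- The inclusion `M ⊗_A A ⟶ M ⊗ A`. -/
def inclV : (tensor M (unitObj A)).X ⟶ M.X ⊗ A := incl M (unitObj A)

theorem projV_desc {W : C} {f : M.X ⊗ A ⟶ W}
    (hf : tail M.ρ A ≫ f = brd A M.X A ≫ M.X ◁ μ[A] ≫ f) : projV M ≫ inclV M ≫ f = f :=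
  proj_desc (N := unitObj A) (hf.trans (Category.assoc _ _ f).symm)

theorem projV_cancel {M : SpinLine A} {W : C} {f g : (tensor M (unitObj A)).X ⟶ W}
    (h : projV M ≫ f = projV M ≫ g) : f = g := proj_cancel h

theorem whiskerLeft_projV_cancel {M : SpinLine A} {B W : C}
    {f g : B ⊗ (tensor M (unitObj A)).X ⟶ W}
    (h : B ◁ projV M ≫ f = B ◁ projV M ≫ g) : f = g := whiskerLeft_proj_cancel h

theorem tail_projV : tail M.ρ A ≫ projV M = brd A M.X A ≫ M.X ◁ μ[A] ≫ projV M :=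
  tail_proj M (unitObj A)

theorem projV_ρ : A ◁ projV M ≫ (tensor M (unitObj A)).ρ = tail M.ρ A ≫ projV M :=
  proj_ρ M (unitObj A)

theorem projV_t : projV M ≫ (tensor M (unitObj A)).t = (M.t ⊗ₘ twist A) ≫ projV M :=
  proj_t M (unitObj A)

/-- The underlying map of the right unitor. -/
def rightHom : (tensor M (unitObj A)).X ⟶ M.X := inclV M ≫ (β_ A M.X).inv ≫ M.ρ

/-- The inverse braiding undoes the crossing by which A reaches the second factor in `ract`;
commutativity removes the remaining crossing of A with itself. -/
theorem tail_braiding_inv_ρ : tail M.ρ A ≫ (β_ A M.X).inv ≫ M.ρ =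
    A ◁ (β_ A M.X).inv ≫ A ◁ M.ρ ≫ M.ρ := by
  rw [reassoc_of% (whiskerRight_braiding_inv M.ρ A), M.isAct.assoc,
    reassoc_of% (brdInv_mul (A := A) M.X)]

theorem projV_rightHom : projV M ≫ rightHom M = (β_ A M.X).inv ≫ M.ρ :=
  projV_desc M (by
    rw [tail_braiding_inv_ρ, reassoc_of% (whiskerLeft_braiding_inv μ[A] M.X),
      reassoc_of% (brd_brdInv A M.X A), M.isAct.assoc])

theorem ins_braiding_projV_cancel :
    (β_ A M.X).inv ≫ M.ρ ≫ ins η[A] M.X ≫ (β_ A M.X).hom ≫ projV M = projV M := by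
  rw [← reassoc_of% (ins_nat η[A] M.ρ), reassoc_of% (whiskerLeft_braiding M.ρ A), tail_projV,
    ← reassoc_of% (whiskerRight_braiding μ[A] M.X), reassoc_of% (brd_mul (A := A) M.X),
    reassoc_of% (isAct_mul (A := A).tail M.X).unit]
  simp

/-- The right unitor of the relative tensor product. -/
def rightIso : tensor M (unitObj A) ≅ M :=
  isoMk (rightHom M) (ins η[A] M.X ≫ (β_ A M.X).hom ≫ projV M)
    (by
      apply projV_cancel
      rw [reassoc_of% (projV_rightHom M), ins_braiding_projV_cancel, Category.comp_id])
    (by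
      rw [Category.assoc, Category.assoc, projV_rightHom, Iso.hom_inv_id_assoc, M.isAct.unit])
    (by
      apply whiskerLeft_projV_cancel
      rw [reassoc_of% (projV_ρ M), projV_rightHom, reassoc_of% (whisker22 A (projV_rightHom M)),
        tail_braiding_inv_ρ])
    (by
      apply projV_cancel
      rw [reassoc_of% (projV_t M), projV_rightHom, reassoc_of% (projV_rightHom M), M.ρ_t,
        MonoidalCategory.tensorHom_def]
      simp)

end RightUnitor

theorem tensorMap_id (M N : SpinLine A) : tensorMap (𝟙 M) (𝟙 N) = 𝟙 (tensor M N) := by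
  apply hom_ext
  apply proj_cancel
  rw [proj_tensorMap, id_hom, id_hom, id_hom, id_tensorHom_id, Category.id_comp, Category.comp_id]

theorem tensorMap_comp {M M' M'' N N' N'' : SpinLine A} (f : M ⟶ M') (g : N ⟶ N') (f' : M' ⟶ M'')
    (g' : N' ⟶ N'') : tensorMap f g ≫ tensorMap f' g' = tensorMap (f ≫ f') (g ≫ g') := by
  apply hom_ext
  apply proj_cancel
  rw [comp_hom, reassoc_of% (proj_tensorMap f g), proj_tensorMap, proj_tensorMap, comp_hom,
    comp_hom, tensorHom_comp_tensorHom_assoc]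

theorem assocIso_natural {M M' N N' K K' : SpinLine A} (f : M ⟶ M') (g : N ⟶ N') (h : K ⟶ K') :
    tensorMap (tensorMap f g) h ≫ (assocIso M' N' K').hom =
      (assocIso M N K).hom ≫ tensorMap f (tensorMap g h) := by
  apply hom_ext
  apply proj_proj_cancel
  rw [comp_hom, comp_hom, assocIso, assocIso, isoMk_hom_hom, isoMk_hom_hom,
    reassoc_of% (proj_tensorMap (tensorMap f g) h),
    reassoc_of% (whiskerRight_tensorHom (proj_tensorMap f g) h.hom), proj_assocHom,
    reassoc_of% (proj_assocHom M N K), proj_tensorMap,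
    reassoc_of% (whiskerLeft_tensorHom (proj_tensorMap g h) f.hom), associator_naturality_assoc]

theorem leftIso_natural {M N : SpinLine A} (f : M ⟶ N) :
    tensorMap (𝟙 (unitObj A)) f ≫ (leftIso N).hom = (leftIso M).hom ≫ f := by
  apply hom_ext
  apply projU_cancel
  have h : projU M ≫ (tensorMap (𝟙 (unitObj A)) f).hom = (𝟙 A ⊗ₘ f.hom) ≫ projU N :=
    proj_tensorMap (𝟙 (unitObj A)) f
  rw [comp_hom, comp_hom, leftIso, leftIso, isoMk_hom_hom, isoMk_hom_hom, reassoc_of% h,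
    projU_leftHom, reassoc_of% (projU_leftHom M), f.act_hom, id_tensorHom]

theorem rightIso_natural {M N : SpinLine A} (f : M ⟶ N) :
    tensorMap f (𝟙 (unitObj A)) ≫ (rightIso N).hom = (rightIso M).hom ≫ f := by
  apply hom_ext
  apply projV_cancel
  have h : projV M ≫ (tensorMap f (𝟙 (unitObj A))).hom = (f.hom ⊗ₘ 𝟙 A) ≫ projV N :=
    proj_tensorMap f (𝟙 (unitObj A))
  rw [comp_hom, comp_hom, rightIso, rightIso, isoMk_hom_hom, isoMk_hom_hom, reassoc_of% h,
    projV_rightHom, reassoc_of% (projV_rightHom M), f.act_hom, tensorHom_id]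
  simp

theorem whiskerRight_whiskerRight_proj_cancel {M N : SpinLine A} {B B' W : C}
    {f g : ((tensor M N).X ⊗ B) ⊗ B' ⟶ W}
    (h : proj M N ▷ B ▷ B' ≫ f = proj M N ▷ B ▷ B' ≫ g) : f = g := by
  have h1 : incl M N ▷ B ▷ B' ≫ proj M N ▷ B ▷ B' = 𝟙 _ := by
    rw [← comp_whiskerRight, ← comp_whiskerRight, incl_proj, id_whiskerRight, id_whiskerRight]
  simpa [reassoc_of% h1] using incl M N ▷ B ▷ B' ≫= h

theorem pentagon_tensor (W M N K : SpinLine A) :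
    tensorMap (assocIso W M N).hom (𝟙 K) ≫ (assocIso W (tensor M N) K).hom ≫
        tensorMap (𝟙 W) (assocIso M N K).hom =
      (assocIso (tensor W M) N K).hom ≫ (assocIso W M (tensor N K)).hom := by
  apply hom_ext
  apply proj_proj_cancel
  apply whiskerRight_whiskerRight_proj_cancel
  rw [comp_hom, comp_hom, comp_hom, reassoc_of% (proj_tensorMap (assocIso W M N).hom (𝟙 K))]
  simp only [assocIso, isoMk_hom_hom, id_hom, tensorHom_id]
  have h1 := congrArg (· ▷ K.X) (proj_assocHom W M N)
  simp only [comp_whiskerRight] at h1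
  rw [reassoc_of% h1, reassoc_of% (proj_assocHom W (tensor M N) K), proj_tensorMap, id_hom,
    id_tensorHom, associator_naturality_middle_assoc, isoMk_hom_hom,
    reassoc_of% (whisker33 W.X (proj_assocHom M N K)),
    reassoc_of% (proj_assocHom (tensor W M) N K), associator_naturality_left_assoc,
    ← whisker_exchange_assoc, proj_assocHom, associator_naturality_right_assoc,
    pentagon_assoc]

/-- After projection the triangle is the balancing relation itself: the right unitor acts on M
through the inverse crossing, the left unitor acts on N. -/
theorem triangle_tensor (M N : SpinLine A) :
    (assocIso M (unitObj A) N).hom ≫ tensorMap (𝟙 M) (leftIso N).hom =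
      tensorMap (rightIso M).hom (𝟙 N) := by
  apply hom_ext
  apply proj_proj_cancel
  have h1 : projV M ▷ N.X ≫ proj (tensor M (unitObj A)) N ≫ assocHom M (unitObj A) N =
    (α_ M.X A N.X).hom ≫ M.X ◁ projU N ≫ proj M (tensor (unitObj A) N) :=
    proj_assocHom M (unitObj A) N
  change projV M ▷ N.X ≫ _ = projV M ▷ N.X ≫ _
  rw [comp_hom, proj_tensorMap, assocIso, isoMk_hom_hom, reassoc_of% h1, proj_tensorMap, id_hom,
    id_hom, id_tensorHom, tensorHom_id, leftIso, rightIso, isoMk_hom_hom, isoMk_hom_hom,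
    reassoc_of% (whisker21 M.X (projU_leftHom N)), ← comp_whiskerRight_assoc, projV_rightHom]
  rw [← cancel_epi (α_ M.X A N.X).inv, Iso.inv_hom_id_assoc]
  have h2 : (α_ M.X A N.X).inv ≫ ((β_ A M.X).inv ≫ M.ρ) ▷ N.X =
    brdInv A M.X N.X ≫ tail M.ρ N.X := by simp [brdInv, tail]
  rw [reassoc_of% h2, tail_proj, reassoc_of% (brdInv_brd A M.X N.X)]

instance : MonoidalCategoryStruct (SpinLine A) where
  tensorObj := tensor
  tensorHom := tensorMap
  whiskerLeft M _ _ f := tensorMap (𝟙 M) f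
  whiskerRight f N := tensorMap f (𝟙 N)
  tensorUnit := unitObj A
  associator := assocIso
  leftUnitor := leftIso
  rightUnitor := rightIso

instance : MonoidalCategory (SpinLine A) :=
  .ofTensorHom
    (id_tensorHom_id := tensorMap_id)
    (id_tensorHom := fun _ _ _ _ => rfl)
    (tensorHom_id := fun _ _ => rfl)
    (tensorHom_comp_tensorHom := tensorMap_comp)
    (associator_naturality := assocIso_natural)
    (leftUnitor_naturality := leftIso_natural)
    (rightUnitor_naturality := rightIso_natural)
    (pentagon := pentagon_tensor)
    (triangle := triangle_tensor)

end SpinLine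

theorem brd_brd_tail {C : Type u} [Category.{v} C] [MonoidalCategory C] [BraidedCategory C]
    {A M : C} (r : A ⊗ M ⟶ M) (N : C) :
    brd A M N ≫ brd M A N ≫ tail r N = tail (mact r) N := by
  rw [tail_braiding, tail_braiding, mact]

/-! ### The braiding -/

namespace SpinLine

variable {C : Type u} [Category.{v} C] [Preadditive C] [MonoidalCategory C] [MonoidalPreadditive C]
  [BraidedCategory C] [RightRigidCategory C] [RibbonCategory C] [IsIdempotentComplete C]
  {A : C} [MonObj A] [ComonObj A] [IsSeparableFrobenius A] [IsCommMonObj A]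

theorem ρ_pow2_t (M : SpinLine A) (ν : ZMod 2) :
    M.ρ ≫ pow2 M.t ν = A ◁ pow2 M.t ν ≫ pow2 (twist A) ν ▷ M.X ≫ M.ρ := by
  rcases zmod2_cases ν with rfl | rfl
  · simp [pow2_zero]
  · simpa [pow2_one] using M.ρ_t

theorem e_idem (M : SpinLine A) (ν : ZMod 2) : M.e ν ≫ M.e ν = M.e ν := M.grading.idem ν

theorem pow2_twist_twist (i : ZMod 2) : pow2 (twist A) i ≫ pow2 (twist A) i = 𝟙 A := by
  rw [pow2_pow2 (twist_twist A), CharTwo.add_self_eq_zero, pow2_zero]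

/-- The grading-dependent correction of the braiding by the equivariant structure. -/
def deg (M N : SpinLine A) : M.X ⊗ N.X ⟶ M.X ⊗ N.X := ∑ ν, (M.e ν ⊗ₘ pow2 N.t ν)

theorem e_deg (M N : SpinLine A) (ν : ZMod 2) :
    M.e ν ▷ N.X ≫ deg M N = M.e ν ▷ N.X ≫ M.X ◁ pow2 N.t ν := by
  rw [deg, Preadditive.comp_sum, Finset.sum_eq_single ν]
  · rw [MonoidalCategory.tensorHom_def, ← comp_whiskerRight_assoc, e_idem]
  · intro j _ hj
    rw [MonoidalCategory.tensorHom_def, ← comp_whiskerRight_assoc, M.grading.orth _ _ (Ne.symm hj)]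
    simp
  · simp

theorem deg_nat {M M' N N' : SpinLine A} {f : M.X ⟶ M'.X} {g : N.X ⟶ N'.X}
    (hf : ∀ ν, M.e ν ≫ f = f ≫ M'.e ν) (hg : N.t ≫ g = g ≫ N'.t) :
    deg M N ≫ (f ⊗ₘ g) = (f ⊗ₘ g) ≫ deg M' N' := by
  simp only [deg, Preadditive.comp_sum, Preadditive.sum_comp, tensorHom_comp_tensorHom, hf,
    pow2_comp hg]

theorem deg_deg (M N : SpinLine A) : deg M N ≫ deg M N = 𝟙 _ := by
  apply M.grading.ext_whiskerRight
  intro ν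
  rw [reassoc_of% (e_deg M N ν), ← whisker_exchange_assoc, e_deg, whisker_exchange_assoc,
    ← MonoidalCategory.whiskerLeft_comp, pow2_pow2 N.t_t, CharTwo.add_self_eq_zero, pow2_zero]
  simp

theorem lact_deg (M N : SpinLine A) : lact M N ≫ deg M N = A ◁ deg M N ≫ lact M N := by
  simp only [deg, Preadditive.comp_sum, Preadditive.sum_comp, whiskerLeft_sum]
  refine Finset.sum_congr rfl fun ν _ => ?_
  have h := tail_tensorHom (r := M.ρ) (s := 𝟙 A) (pow2 N.t ν) (by simpa using M.ρ_e ν)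
  simpa [lact] using h

/-- `deg` applies t_N^ν on degree ν, so it is linear for the action on M (`lact_deg`) but
θ_A^ν-semilinear for the action on N. This is the correction that the braiding needs. -/
theorem e_ract_deg (M N : SpinLine A) (ν : ZMod 2) : A ◁ M.e ν ▷ N.X ≫ ract M N ≫ deg M N =
    A ◁ M.e ν ▷ N.X ≫ A ◁ deg M N ≫ pow2 (twist A) ν ▷ (M.X ⊗ N.X) ≫ ract M N := by
  rw [reassoc_of% (whisker22 A (e_deg M N ν)), ract, Category.assoc,
    reassoc_of% (brd_nat_left (pow2 (twist A) ν) M.X N.X),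
    reassoc_of% (brd_nat (X := A) (Y := M.X) (pow2 N.t ν)), reassoc_of% (brd_nat_mid A (M.e ν) N.X),
    ← whisker_exchange_assoc, e_deg, whisker_exchange_assoc,
    reassoc_of% (brd_nat_mid A (M.e ν) N.X), whisker23 M.X (ρ_pow2_t N ν)]

/-- The braiding moves the graded middle factor to the front. -/
theorem ext_whiskerLeft_whiskerRight {M : SpinLine A} {B B' W : C} {f g : B ⊗ M.X ⊗ B' ⟶ W}
    (h : ∀ ν, B ◁ M.e ν ▷ B' ≫ f = B ◁ M.e ν ▷ B' ≫ g) : f = g := by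
  rw [← cancel_epi (α_ B M.X B').hom, ← cancel_epi ((β_ B M.X).inv ▷ B'),
    ← cancel_epi (α_ M.X B B').inv]
  apply M.grading.ext_whiskerRight
  intro ν
  have h1 : M.e ν ▷ (B ⊗ B') ≫ (α_ M.X B B').inv ≫ (β_ B M.X).inv ▷ B' ≫ (α_ B M.X B').hom =
      (α_ M.X B B').inv ≫ (β_ B M.X).inv ▷ B' ≫ (α_ B M.X B').hom ≫ B ◁ M.e ν ▷ B' :=
    brdInv_nat_left B (M.e ν) B' |>.trans (by simp [brdInv])
  rw [reassoc_of% h1, reassoc_of% h1, h]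

theorem act_deg_braiding (M N : SpinLine A) : lact M N ≫ deg M N ≫ (β_ M.X N.X).hom =
    A ◁ deg M N ≫ A ◁ (β_ M.X N.X).hom ≫ ract N M := by
  rw [reassoc_of% (lact_deg M N), lact, whiskerRight_braiding, ract]

theorem e_twist_mact (M : SpinLine A) (Z : C) (ν : ZMod 2) :
    A ◁ M.e ν ▷ Z ≫ pow2 (twist A) ν ▷ (M.X ⊗ Z) ≫ tail (mact M.ρ) Z =
      A ◁ M.e ν ▷ Z ≫ tail M.ρ Z := by
  rw [whisker_exchange_assoc, ← tail_whiskerLeft_comp, e_mact, ← tail_whiskerRight_comp,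
    ← whisker_exchange_assoc, ← comp_whiskerRight_assoc, pow2_twist_twist, id_whiskerRight,
    Category.id_comp, tail_whiskerLeft_comp]

/-- Under the braiding followed by projection, the action on N becomes the monodromy action on M,
which is the plain action up to θ_A^ν on degree ν. This θ_A^ν cancels against the one from
`e_ract_deg`. -/
theorem deg_braiding_balanced (M N : SpinLine A) :
    lact M N ≫ deg M N ≫ (β_ M.X N.X).hom ≫ proj N M =
      ract M N ≫ deg M N ≫ (β_ M.X N.X).hom ≫ proj N M := by
  apply ext_whiskerLeft_whiskerRight
  intro ν
  rw [reassoc_of% (e_ract_deg M N ν)]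
  have h : ract M N ≫ (β_ M.X N.X).hom ≫ proj N M = tail (mact M.ρ) N.X ≫ (β_ M.X N.X).hom ≫ proj N M := by
    rw [ract, Category.assoc, reassoc_of% (whiskerLeft_braiding N.ρ M.X), tail_proj,
      ← reassoc_of% (whiskerRight_braiding M.ρ N.X), reassoc_of% (brd_brd_tail M.ρ N.X)]
  rw [h, reassoc_of% (lact_deg M N), reassoc_of% (whisker22 A (e_deg M N ν)),
    reassoc_of% (whisker22 A (e_deg M N ν)),
    ← reassoc_of% (whisker22 A (whisker_exchange (M.e ν) (pow2 N.t ν))),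
    ← reassoc_of% (whisker22 A (whisker_exchange (M.e ν) (pow2 N.t ν))),
    reassoc_of% (e_twist_mact M N.X ν), lact]

theorem deg_comm {M M' N N' : SpinLine A} {f : M.X ⟶ M'.X} {g : N.X ⟶ N'.X}
    (hf : ∀ ν, M.e ν ≫ f = f ≫ M'.e ν) (hg : N.t ≫ g = g ≫ N'.t) {W : C} (h : N'.X ⊗ M'.X ⟶ W) :
    deg M N ≫ (β_ M.X N.X).hom ≫ (g ⊗ₘ f) ≫ h =
      (f ⊗ₘ g) ≫ deg M' N' ≫ (β_ M'.X N'.X).hom ≫ h := by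
  rw [← reassoc_of% (deg_nat hf hg), BraidedCategory.braiding_naturality_assoc]

theorem e_brdInv_twist (M N : SpinLine A) (ν : ZMod 2) :
    A ◁ M.e ν ▷ N.X ≫ brdInv M.X A N.X ≫ M.X ◁ pow2 (twist A) ν ▷ N.X ≫ M.X ◁ N.ρ ≫ proj M N =
      A ◁ M.e ν ▷ N.X ≫ brd A M.X N.X ≫ M.X ◁ N.ρ ≫ proj M N := by
  rw [reassoc_of% (brdInv_nat_mid (M.e ν) A N.X)]
  have h : M.e ν ▷ (A ⊗ N.X) ≫ brd M.X A N.X ≫ tail M.ρ N.X ≫ proj M N =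
    M.e ν ▷ (A ⊗ N.X) ≫ M.X ◁ pow2 (twist A) ν ▷ N.X ≫ M.X ◁ N.ρ ≫ proj M N :=
    e_brd_act_tπ M N ν
  rw [← h, ← reassoc_of% (brdInv_nat_mid (M.e ν) A N.X), reassoc_of% (brdInv_brd M.X A N.X),
    tail_proj]

theorem braiding_inv_deg_balanced (M N : SpinLine A) :
    lact N M ≫ (β_ M.X N.X).inv ≫ deg M N ≫ proj M N =
      ract N M ≫ (β_ M.X N.X).inv ≫ deg M N ≫ proj M N := by
  rw [← cancel_epi (A ◁ (β_ M.X N.X).hom)]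
  apply ext_whiskerLeft_whiskerRight
  intro ν
  rw [lact, reassoc_of% (whiskerRight_braiding_inv N.ρ M.X),
    reassoc_of% (whisker20 A (β_ M.X N.X).hom_inv_id), ract, Category.assoc,
    ← reassoc_of% (whiskerRight_braiding M.ρ N.X), Iso.hom_inv_id_assoc]
  have h1 : A ◁ M.e ν ▷ N.X ≫ tail M.ρ N.X ≫ deg M N ≫ proj M N =
      A ◁ M.X ◁ pow2 N.t ν ≫ A ◁ M.e ν ▷ N.X ≫ brd A M.X N.X ≫ M.X ◁ N.ρ ≫ proj M N := by
    have := lact_deg M N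
    rw [lact] at this
    rw [reassoc_of% this, tail_proj, reassoc_of% (whisker22 A (e_deg M N ν)),
      ← reassoc_of% (whisker22 A (whisker_exchange (M.e ν) (pow2 N.t ν)))]
  rw [h1, ← e_brdInv_twist, reassoc_of% (brdInv_nat_mid (M.e ν) A N.X), ← whisker_exchange_assoc,
    reassoc_of% (e_deg M N ν), reassoc_of% (brdInv_nat_mid (M.e ν) A N.X),
    reassoc_of% (brdInv_nat (X := M.X) (Y := A) (pow2 N.t ν)),
    ← whisker_exchange_assoc (M.e ν) (pow2 N.t ν),
    reassoc_of% (whisker23 M.X (ρ_pow2_t N ν)), ← whisker_exchange_assoc, ← whisker_exchange_assoc]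

/-- The underlying map of the braiding. -/
def braidHom (M N : SpinLine A) : (tensor M N).X ⟶ (tensor N M).X :=
  incl M N ≫ deg M N ≫ (β_ M.X N.X).hom ≫ proj N M

/-- The underlying map of the inverse of the braiding. -/
def braidInv (M N : SpinLine A) : (tensor N M).X ⟶ (tensor M N).X :=
  incl N M ≫ (β_ M.X N.X).inv ≫ deg M N ≫ proj M N

theorem proj_braidHom (M N : SpinLine A) :
    proj M N ≫ braidHom M N = deg M N ≫ (β_ M.X N.X).hom ≫ proj N M :=
  proj_desc (deg_braiding_balanced M N)

theorem proj_braidInv (M N : SpinLine A) :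
    proj N M ≫ braidInv M N = (β_ M.X N.X).inv ≫ deg M N ≫ proj M N :=
  proj_desc (braiding_inv_deg_balanced M N)

/-- The braiding of spin line defects. -/
def braidIso (M N : SpinLine A) : tensor M N ≅ tensor N M :=
  isoMk (braidHom M N) (braidInv M N)
    (by
      apply proj_cancel
      rw [reassoc_of% (proj_braidHom M N), proj_braidInv, Iso.hom_inv_id_assoc,
        reassoc_of% (deg_deg M N), Category.comp_id])
    (by
      apply proj_cancel
      rw [reassoc_of% (proj_braidInv M N), proj_braidHom, reassoc_of% (deg_deg M N),
        Iso.inv_hom_id_assoc, Category.comp_id])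
    (by
      apply whiskerLeft_proj_cancel
      have h := act_deg_braiding M N
      simp only [lact, ract] at h
      rw [reassoc_of% (proj_ρ M N), proj_braidHom, reassoc_of% h,
        reassoc_of% (whisker23 A (proj_braidHom M N)), proj_ρ'])
    (by
      apply proj_cancel
      rw [reassoc_of% (proj_t M N), proj_braidHom, reassoc_of% (proj_braidHom M N), proj_t,
        deg_comm (e_t M) rfl])

theorem braidIso_natural {M M' N N' : SpinLine A} (f : M ⟶ M') (g : N ⟶ N') :
    tensorMap f g ≫ (braidIso M' N').hom = (braidIso M N).hom ≫ tensorMap g f := by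
  apply hom_ext
  apply proj_cancel
  rw [comp_hom, comp_hom, braidIso, braidIso, isoMk_hom_hom, isoMk_hom_hom,
    reassoc_of% (proj_tensorMap f g), proj_braidHom, reassoc_of% (proj_braidHom M N),
    proj_tensorMap, deg_comm (e_hom f) g.t_hom]

/-- The equivariant structure of N ⊗_A K is induced by t_N ⊗ t_K, so the correction for N ⊗_A K is a
product; this is the input to the forward hexagon. -/
theorem whiskerLeft_proj_deg (M N K : SpinLine A) (ν : ZMod 2) :
    M.e ν ▷ (N.X ⊗ K.X) ≫ M.X ◁ proj N K ≫ deg M (tensor N K) =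
      (M.e ν ⊗ₘ pow2 N.t ν ⊗ₘ pow2 K.t ν) ≫ M.X ◁ proj N K := by
  have h : proj N K ≫ pow2 (tensor N K).t ν = (pow2 N.t ν ⊗ₘ pow2 K.t ν) ≫ proj N K := by
    rcases zmod2_cases ν with rfl | rfl
    · simp [pow2_zero]
    · simpa [pow2_one] using proj_t N K
  rw [← whisker_exchange_assoc, e_deg, whisker_exchange_assoc, whisker22 M.X h,
    MonoidalCategory.tensorHom_def (M.e ν), Category.assoc]

/-- Additivity of degree puts t_K^{i+j} on the component of bidegree (i, j); this is the input to
the reverse hexagon. -/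
theorem whiskerRight_proj_deg (M N K : SpinLine A) (i j : ZMod 2) :
    (M.e i ⊗ₘ N.e j) ▷ K.X ≫ proj M N ▷ K.X ≫ deg (tensor M N) K =
      ((M.e i ⊗ₘ N.e j) ⊗ₘ pow2 K.t (i + j)) ≫ proj M N ▷ K.X := by
  rw [deg, Preadditive.comp_sum, Preadditive.comp_sum, Finset.sum_eq_single (i + j)]
  · simp only [← tensorHom_id, tensorHom_comp_tensorHom, Category.id_comp, Category.comp_id,
      e_proj_e, if_pos]
  · intro ν _ hν
    simp only [← tensorHom_id, tensorHom_comp_tensorHom, Category.id_comp, e_proj_e,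
      if_neg (Ne.symm hν), MonoidalPreadditive.zero_tensor]
  · simp

theorem e_deg_deg (M N K : SpinLine A) (ν : ZMod 2) :
    M.e ν ▷ (N.X ⊗ K.X) ≫ (α_ M.X N.X K.X).inv ≫ deg M N ▷ K.X ≫ (β_ M.X N.X).hom ▷ K.X ≫
        (α_ N.X M.X K.X).hom ≫ N.X ◁ deg M K =
      (M.e ν ⊗ₘ pow2 N.t ν ⊗ₘ pow2 K.t ν) ≫ (α_ M.X N.X K.X).inv ≫ (β_ M.X N.X).hom ▷ K.X ≫
        (α_ N.X M.X K.X).hom := by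
  have h1 : M.e ν ▷ N.X ≫ deg M N = M.X ◁ pow2 N.t ν ≫ M.e ν ▷ N.X := by
    rw [e_deg, whisker_exchange]
  rw [associator_inv_naturality_left_assoc, ← comp_whiskerRight_assoc, h1,
    comp_whiskerRight_assoc, ← comp_whiskerRight_assoc _ (β_ M.X N.X).hom,
    BraidedCategory.braiding_naturality_left, comp_whiskerRight_assoc,
    associator_naturality_middle_assoc, whisker22 N.X (e_deg M K ν),
    ← associator_naturality_middle_assoc, ← comp_whiskerRight_assoc,
    ← comp_whiskerRight_assoc, Category.assoc, ← BraidedCategory.braiding_naturality_left, comp_whiskerRight_assoc,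
    comp_whiskerRight_assoc, ← associator_naturality_right, ← whisker_exchange_assoc,
    ← comp_whiskerRight_assoc, ← tensorHom_def', ← MonoidalCategory.tensorHom_def_assoc,
    ← associator_inv_naturality_assoc]

theorem hexagon_forward_tensor (M N K : SpinLine A) :
    (assocIso M N K).hom ≫ (braidIso M (tensor N K)).hom ≫ (assocIso N K M).hom =
      tensorMap (braidIso M N).hom (𝟙 K) ≫ (assocIso N M K).hom ≫
        tensorMap (𝟙 N) (braidIso M K).hom := by
  apply hom_ext
  apply proj_proj_cancel
  have h1 := congrArg (· ▷ K.X) (proj_braidHom M N)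
  simp only [comp_whiskerRight] at h1
  simp only [comp_hom, braidIso, assocIso, isoMk_hom_hom]
  rw [reassoc_of% (proj_assocHom M N K), reassoc_of% (proj_braidHom M (tensor N K)),
    reassoc_of% (proj_tensorMap _ (𝟙 K)), isoMk_hom_hom, id_hom, tensorHom_id, reassoc_of% h1,
    reassoc_of% (proj_assocHom N M K), proj_tensorMap, isoMk_hom_hom, id_hom, id_tensorHom,
    reassoc_of% (whisker23 N.X (proj_braidHom M K))]
  rw [← cancel_epi (α_ M.X N.X K.X).inv, Iso.inv_hom_id_assoc]
  apply M.grading.ext_whiskerRight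
  intro ν
  rw [reassoc_of% (whiskerLeft_proj_deg M N K ν),
    BraidedCategory.braiding_naturality_right_assoc, proj_assocHom,
    reassoc_of% (e_deg_deg M N K ν)]
  simp [BraidedCategory.braiding_tensor_right_hom]

theorem e_e_deg_deg (M N K : SpinLine A) (i j : ZMod 2) :
    M.X ◁ N.e j ▷ K.X ≫ M.e i ▷ (N.X ⊗ K.X) ≫ M.X ◁ deg N K ≫ M.X ◁ (β_ N.X K.X).hom ≫
        (α_ M.X K.X N.X).inv ≫ deg M K ▷ N.X =
      (M.e i ⊗ₘ N.e j ⊗ₘ pow2 K.t (i + j)) ≫ M.X ◁ (β_ N.X K.X).hom ≫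
        (α_ M.X K.X N.X).inv := by
  have h1 : M.e i ▷ (K.X ⊗ N.X) ≫ (α_ M.X K.X N.X).inv ≫ deg M K ▷ N.X =
      M.e i ▷ (K.X ⊗ N.X) ≫ M.X ◁ pow2 K.t i ▷ N.X ≫ (α_ M.X K.X N.X).inv := by
    rw [associator_inv_naturality_left_assoc, ← comp_whiskerRight, e_deg]
    simp
  rw [← whisker_exchange_assoc, ← whisker_exchange_assoc, h1, whisker_exchange_assoc,
    whisker_exchange_assoc, whisker_exchange_assoc, reassoc_of% (whisker22 M.X (e_deg N K j)),
    ← reassoc_of% (whisker22 M.X (BraidedCategory.braiding_naturality_right N.X (pow2 K.t i))),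
    reassoc_of% (whisker21 M.X (show N.X ◁ pow2 K.t j ≫ N.X ◁ pow2 K.t i =
      N.X ◁ pow2 K.t (i + j) by
        rw [← MonoidalCategory.whiskerLeft_comp, pow2_pow2 K.t_t, add_comm])),
    MonoidalCategory.tensorHom_def (M.e i), MonoidalCategory.tensorHom_def (N.e j)]
  simp only [MonoidalCategory.whiskerLeft_comp, Category.assoc]

theorem hexagon_reverse_tensor (M N K : SpinLine A) :
    (assocIso M N K).inv ≫ (braidIso (tensor M N) K).hom ≫ (assocIso K M N).inv =
      tensorMap (𝟙 M) (braidIso N K).hom ≫ (assocIso M K N).inv ≫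
        tensorMap (braidIso M K).hom (𝟙 N) := by
  apply hom_ext
  apply proj_proj_cancel'
  have h1 := congrArg (· ▷ N.X) (proj_braidHom M K)
  simp only [comp_whiskerRight] at h1
  have h2 : ∀ M N K : SpinLine A, (assocIso M N K).inv.hom = assocInv M N K := fun _ _ _ => rfl
  simp only [comp_hom, h2]
  rw [reassoc_of% (proj_assocInv M N K), braidIso, isoMk_hom_hom,
    reassoc_of% (proj_braidHom (tensor M N) K),
    reassoc_of% (proj_tensorMap (𝟙 M)), id_hom, id_tensorHom, braidIso, isoMk_hom_hom,
    reassoc_of% (whisker23 M.X (proj_braidHom N K)), reassoc_of% (proj_assocInv M K N),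
    proj_tensorMap, id_hom, tensorHom_id, braidIso, isoMk_hom_hom, reassoc_of% h1]
  apply M.grading.ext_whiskerRight
  intro i
  apply ext_whiskerLeft_whiskerRight
  intro j
  rw [reassoc_of% (e_e_deg_deg M N K i j)]
  have h3 : M.X ◁ N.e j ▷ K.X ≫ M.e i ▷ (N.X ⊗ K.X) ≫ (α_ M.X N.X K.X).inv =
      (α_ M.X N.X K.X).inv ≫ (M.e i ⊗ₘ N.e j) ▷ K.X := by
    rw [tensorHom_def' (M.e i)]
    simp
  rw [reassoc_of% h3, reassoc_of% (whiskerRight_proj_deg M N K i j),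
    BraidedCategory.braiding_naturality_left_assoc, proj_assocInv,
    ← associator_inv_naturality_assoc]
  simp [BraidedCategory.braiding_tensor_left_hom]

instance : BraidedCategory (SpinLine A) where
  braiding := braidIso
  braiding_naturality_right M _ _ f := braidIso_natural (𝟙 M) f
  braiding_naturality_left f N := braidIso_natural f (𝟙 N)
  hexagon_forward := hexagon_forward_tensor
  hexagon_reverse := hexagon_reverse_tensor

theorem deg_of_isPure (M N : SpinLine A) (ν : ZMod 2) (h : IsPure M.toMod ν) :
    deg M N = M.X ◁ pow2 N.t ν := by
  have h1 := e_deg M N ν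
  rw [e_of_isPure M ν h] at h1
  simpa using h1

end SpinLine

/-! ### Mates and duals -/

section Dual

variable {C : Type u} [Category.{v} C] [MonoidalCategory C]

theorem dual_ext {X W : C} [HasRightDual X] {f g : W ⟶ Xᘁ}
    (h : f ▷ X ≫ ε_ X Xᘁ = g ▷ X ≫ ε_ X Xᘁ) : f = g := by
  have key : ∀ f : W ⟶ Xᘁ, f = (ρ_ W).inv ≫ W ◁ η_ X Xᘁ ≫ (α_ _ _ _).inv ≫
      (f ▷ X ≫ ε_ X Xᘁ) ▷ Xᘁ ≫ (λ_ _).hom := fun f => by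
    have h1 : W ◁ η_ X Xᘁ ≫ (α_ _ _ _).inv ≫ f ▷ X ▷ Xᘁ =
        f ▷ 𝟙_ C ≫ Xᘁ ◁ η_ X Xᘁ ≫ (α_ _ _ _).inv := by
      rw [← associator_inv_naturality_left, whisker_exchange_assoc]
    rw [comp_whiskerRight, Category.assoc, reassoc_of% h1,
      ExactPairing.coevaluation_evaluation_assoc]
    simp
  rw [key f, h, ← key g]

theorem brd_whiskerLeft_rightUnitor [BraidedCategory C] (A X : C) :
    brd A X (𝟙_ C) ≫ X ◁ (ρ_ A).hom = A ◁ (ρ_ X).hom ≫ (β_ A X).hom := by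
  simp only [brd, Category.assoc]
  rw [← rightUnitor_tensor_hom, rightUnitor_naturality, rightUnitor_tensor_hom_assoc,
    Iso.inv_hom_id_assoc]

theorem tail_cap_braiding_inv [BraidedCategory C] {A X Z : C} (f : Z ⟶ 𝟙_ C) :
    X ◁ (A ◁ f ≫ (ρ_ A).hom) ≫ (β_ A X).inv = brdInv A X Z ≫ A ◁ (X ◁ f ≫ (ρ_ X).hom) := by
  have h := brdInv_nat (X := A) (Y := X) f
  have h2 : X ◁ (ρ_ A).hom ≫ (β_ A X).inv = brdInv A X (𝟙_ C) ≫ A ◁ (ρ_ X).hom := by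
    simp only [brdInv, Category.assoc]
    rw [← rightUnitor_tensor_hom, rightUnitor_naturality, rightUnitor_tensor_hom_assoc,
      Iso.inv_hom_id_assoc]
  rw [MonoidalCategory.whiskerLeft_comp, Category.assoc, h2, reassoc_of% h,
    MonoidalCategory.whiskerLeft_comp]

end Dual

/-! ### Locality as semilinearity of the twist -/

section DualAction

variable {C : Type u} [Category.{v} C] [MonoidalCategory C] [BraidedCategory C]
  [RightRigidCategory C] [RibbonCategory C] {A : C} [MonObj A] [ComonObj A]

theorem cop_twist_brd [IsFrobenius A] [IsCommMonObj A] (Z : C) :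
    cop A Z ≫ A ◁ twist A ▷ Z ≫ brd A A Z = cop A Z ≫ A ◁ twist A ▷ Z := by
  rw [brd_nat_mid, reassoc_of% (cop_brd (A := A) Z), cop_twist]

/-- Balancing is used once for each leg of the copairing; moving both legs swaps them, and the
twisted copairing is symmetric. -/
theorem CommActs.aop_comp [IsFrobenius A] [IsCommMonObj A] {Y : C} {l r : A ⊗ Y ⟶ Y}
    (h : CommActs l r) {W : C} {f : Y ⟶ W} (hf : l ≫ f = r ≫ f) : aop l ≫ f = aop r ≫ f := by
  simp only [aop, Category.assoc]
  rw [hf, reassoc_of% h.comm, hf, reassoc_of% (cop_twist_brd (A := A) Y)]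

instance (X : C) : IsIso (twist X) := (RibbonCategory.twist X).isIso_hom

theorem act_twist {M : C} (r : A ⊗ M ⟶ M) :
    r ≫ twist M = twist A ▷ M ≫ A ◁ twist M ≫ mact r := by
  rw [← twist_nat, twist_tensor, MonoidalCategory.tensorHom_def, mact]
  simp

/-- The balancing axiom says that θ_M of a·m is the monodromy action of θ_A(a) on θ_M(m). If
monodromy contributes θ_A^ν, then θ_M is semilinear over θ_A^{1+ν}; as twists are invertible, the
converse holds too. -/
theorem loc_iff [IsFrobenius A] [IsCommMonObj A] {M : C} (r : A ⊗ M ⟶ M) (g : M ⟶ M)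
    (ν : ZMod 2) : A ◁ g ≫ mact r = A ◁ g ≫ pow2 (twist A) ν ▷ M ≫ r ↔
      A ◁ g ≫ r ≫ twist M = A ◁ (g ≫ twist M) ≫ pow2 (twist A) (1 + ν) ▷ M ≫ r := by
  have h1 : A ◁ g ≫ r ≫ twist M = twist A ▷ M ≫ A ◁ twist M ≫ A ◁ g ≫ mact r := by
    rw [act_twist, whisker_exchange_assoc, ← reassoc_of% (whisker22 A (twist_nat g))]
  have h2 : A ◁ (g ≫ twist M) ≫ pow2 (twist A) (1 + ν) ▷ M ≫ r =
      twist A ▷ M ≫ A ◁ twist M ≫ A ◁ g ≫ pow2 (twist A) ν ▷ M ≫ r := by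
    rw [← pow2_pow2 (twist_twist A), pow2_one, comp_whiskerRight, Category.assoc,
      whisker_exchange_assoc, ← twist_nat, MonoidalCategory.whiskerLeft_comp, Category.assoc]
  rw [h1, h2, cancel_epi (twist A ▷ M), cancel_epi (A ◁ twist M)]

end DualAction

/-! ### The dual of a spin line defect -/

namespace SpinLine

variable {C : Type u} [Category.{v} C] [Preadditive C] [MonoidalCategory C] [MonoidalPreadditive C]
  [BraidedCategory C] [RightRigidCategory C] [RibbonCategory C] [IsIdempotentComplete C]
  {A : C} [MonObj A] [ComonObj A] [IsSeparableFrobenius A] [IsCommMonObj A]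

section DualObject

variable (M : SpinLine A)

theorem actEv_eq : M.actEv = brd A (M.X)ᘁ M.X ≫ (M.X)ᘁ ◁ M.ρ ≫ ε_ M.X (M.X)ᘁ := by
  simp [actEv, brd]

theorem dualAct_whiskerRight_ev :
    M.dualAct ▷ M.X ≫ ε_ M.X (M.X)ᘁ = (α_ A (M.X)ᘁ M.X).hom ≫ M.actEv := by
  have h := (tensorRightHomEquiv (A ⊗ (M.X)ᘁ) M.X (M.X)ᘁ (𝟙_ C)).symm_apply_apply
    ((α_ A (M.X)ᘁ M.X).hom ≫ M.actEv)
  simp only [tensorRightHomEquiv, Equiv.coe_fn_mk, Equiv.coe_fn_symm_mk] at h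
  rw [← h, dualAct]
  simp [unitors_inv_equal]

theorem tail_dualAct_ev : tail M.dualAct M.X ≫ ε_ M.X (M.X)ᘁ = M.actEv := by
  rw [tail, Category.assoc, dualAct_whiskerRight_ev, Iso.inv_hom_id_assoc]

theorem isAct_dualAct : IsAct M.dualAct where
  unit := by
    apply dual_ext
    rw [comp_whiskerRight, Category.assoc, dualAct_whiskerRight_ev, actEv_eq]
    have h : ins η[A] (M.X)ᘁ ▷ M.X ≫ (α_ A (M.X)ᘁ M.X).hom = ins η[A] _ := by simp [ins]
    rw [reassoc_of% h, reassoc_of% (ins_brd η[A] (M.X)ᘁ M.X),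
      reassoc_of% (whisker20 (M.X)ᘁ M.isAct.unit)]
    simp
  assoc := by
    apply dual_ext
    rw [comp_whiskerRight, comp_whiskerRight, Category.assoc, Category.assoc,
      dualAct_whiskerRight_ev, actEv_eq]
    have h : mulT A (M.X)ᘁ ▷ M.X ≫ (α_ A (M.X)ᘁ M.X).hom =
        (α_ _ _ _).hom ≫ A ◁ (α_ _ _ _).hom ≫ mulT A ((M.X)ᘁ ⊗ M.X) := by simp [tail]
    rw [reassoc_of% h, reassoc_of% (tail_brd μ[A] (M.X)ᘁ M.X), associator_naturality_middle_assoc,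
      reassoc_of% (brd_nat_mid A M.dualAct M.X), ← whisker_exchange_assoc,
      dualAct_whiskerRight_ev, actEv_eq, brd_tensor_right]
    simp only [Category.assoc]
    rw [← associator_inv_naturality_right_assoc, Iso.inv_hom_id_assoc,
      reassoc_of% (brd_nat (X := A) (Y := (M.X)ᘁ) M.ρ),
      reassoc_of% (brd_yang_baxter A A (M.X)ᘁ M.X), reassoc_of% (whisker32 (M.X)ᘁ M.isAct.comm),
      reassoc_of% (whisker22 (M.X)ᘁ M.isAct.assoc)]

/-- Transposition moves s to the other side of f; since the relevant s are involutions, the mate is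
semilinear over the same s as f. -/
theorem dualAct_mate {f : M.X ⟶ M.X} {s : A ⟶ A} (h : A ◁ f ≫ M.ρ = s ▷ M.X ≫ M.ρ ≫ f) :
    M.dualAct ≫ fᘁ = A ◁ fᘁ ≫ s ▷ (M.X)ᘁ ≫ M.dualAct := by
  apply dual_ext
  simp only [comp_whiskerRight, Category.assoc]
  rw [rightAdjointMate_comp_evaluation, ← whisker_exchange_assoc, dualAct_whiskerRight_ev,
    actEv_eq, associator_naturality_right_assoc, reassoc_of% (brd_nat (X := A) (Y := (M.X)ᘁ) f),
    reassoc_of% (whisker23 (M.X)ᘁ h), associator_naturality_left_assoc,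
    associator_naturality_middle_assoc, reassoc_of% (brd_nat_left s (M.X)ᘁ M.X),
    reassoc_of% (brd_nat_mid A (fᘁ) M.X), ← whisker_exchange_assoc, ← whisker_exchange_assoc,
    rightAdjointMate_comp_evaluation]

theorem e_twist_mul (ν : ZMod 2) : A ◁ (M.e ν ≫ twist M.X) ≫ M.ρ =
    pow2 (twist A) (1 + ν) ▷ M.X ≫ M.ρ ≫ M.e ν ≫ twist M.X := by
  have h := (loc_iff M.ρ (M.e ν) ν).1 (M.e_mact ν)
  rw [← reassoc_of% (ρ_e M ν)] at h
  rw [h, whisker_exchange_assoc, ← comp_whiskerRight_assoc, pow2_twist_twist]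
  simp

/-- The evaluation is balanced, so it sees the same operator from the action on the dual as from the
action on M. -/
theorem aop_dualAct : aop M.dualAct = (aop M.ρ)ᘁ := by
  apply dual_ext
  rw [rightAdjointMate_comp_evaluation, ← aop_tail, ← aop_brd_whiskerLeft]
  exact (commActs_tensor M.isAct_dualAct M.isAct).aop_comp (by
    rw [tail_dualAct_ev, actEv_eq, Category.assoc])

/-- For locality, monodromy with the dual is avoided: by `loc_iff` it suffices that the twist of the
dual is semilinear, and that twist is the mate of θ_M. -/
theorem isGrading_mate : IsGrading M.dualAct (fun ν => (M.e ν)ᘁ) where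
  sum := by
    apply dual_ext
    rw [MonoidalPreadditive.add_whiskerRight, Preadditive.add_comp,
      rightAdjointMate_comp_evaluation, rightAdjointMate_comp_evaluation, ← Preadditive.add_comp,
      ← MonoidalPreadditive.whiskerLeft_add, M.grading.sum]
    simp
  idem ν := by rw [← comp_rightAdjointMate, e_idem]
  orth ν ν' h := by
    rw [← comp_rightAdjointMate, M.grading.orth ν' ν (Ne.symm h)]
    apply dual_ext
    rw [rightAdjointMate_comp_evaluation]
    simp
  act ν := by
    have h := dualAct_mate M (f := M.e ν) (s := 𝟙 A) (by simpa using (ρ_e M ν).symm)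
    simpa using h
  loc ν := by
    rw [loc_iff]
    have h1 : M.dualAct ≫ (M.e ν)ᘁ = A ◁ (M.e ν)ᘁ ≫ M.dualAct := by
      have h := dualAct_mate M (f := M.e ν) (s := 𝟙 A) (by simpa using (ρ_e M ν).symm)
      simpa using h
    have h2 : (M.e ν)ᘁ ≫ twist (M.X)ᘁ = (M.e ν ≫ twist M.X)ᘁ := by
      rw [twist, RibbonCategory.twist_dual, ← comp_rightAdjointMate]
      congr 1
      exact twist_nat (M.e ν)
    rw [← reassoc_of% h1, h2, dualAct_mate M (e_twist_mul M ν)]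
  odd := by
    rw [aop_dualAct, ← comp_rightAdjointMate, aop_nat (ρ_e M 1), M.grading.odd]
    apply dual_ext
    rw [rightAdjointMate_comp_evaluation]
    simp

theorem t_act : A ◁ M.t ≫ M.ρ = twist A ▷ M.X ≫ M.ρ ≫ M.t := by
  rw [M.ρ_t, whisker_exchange_assoc, ← comp_whiskerRight_assoc, twist_twist]
  simp

theorem dualAct_t : M.dualAct ≫ M.tᘁ = A ◁ M.tᘁ ≫ twist A ▷ (M.X)ᘁ ≫ M.dualAct :=
  dualAct_mate M M.t_act

theorem mate_t_t : M.tᘁ ≫ M.tᘁ = 𝟙 (M.X)ᘁ := by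
  rw [← comp_rightAdjointMate, M.t_t, rightAdjointMate_id]

/-- The dual of a spin line defect. -/
def dualObj : SpinLine A :=
  ofGrading M.dualAct M.isAct_dualAct (fun ν => (M.e ν)ᘁ) M.isGrading_mate (rightAdjointMate M.t) M.dualAct_t
    M.mate_t_t

end DualObject

end SpinLine

/-! ### Compatible dualities and rigidity -/

namespace SpinLine

variable {C : Type u} [Category.{v} C] [Preadditive C] [MonoidalCategory C] [MonoidalPreadditive C]
  [BraidedCategory C] [RightRigidCategory C] [RibbonCategory C] [IsIdempotentComplete C]
  {A : C} [MonObj A] [ComonObj A] [IsSeparableFrobenius A] [IsCommMonObj A]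

/-- A duality between the underlying objects of two spin line defects which is compatible with the
actions and the equivariant structures. -/
structure DualPair (M D : SpinLine A) where
  ev : D.X ⊗ M.X ⟶ 𝟙_ C
  coev : 𝟙_ C ⟶ M.X ⊗ D.X
  zig : (λ_ M.X).inv ≫ coev ▷ M.X ≫ (α_ _ _ _).hom ≫ M.X ◁ ev ≫ (ρ_ M.X).hom = 𝟙 M.X
  zag : (ρ_ D.X).inv ≫ D.X ◁ coev ≫ (α_ _ _ _).inv ≫ ev ▷ D.X ≫ (λ_ D.X).hom = 𝟙 D.X
  act : lact D M ≫ ev = ract D M ≫ ev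
  ev_t : (D.t ⊗ₘ M.t) ≫ ev = ev
  coev_t : coev ≫ (M.t ⊗ₘ D.t) = coev

namespace DualPair

variable {M D : SpinLine A} (P : DualPair M D)

/-- The evaluation before passing to the relative tensor product. -/
def evA : D.X ⊗ M.X ⟶ A := cop A (D.X ⊗ M.X) ≫ A ◁ (lact D M ≫ P.ev) ≫ (ρ_ A).hom

/-- The coevaluation before passing to the relative tensor product. -/
def coevA : A ⟶ M.X ⊗ D.X := (ρ_ A).inv ≫ A ◁ P.coev ≫ tail M.ρ D.X

theorem lact_evA : lact D M ≫ P.evA = A ◁ P.evA ≫ μ[A] := by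
  have h1 : A ◁ (ρ_ A).hom ≫ μ[A] = mulT A (𝟙_ C) ≫ (ρ_ A).hom := by simp [tail]
  have h2 : lact D M ≫ P.evA = cop A (A ⊗ D.X ⊗ M.X) ≫ A ◁ mulT A (D.X ⊗ M.X) ≫
      A ◁ lact D M ≫ A ◁ P.ev ≫ (ρ_ A).hom := by
    rw [evA, ← reassoc_of% (cup_nat (copairing A) (lact D M))]
    simp only [MonoidalCategory.whiskerLeft_comp, Category.assoc]
    rw [reassoc_of% (whisker22 A (commActs D M).left.assoc)]
  rw [h2, ← reassoc_of% (mul_cop_eq (A := A) (D.X ⊗ M.X)), evA]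
  simp only [MonoidalCategory.whiskerLeft_comp, Category.assoc]
  rw [h1, reassoc_of% (tail_nat μ[A] P.ev), reassoc_of% (tail_nat μ[A] (lact D M))]

/-- One leg of the copairing already acts on D before `ev`. As `ev` is balanced and A is
commutative, a further element may enter through either action. -/
theorem evA_balanced : lact D M ≫ P.evA = ract D M ≫ P.evA := by
  have h : A ◁ ract D M ≫ lact D M ≫ P.ev = A ◁ lact D M ≫ lact D M ≫ P.ev := by
    have h1 : A ◁ ract D M ≫ lact D M = brdInv A A _ ≫ A ◁ lact D M ≫ ract D M := by
      rw [(commActs D M).comm, reassoc_of% (brdInv_brd A A (D.X ⊗ M.X))]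
    rw [reassoc_of% h1, ← P.act, reassoc_of% (commActs D M).left.assoc,
      reassoc_of% (brdInv_mul (A := A) (D.X ⊗ M.X))]
  rw [evA, ← reassoc_of% (cup_nat (copairing A) (lact D M)),
    ← reassoc_of% (cup_nat (copairing A) (ract D M)), ← MonoidalCategory.whiskerLeft_comp_assoc,
    ← h, MonoidalCategory.whiskerLeft_comp_assoc]

theorem evA_t : (D.t ⊗ₘ M.t) ≫ P.evA = P.evA ≫ twist A := by
  have h1 := tail_tensorHom (N := M.X) M.t D.ρ_t
  have h2 : A ◁ (D.t ⊗ₘ M.t) ≫ lact D M ≫ P.ev = twist A ▷ (D.X ⊗ M.X) ≫ lact D M ≫ P.ev := by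
    have h3 : A ◁ (D.t ⊗ₘ M.t) ≫ lact D M =
        twist A ▷ (D.X ⊗ M.X) ≫ lact D M ≫ (D.t ⊗ₘ M.t) := by
      rw [lact, h1, ← whisker_exchange_assoc, ← comp_whiskerRight_assoc, twist_twist]
      simp
    rw [reassoc_of% h3, P.ev_t]
  rw [evA, ← reassoc_of% (cup_nat (copairing A) (D.t ⊗ₘ M.t)),
    ← MonoidalCategory.whiskerLeft_comp_assoc, h2, MonoidalCategory.whiskerLeft_comp_assoc,
    ← reassoc_of% (cop_twist (A := A) (D.X ⊗ M.X)), ← whisker_exchange_assoc]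
  simp

theorem act_coevA : μ[A] ≫ P.coevA = A ◁ P.coevA ≫ lact M D := by
  have h1 : (A ◁ (ρ_ A).inv) ≫ mulT A (𝟙_ C) = μ[A] ≫ (ρ_ A).inv := by simp [tail]
  change μ[A] ≫ (ρ_ A).inv ≫ A ◁ P.coev ≫ lact M D =
    A ◁ ((ρ_ A).inv ≫ A ◁ P.coev ≫ lact M D) ≫ lact M D
  simp only [MonoidalCategory.whiskerLeft_comp, Category.assoc]
  rw [(commActs M D).left.assoc, lact, reassoc_of% (tail_nat μ[A] P.coev), reassoc_of% h1]

theorem coevA_t : twist A ≫ P.coevA = P.coevA ≫ (M.t ⊗ₘ D.t) := by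
  have h1 := tail_tensorHom (N := D.X) D.t M.ρ_t
  simp only [coevA, Category.assoc]
  rw [h1, reassoc_of% (whisker21 A P.coev_t), whisker_exchange_assoc]
  simp

/-- The underlying map of the evaluation of spin line defects. -/
def evHat : (tensor D M).X ⟶ A := incl D M ≫ P.evA

theorem proj_evHat : proj D M ≫ P.evHat = P.evA := proj_desc P.evA_balanced

/-- The evaluation of spin line defects. -/
def evHom : tensor D M ⟶ unitObj A :=
  ⟨P.evHat, by
    apply whiskerLeft_proj_cancel
    change A ◁ proj D M ≫ (tensor D M).ρ ≫ P.evHat = A ◁ proj D M ≫ A ◁ P.evHat ≫ μ[A]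
    rw [reassoc_of% (proj_ρ D M), P.proj_evHat, reassoc_of% (whisker21 A P.proj_evHat), ← lact_evA,
      lact], by
    apply proj_cancel
    change proj D M ≫ (tensor D M).t ≫ P.evHat = proj D M ≫ P.evHat ≫ twist A
    rw [reassoc_of% (proj_t D M), P.proj_evHat, reassoc_of% P.proj_evHat, P.evA_t]⟩

/-- The coevaluation of spin line defects. -/
def coevHom : unitObj A ⟶ tensor M D :=
  ⟨P.coevA ≫ proj M D, by
    change μ[A] ≫ P.coevA ≫ proj M D = A ◁ (P.coevA ≫ proj M D) ≫ (tensor M D).ρ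
    rw [MonoidalCategory.whiskerLeft_comp, Category.assoc, proj_ρ, reassoc_of% P.act_coevA, lact],
    by
    change twist A ≫ P.coevA ≫ proj M D = (P.coevA ≫ proj M D) ≫ (tensor M D).t
    rw [Category.assoc, proj_t, reassoc_of% P.coevA_t]⟩

/-- Balancing moves the action of y_i from D to M, the coevaluation slides past it, and the zigzag
of C collapses. What is left is the action of Σ x_i y_i, the identity by separability. -/
theorem cup_evA : cup P.coev M.X ≫ M.X ◁ P.evA ≫ (β_ A M.X).inv ≫ M.ρ = 𝟙 M.X := by
  have h1 := tail_cap_braiding_inv (A := A) (X := M.X) (lact D M ≫ P.ev)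
  have h2 : M.X ◁ cop A (D.X ⊗ M.X) ≫ brdInv A M.X (A ⊗ D.X ⊗ M.X) =
      cop A (M.X ⊗ D.X ⊗ M.X) ≫ A ◁ brd A M.X (D.X ⊗ M.X) := by
    rw [← cup_brd, Category.assoc, Category.assoc, brd_brdInv, Category.comp_id]
  have h3 : cup P.coev M.X ≫ M.X ◁ P.ev ≫ (ρ_ M.X).hom = 𝟙 M.X := by simpa [cup] using P.zig
  have h4 : A ◁ cup P.coev M.X ≫ brd A M.X (D.X ⊗ M.X) ≫
      M.X ◁ (lact D M ≫ P.ev) ≫ (ρ_ M.X).hom = M.ρ := by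
    rw [P.act, ract]
    simp only [MonoidalCategory.whiskerLeft_comp, Category.assoc]
    rw [reassoc_of% (brd_cup P.coev A M.X), reassoc_of% (cup_nat P.coev M.ρ), h3, Category.comp_id]
  rw [evA, MonoidalCategory.whiskerLeft_comp, Category.assoc, reassoc_of% h1, reassoc_of% h2,
    ← reassoc_of% (cup_nat (copairing A) (cup P.coev M.X)), reassoc_of% (whisker31 A h4),
    M.isAct.cop_act_act]

/-- The mirror argument is shorter, since y_i already acts on D: the other zigzag leaves Σ x_i y_i
acting on D. -/
theorem coev_evA : (ρ_ D.X).inv ≫ D.X ◁ P.coev ≫ tail P.evA D.X ≫ D.ρ = 𝟙 D.X := by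
  have h1 : tail P.evA D.X = cop A (D.X ⊗ M.X ⊗ D.X) ≫ A ◁ tail D.ρ (M.X ⊗ D.X) ≫
      A ◁ cap P.ev D.X := by
    have h : (α_ D.X M.X D.X).inv ≫ (λ_ ((D.X ⊗ M.X) ⊗ D.X)).inv ≫
        (α_ (𝟙_ C) (D.X ⊗ M.X) D.X).inv ≫ (α_ (𝟙_ C) D.X M.X).inv ▷ D.X =
          (λ_ (D.X ⊗ M.X ⊗ D.X)).inv ≫ (α_ (𝟙_ C) D.X (M.X ⊗ D.X)).inv ≫
            (α_ (𝟙_ C ⊗ D.X) M.X D.X).inv := by monoidal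
    simp [evA, tail, cap, lact, cup, reassoc_of% h]
  have h3 : (ρ_ D.X).inv ≫ D.X ◁ P.coev ≫ cap P.ev D.X = 𝟙 D.X := by simpa [cap] using P.zag
  have h4 : A ◁ (ρ_ D.X).inv ≫ A ◁ D.X ◁ P.coev ≫ tail D.ρ (M.X ⊗ D.X) ≫ cap P.ev D.X = D.ρ := by
    rw [reassoc_of% (tail_nat D.ρ P.coev)]
    have h5 : A ◁ (ρ_ D.X).inv ≫ tail D.ρ (𝟙_ C) = D.ρ ≫ (ρ_ D.X).inv := by simp [tail]
    rw [reassoc_of% h5, h3, Category.comp_id]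
  rw [h1]
  simp only [Category.assoc]
  rw [← reassoc_of% (cup_nat (copairing A) (D.X ◁ P.coev)),
    ← reassoc_of% (cup_nat (copairing A) (ρ_ D.X).inv), reassoc_of% (whisker41 A h4),
    D.isAct.cop_act_act]

theorem zigzag : tensorMap P.coevHom (𝟙 M) ≫ (assocIso M D M).hom ≫ tensorMap (𝟙 M) P.evHom =
    (leftIso M).hom ≫ (rightIso M).inv := by
  rw [← cancel_mono (rightIso M).hom]
  simp only [Category.assoc, Iso.inv_hom_id, Category.comp_id]
  apply hom_ext
  apply projU_cancel
  have h1 : projU M ≫ (tensorMap P.coevHom (𝟙 M)).hom =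
      P.coevA ▷ M.X ≫ proj M D ▷ M.X ≫ proj (tensor M D) M := by
    refine (proj_tensorMap P.coevHom (𝟙 M)).trans ?_
    rw [id_hom, tensorHom_id]
    exact (comp_whiskerRight_assoc P.coevA (proj M D) M.X _)
  have h2 : proj M (tensor D M) ≫ (tensorMap (𝟙 M) P.evHom).hom =
      M.X ◁ P.evHat ≫ projV M := by
    refine (proj_tensorMap (𝟙 M) P.evHom).trans ?_
    rw [id_hom, id_tensorHom]
    rfl
  have h3 : P.coevA ▷ M.X ≫ (α_ M.X D.X M.X).hom = A ◁ cup P.coev M.X ≫ tail M.ρ (D.X ⊗ M.X) := by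
    simp [coevA, tail, cup]
  rw [comp_hom, comp_hom, comp_hom, reassoc_of% h1, assocIso, isoMk_hom_hom,
    reassoc_of% (proj_assocHom M D M), reassoc_of% h2, rightIso, isoMk_hom_hom, projV_rightHom,
    leftIso, isoMk_hom_hom, projU_leftHom, reassoc_of% (whisker21 M.X P.proj_evHat),
    reassoc_of% h3, ← reassoc_of% (tail_nat M.ρ P.evA), tail_braiding_inv_ρ,
    reassoc_of% (whisker40 A P.cup_evA)]

theorem zagzig : tensorMap (𝟙 D) P.coevHom ≫ (assocIso D M D).inv ≫ tensorMap P.evHom (𝟙 D) =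
    (rightIso D).hom ≫ (leftIso D).inv := by
  rw [← cancel_mono (leftIso D).hom]
  simp only [Category.assoc, Iso.inv_hom_id, Category.comp_id]
  apply hom_ext
  apply projV_cancel
  have h1 : projV D ≫ (tensorMap (𝟙 D) P.coevHom).hom =
      D.X ◁ P.coevA ≫ D.X ◁ proj M D ≫ proj D (tensor M D) := by
    refine (proj_tensorMap (𝟙 D) P.coevHom).trans ?_
    rw [id_hom, id_tensorHom]
    exact (MonoidalCategory.whiskerLeft_comp_assoc D.X P.coevA (proj M D) _)
  have h2 : proj (tensor D M) D ≫ (tensorMap P.evHom (𝟙 D)).hom =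
      P.evHat ▷ D.X ≫ projU D := by
    refine (proj_tensorMap P.evHom (𝟙 D)).trans ?_
    rw [id_hom, tensorHom_id]
    rfl
  have h3 : (assocIso D M D).inv.hom = assocInv D M D := rfl
  have h4 := congrArg (· ▷ D.X) P.proj_evHat
  simp only [comp_whiskerRight] at h4
  have h5 : (α_ D.X M.X D.X).inv ≫ P.evA ▷ D.X = tail P.evA D.X := rfl
  have h6 : (β_ A D.X).hom ≫ D.X ◁ P.coevA =
      A ◁ (ρ_ D.X).inv ≫ A ◁ D.X ◁ P.coev ≫ brd A D.X (M.X ⊗ D.X) ≫ D.X ◁ tail M.ρ D.X := by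
    have h : (β_ A D.X).hom ≫ D.X ◁ (ρ_ A).inv = A ◁ (ρ_ D.X).inv ≫ brd A D.X (𝟙_ C) := by
      rw [← cancel_mono (D.X ◁ (ρ_ A).hom), Category.assoc, Category.assoc,
        brd_whiskerLeft_rightUnitor, ← MonoidalCategory.whiskerLeft_comp,
        ← MonoidalCategory.whiskerLeft_comp_assoc]
      simp
    rw [coevA, MonoidalCategory.whiskerLeft_comp, MonoidalCategory.whiskerLeft_comp, reassoc_of% h,
      ← reassoc_of% (brd_nat (X := A) (Y := D.X) P.coev)]
  have h7 : brd A D.X (M.X ⊗ D.X) ≫ D.X ◁ tail M.ρ D.X ≫ tail P.evA D.X =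
      A ◁ tail P.evA D.X ≫ mulT A D.X := by
    have h := congrArg (tail · D.X) (P.evA_balanced.symm.trans P.lact_evA)
    simp only [tail_comp (ract D M) P.evA] at h
    rw [whiskerRight_eq_tail P.evA, ract, reassoc_of% (tail_whiskerLeft D.X M.ρ D.X),
      tail_whiskerLeft_comp, whiskerRight_eq_tail P.evA, MonoidalCategory.whiskerLeft_comp,
      Category.assoc, cancel_epi] at h
    exact h
  rw [comp_hom, comp_hom, comp_hom, reassoc_of% h1, h3,
    reassoc_of% (proj_assocInv D M D), reassoc_of% h2, leftIso, isoMk_hom_hom, projU_leftHom,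
    rightIso, isoMk_hom_hom, projV_rightHom, reassoc_of% h4, reassoc_of% h5,
    ← cancel_epi (β_ A D.X).hom, Iso.hom_inv_id_assoc, reassoc_of% h6, reassoc_of% h7,
    ← D.isAct.assoc, reassoc_of% (whisker40 A P.coev_evA)]

/-- The exact pairing of spin line defects given by a compatible duality. -/
@[reducible] def exactPairing : ExactPairing M D where
  coevaluation' := P.coevHom
  evaluation' := P.evHom
  coevaluation_evaluation' := P.zagzig
  evaluation_coevaluation' := P.zigzag

end DualPair

/-- The duality between a spin line defect and its dual. -/
def dualPair (M : SpinLine A) : DualPair M (dualObj M) where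
  ev := ε_ M.X (M.X)ᘁ
  coev := η_ M.X (M.X)ᘁ
  zig := by
    change (λ_ M.X).inv ≫ η_ M.X (M.X)ᘁ ▷ M.X ≫ (α_ M.X (M.X)ᘁ M.X).hom ≫
      M.X ◁ ε_ M.X (M.X)ᘁ ≫ (ρ_ M.X).hom = 𝟙 M.X
    rw [ExactPairing.evaluation_coevaluation_assoc]
    simp
  zag := by
    change (ρ_ (M.X)ᘁ).inv ≫ (M.X)ᘁ ◁ η_ M.X (M.X)ᘁ ≫ (α_ (M.X)ᘁ M.X (M.X)ᘁ).inv ≫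
      ε_ M.X (M.X)ᘁ ▷ (M.X)ᘁ ≫ (λ_ (M.X)ᘁ).hom = 𝟙 (M.X)ᘁ
    rw [ExactPairing.coevaluation_evaluation_assoc]
    simp
  act := by
    change tail M.dualAct M.X ≫ ε_ M.X (M.X)ᘁ =
      (brd A (M.X)ᘁ M.X ≫ (M.X)ᘁ ◁ M.ρ) ≫ ε_ M.X (M.X)ᘁ
    rw [tail_dualAct_ev, actEv_eq, Category.assoc]
  ev_t := by
    change (rightAdjointMate M.t ⊗ₘ M.t) ≫ ε_ M.X (M.X)ᘁ = ε_ M.X (M.X)ᘁ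
    rw [tensorHom_def', Category.assoc, rightAdjointMate_comp_evaluation,
      ← MonoidalCategory.whiskerLeft_comp_assoc, M.t_t]
    simp
  coev_t := by
    change η_ M.X (M.X)ᘁ ≫ (M.t ⊗ₘ rightAdjointMate M.t) = η_ M.X (M.X)ᘁ
    rw [tensorHom_def', coevaluation_comp_rightAdjointMate_assoc, ← comp_whiskerRight, M.t_t]
    simp

instance : RightRigidCategory (SpinLine A) where
  rightDual M := { rightDual := dualObj M, exact := (dualPair M).exactPairing }

end SpinLine

theorem pow2_mate {C : Type u} [Category.{v} C] [MonoidalCategory C] {X : C} [HasRightDual X]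
    (f : X ⟶ X) (ν : ZMod 2) : rightAdjointMate (pow2 f ν) = pow2 (rightAdjointMate f) ν := by
  rcases zmod2_cases ν with rfl | rfl
  · simp [pow2_zero, rightAdjointMate_id]
  · simp [pow2_one]

/-! ### The twist, the ribbon structure and the opposite duality -/

namespace SpinLine

variable {C : Type u} [Category.{v} C] [Preadditive C] [MonoidalCategory C] [MonoidalPreadditive C]
  [BraidedCategory C] [RightRigidCategory C] [RibbonCategory C] [IsIdempotentComplete C]
  {A : C} [MonObj A] [ComonObj A] [IsSeparableFrobenius A] [IsCommMonObj A]

section Twist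

variable (M : SpinLine A)

/-- The action of `t_M` on the even part. -/
def evenT : M.X ⟶ M.X := ∑ ν, M.e ν ≫ pow2 M.t (1 + ν)

/-- The underlying map of the twist of spin line defects. -/
def twHom : M.X ⟶ M.X := evenT M ≫ twist M.X

theorem e_evenT (ν : ZMod 2) : M.e ν ≫ evenT M = M.e ν ≫ pow2 M.t (1 + ν) := by
  rw [evenT, Preadditive.comp_sum, Finset.sum_eq_single ν]
  · rw [← Category.assoc, e_idem]
  · intro j _ hj
    rw [← Category.assoc, M.grading.orth _ _ (Ne.symm hj), zero_comp]
  · simp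

theorem e_twHom (ν : ZMod 2) : M.e ν ≫ twHom M = M.e ν ≫ pow2 M.t (1 + ν) ≫ twist M.X := by
  rw [twHom, ← Category.assoc, e_evenT, Category.assoc]

theorem e_pow2_t (i j : ZMod 2) : M.e i ≫ pow2 M.t j = pow2 M.t j ≫ M.e i :=
  (pow2_comp (M.e_t i).symm j).symm

theorem evenT_evenT : evenT M ≫ evenT M = 𝟙 M.X := by
  apply M.grading.ext_left
  intro ν
  rw [← Category.assoc, e_evenT, e_pow2_t, Category.assoc, e_evenT, e_pow2_t, ← Category.assoc,
    pow2_pow2 M.t_t, CharTwo.add_self_eq_zero, pow2_zero]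
  simp

/-- On degree ν both θ_M and t^{1+ν} are semilinear over θ_A^{1+ν}, an involution, so their
composite is linear. -/
theorem ρ_twHom : M.ρ ≫ twHom M = A ◁ twHom M ≫ M.ρ := by
  apply M.grading.ext_whiskerLeft
  intro ν
  have h := e_twist_mul M ν
  rw [← reassoc_of% (ρ_e M ν), e_twHom, reassoc_of% (whisker23 A (e_twHom M ν)),
    reassoc_of% (e_pow2_t M ν (1 + ν)),
    reassoc_of% (ρ_pow2_t M (1 + ν)), ← h, MonoidalCategory.whiskerLeft_comp,
    Category.assoc, ← reassoc_of% (whisker22 A (e_pow2_t M ν (1 + ν)))]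

theorem twHom_nat {N : SpinLine A} (f : M ⟶ N) : twHom M ≫ f.hom = f.hom ≫ twHom N := by
  apply M.grading.ext_left
  intro ν
  rw [reassoc_of% (e_twHom M ν), twist_nat, reassoc_of% (pow2_comp f.t_hom (1 + ν)),
    reassoc_of% (e_hom f ν), reassoc_of% (e_hom f ν), e_twHom]

theorem t_twHom : M.t ≫ twHom M = twHom M ≫ M.t := by
  apply M.grading.ext_left
  intro ν
  rw [reassoc_of% (e_t M ν), reassoc_of% (e_twHom M ν), e_twHom, twist_nat,
    ← reassoc_of% (e_t M ν), reassoc_of% (pow2_comp (f := M.t) (g := M.t) (h := M.t) rfl (1 + ν))]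

/-- The twist of spin line defects. -/
def twIso : M ≅ M :=
  isoMk (twHom M) (inv (twist M.X) ≫ evenT M)
    (by rw [twHom, Category.assoc, IsIso.hom_inv_id_assoc, evenT_evenT])
    (by rw [twHom, Category.assoc, reassoc_of% (evenT_evenT M), IsIso.inv_hom_id])
    (ρ_twHom M) (t_twHom M)

end Twist

/-- The first braiding contributes t_N^i and the second t_M^j; both commute with the grading and
pass through the crossings. -/
theorem e_e_monodromy (M N : SpinLine A) (i j : ZMod 2) :
    (M.e i ⊗ₘ N.e j) ≫ deg M N ≫ (β_ M.X N.X).hom ≫ deg N M =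
      (M.e i ⊗ₘ N.e j) ≫ (pow2 M.t j ⊗ₘ pow2 N.t i) ≫ (β_ M.X N.X).hom := by
  have h1 : (M.e i ⊗ₘ N.e j) ≫ deg M N = M.X ◁ pow2 N.t i ≫ (M.e i ⊗ₘ N.e j) := by
    rw [tensorHom_def', Category.assoc, e_deg, ← whisker_exchange,
      reassoc_of% (whisker22 M.X (e_pow2_t N j i))]
  have h2 : (N.e j ⊗ₘ M.e i) ≫ deg N M = N.X ◁ pow2 M.t j ≫ (N.e j ⊗ₘ M.e i) := by
    rw [tensorHom_def', Category.assoc, e_deg, ← whisker_exchange,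
      reassoc_of% (whisker22 N.X (e_pow2_t M i j))]
  rw [reassoc_of% h1, BraidedCategory.braiding_naturality_assoc, h2,
    ← BraidedCategory.braiding_naturality_left_assoc, ← BraidedCategory.braiding_naturality,
    tensorHom_comp_tensorHom_assoc, e_pow2_t, e_pow2_t, ← tensorHom_comp_tensorHom_assoc,
    tensorHom_def' (pow2 M.t j), Category.assoc]

theorem proj_pow2_t (M N : SpinLine A) (ν : ZMod 2) :
    proj M N ≫ pow2 (tensor M N).t ν = (pow2 M.t ν ⊗ₘ pow2 N.t ν) ≫ proj M N := by
  rcases zmod2_cases ν with rfl | rfl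
  · simp [pow2_zero]
  · simpa [pow2_one] using proj_t M N

/-- On bidegree (i, j) the exponent on M is 1 + i + j on both sides: on the right, 1 + i comes from
the twist of M and j from the monodromy. The same holds for N with i and j exchanged. -/
theorem twIso_tensor (M N : SpinLine A) : (twIso (tensor M N)).hom =
    tensorMap (twIso M).hom (twIso N).hom ≫ (braidIso M N).hom ≫ (braidIso N M).hom := by
  apply hom_ext
  apply proj_cancel
  apply ext_tensor
  intro i j
  simp only [comp_hom, twIso, braidIso, isoMk_hom_hom]
  rw [reassoc_of% (proj_tensorMap _ _), isoMk_hom_hom, isoMk_hom_hom,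
    reassoc_of% (proj_braidHom M N), proj_braidHom]
  have h1 : ∀ (M : SpinLine A) (ν : ZMod 2), M.e ν ≫ twHom M =
      (pow2 M.t (1 + ν) ≫ twist M.X) ≫ M.e ν := fun M ν => by
    rw [e_twHom, reassoc_of% (e_pow2_t M ν (1 + ν)), ← twist_nat, Category.assoc]
  have h3 : (M.e i ⊗ₘ N.e j) ≫ (twHom M ⊗ₘ twHom N) = (pow2 M.t (1 + i) ≫ twist M.X ⊗ₘ
      pow2 N.t (1 + j) ≫ twist N.X) ≫ (M.e i ⊗ₘ N.e j) := by
    rw [tensorHom_comp_tensorHom, h1, h1, ← tensorHom_comp_tensorHom]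
  have h4 : ∀ (M : SpinLine A) (i j k : ZMod 2), k = 1 + i + j → M.e i ≫ pow2 M.t k ≫ twist M.X =
      pow2 M.t (1 + i) ≫ twist M.X ≫ M.e i ≫ pow2 M.t j := fun M i j k hk => by
    rw [hk, ← pow2_pow2 M.t_t, Category.assoc, reassoc_of% (e_pow2_t M i (1 + i)),
      reassoc_of% (twist_nat (M.e i)), twist_nat]
  have h2 : (M.e i ⊗ₘ N.e j) ≫ proj M N =
      (M.e i ⊗ₘ N.e j) ≫ proj M N ≫ (tensor M N).e (i + j) := by rw [e_proj_e, if_pos rfl]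
  rw [reassoc_of% h2, e_twHom, ← reassoc_of% h2, reassoc_of% (proj_pow2_t M N (1 + (i + j))),
    ← twist_nat, twist_tensor, reassoc_of% h3, reassoc_of% (e_e_monodromy M N i j)]
  simp only [Category.assoc, tensorHom_comp_tensorHom_assoc]
  rw [h4 M i j _ (add_assoc _ _ _).symm, h4 N j i _ (by rw [add_assoc, add_comm j i])]

/-- The unit is even with t = θ_A, so its twist is the square of θ_A. -/
theorem twIso_unit : (twIso (unitObj A)).hom = 𝟙 (unitObj A) := by
  have h0 : (unitObj A).e 0 = 𝟙 A := by
    change gr μ[A] 0 = 𝟙 A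
    simp [gr, qop_of_even isAct_mul mact_mul]
  have h := e_twHom (unitObj A) 0
  rw [h0] at h
  apply hom_ext
  rw [twIso, isoMk_hom_hom]
  refine (Category.id_comp (X := A) (twHom (unitObj A))).symm.trans (h.trans ?_)
  rw [add_zero, pow2_one]
  change 𝟙 A ≫ twist A ≫ twist A = 𝟙 A
  rw [twist_twist, Category.comp_id]

theorem dualObj_e (M : SpinLine A) (ν : ZMod 2) :
    (dualObj M).e ν = rightAdjointMate (M.e ν) :=
  (congrFun (M.isGrading_mate.eq_gr M.isAct_dualAct) ν).symm

/-- Grading, t and the ambient twist of the dual are the mates of those of M, and the factors of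
`twHom` commute, so reversal of order is harmless. -/
theorem twHom_dualObj (M : SpinLine A) : twHom (dualObj M) = rightAdjointMate (twHom M) := by
  apply (dualObj M).grading.ext_left
  intro ν
  rw [e_twHom, dualObj_e]
  change rightAdjointMate (M.e ν) ≫ pow2 (rightAdjointMate M.t) (1 + ν) ≫ twist (M.X)ᘁ =
    rightAdjointMate (M.e ν) ≫ rightAdjointMate (twHom M)
  rw [← comp_rightAdjointMate, twist, RibbonCategory.twist_dual, ← pow2_mate,
    ← comp_rightAdjointMate, ← comp_rightAdjointMate]
  have h := gr_nat (ρ_twHom M) ν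
  change M.e ν ≫ twHom M = twHom M ≫ M.e ν at h
  rw [← h, e_twHom, reassoc_of% (e_pow2_t M ν (1 + ν)), ← twist_nat]
  congr 1
  rw [Category.assoc]
  exact (Category.assoc _ _ _).symm.trans
    ((congrArg (· ≫ M.e ν) (twist_nat (pow2 M.t (1 + ν)))).trans (Category.assoc _ _ _))

namespace DualPair

variable {M D : SpinLine A} (P : DualPair M D)

theorem pow2_ev (ν : ZMod 2) : pow2 D.t ν ▷ M.X ≫ P.ev = D.X ◁ pow2 M.t ν ≫ P.ev := by
  rcases zmod2_cases ν with rfl | rfl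
  · simp [pow2_zero]
  · have h := D.X ◁ M.t ≫= P.ev_t
    rw [tensorHom_def', Category.assoc, ← MonoidalCategory.whiskerLeft_comp_assoc, M.t_t] at h
    simpa [pow2_one] using h

theorem coev_pow2 (ν : ZMod 2) : P.coev ≫ M.X ◁ pow2 D.t ν = P.coev ≫ pow2 M.t ν ▷ D.X := by
  rcases zmod2_cases ν with rfl | rfl
  · simp [pow2_zero]
  · have h := P.coev_t =≫ M.t ▷ D.X
    rw [tensorHom_def', Category.assoc, Category.assoc, ← comp_whiskerRight, M.t_t] at h
    simpa [pow2_one] using h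

theorem e_t_pow2 (M : SpinLine A) (ν : ZMod 2) :
    pow2 M.t ν ≫ M.e ν ≫ twHom M = M.e ν ≫ M.t ≫ twist M.X := by
  rw [e_twHom, reassoc_of% (e_pow2_t M ν (1 + ν)), ← Category.assoc, pow2_pow2 M.t_t,
    (by decide : ∀ ν : ZMod 2, ν + (1 + ν) = 1), pow2_one, ← reassoc_of% (e_t M ν)]

/-- The braiding puts t^ν on D, which the coevaluation carries over to M; there it meets t^{1+ν}
from the twist, leaving t in every degree. `deg_ev` is the analogue for the evaluation. -/
theorem coev_deg : P.coev ≫ deg M D ≫ (β_ M.X D.X).hom ≫ D.X ◁ twHom M =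
    P.coev ≫ (β_ M.X D.X).hom ≫ D.X ◁ twist M.X ≫ D.X ◁ M.t := by
  have h : deg M D ≫ (β_ M.X D.X).hom ≫ D.X ◁ twHom M =
    ∑ ν, M.X ◁ pow2 D.t ν ≫ (M.e ν ≫ twHom M) ▷ D.X ≫ (β_ M.X D.X).hom := by
    rw [deg, Preadditive.sum_comp]
    refine Finset.sum_congr rfl fun ν _ => ?_
    rw [tensorHom_def', Category.assoc, ← BraidedCategory.braiding_naturality_left,
      comp_whiskerRight_assoc]
  have h2 : (β_ M.X D.X).hom ≫ D.X ◁ twist M.X ≫ D.X ◁ M.t =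
    ∑ ν, (M.e ν ≫ M.t ≫ twist M.X) ▷ D.X ≫ (β_ M.X D.X).hom := by
    have h3 : ∑ ν, M.e ν = 𝟙 M.X := by
      rw [show (Finset.univ : Finset (ZMod 2)) = {0, 1} by decide, Finset.sum_pair (by decide),
        M.grading.sum]
    rw [← Preadditive.sum_comp, ← sum_whiskerRight, ← Preadditive.sum_comp, h3, Category.id_comp,
      ← MonoidalCategory.whiskerLeft_comp, ← BraidedCategory.braiding_naturality_left, twist_nat]
  rw [h, h2, Preadditive.comp_sum, Preadditive.comp_sum]
  refine Finset.sum_congr rfl fun ν _ => ?_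
  rw [reassoc_of% (coev_pow2 P ν), ← comp_whiskerRight_assoc, e_t_pow2]

theorem deg_ev : twHom M ▷ D.X ≫ deg M D ≫ (β_ M.X D.X).hom ≫ P.ev =
    M.t ▷ D.X ≫ twist M.X ▷ D.X ≫ (β_ M.X D.X).hom ≫ P.ev := by
  apply M.grading.ext_whiskerRight
  intro ν
  have h1 := gr_nat (ρ_twHom M) ν
  change M.e ν ≫ twHom M = twHom M ≫ M.e ν at h1
  have h2 : twHom M ≫ pow2 M.t ν ≫ M.e ν = M.e ν ≫ M.t ≫ twist M.X := by
    rw [← e_pow2_t, ← reassoc_of% h1, reassoc_of% (e_twHom M ν), twist_nat,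
      ← Category.assoc (pow2 M.t (1 + ν)), pow2_pow2 M.t_t,
      (by decide : ∀ ν : ZMod 2, 1 + ν + ν = 1), pow2_one]
  rw [← comp_whiskerRight_assoc, h1, comp_whiskerRight_assoc, reassoc_of% (e_deg M D ν),
    BraidedCategory.braiding_naturality_right_assoc, pow2_ev,
    ← BraidedCategory.braiding_naturality_left_assoc, ← comp_whiskerRight_assoc,
    ← comp_whiskerRight_assoc, Category.assoc, e_pow2_t, h2, comp_whiskerRight_assoc, comp_whiskerRight_assoc]

theorem coevA_opp : P.coevA ≫ deg M D ≫ (β_ M.X D.X).hom ≫ D.X ◁ twHom M ≫ proj D M =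
    (ρ_ A).inv ≫ A ◁ (P.coev ≫ (β_ M.X D.X).hom ≫ D.X ◁ twist M.X) ≫ tail D.ρ M.X ≫
      D.X ◁ M.t ≫ proj D M := by
  have h1 : P.coevA = (ρ_ A).inv ≫ A ◁ P.coev ≫ lact M D := rfl
  have h2 : ract D M ≫ D.X ◁ twHom M = A ◁ D.X ◁ twHom M ≫ ract D M := by
    rw [ract, Category.assoc, whisker22 D.X (ρ_twHom M), reassoc_of% (brd_nat (X := A) (Y := D.X))]
  have h3 : tail D.ρ M.X ≫ D.X ◁ M.t = A ◁ D.X ◁ M.t ≫ tail D.ρ M.X := by rw [tail_nat]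
  rw [h1, reassoc_of% h3, Category.assoc, Category.assoc, reassoc_of% (act_deg_braiding M D),
    reassoc_of% h2, ← act_proj, reassoc_of% (whisker44 A P.coev_deg)]
  simp [lact]

theorem evA_opp : twHom M ▷ D.X ≫ deg M D ≫ (β_ M.X D.X).hom ≫ P.evA =
    cop A (M.X ⊗ D.X) ≫ A ◁ (tail M.ρ D.X ≫ M.t ▷ D.X ≫ twist M.X ▷ D.X ≫
      (β_ M.X D.X).hom ≫ P.ev) ≫ (ρ_ A).hom := by
  have h1 : lact M D ≫ twHom M ▷ D.X = A ◁ twHom M ▷ D.X ≫ lact M D := by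
    rw [lact, ← tail_comp, ρ_twHom, tail_whiskerLeft_comp]
  have h2 : lact M D ≫ twHom M ▷ D.X ≫ deg M D ≫ (β_ M.X D.X).hom =
      A ◁ (twHom M ▷ D.X ≫ deg M D ≫ (β_ M.X D.X).hom) ≫ ract D M := by
    rw [reassoc_of% h1, act_deg_braiding]
    simp
  have h3 := cup_nat (copairing A) (twHom M ▷ D.X ≫ deg M D ≫ (β_ M.X D.X).hom)
  simp only [Category.assoc] at h3
  rw [evA, P.act, ← deg_ev, ← lact, reassoc_of% h2, ← reassoc_of% h3]
  simp only [MonoidalCategory.whiskerLeft_comp, Category.assoc]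

end DualPair

theorem proj_comp_whiskerRight_ev {M : SpinLine A} (g : dualObj M ⟶ dualObj M) :
    proj (dualObj M) M ≫ (g ▷ M ≫ (dualPair M).evHom).hom =
      g.hom ▷ M.X ≫ (dualPair M).evA := by
  rw [comp_hom]
  refine ((reassoc_of% (proj_tensorMap g (𝟙 M))) _).trans ?_
  rw [id_hom, tensorHom_id]
  exact congrArg (g.hom ▷ M.X ≫ ·) (dualPair M).proj_evHat

theorem proj_comp_whiskerLeft_ev {M : SpinLine A} (f : M ⟶ M) :
    proj (dualObj M) M ≫ (dualObj M ◁ f ≫ (dualPair M).evHom).hom =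
      (dualObj M).X ◁ f.hom ≫ (dualPair M).evA := by
  rw [comp_hom]
  refine ((reassoc_of% (proj_tensorMap (𝟙 (dualObj M)) f)) _).trans ?_
  rw [id_hom, id_tensorHom]
  exact congrArg ((dualObj M).X ◁ f.hom ≫ ·) (dualPair M).proj_evHat

/-- Being the mate in C suffices: f and g are linear, so they pass through the action and copairing
from which the relative evaluation is built. -/
theorem eq_rightAdjointMate {M : SpinLine A} (f : M ⟶ M) (g : dualObj M ⟶ dualObj M)
    (h : g.hom ▷ M.X ≫ (dualPair M).ev = (dualObj M).X ◁ f.hom ≫ (dualPair M).ev) :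
    g = rightAdjointMate f := by
  refine dual_ext (X := M) (W := dualObj M) (f := g) (g := rightAdjointMate f) ?_
  refine Eq.trans ?_ (rightAdjointMate_comp_evaluation f).symm
  apply hom_ext
  apply proj_cancel (M := dualObj M)
  refine (proj_comp_whiskerRight_ev g).trans (Eq.trans ?_ (proj_comp_whiskerLeft_ev f).symm)
  have h1 : lact (dualObj M) M ≫ g.hom ▷ M.X = A ◁ g.hom ▷ M.X ≫ lact (dualObj M) M := by
    rw [lact, ← tail_comp, g.act_hom, tail_whiskerLeft_comp]
  have h2 : lact (dualObj M) M ≫ (dualObj M).X ◁ f.hom =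
      A ◁ (dualObj M).X ◁ f.hom ≫ lact (dualObj M) M := by
    rw [lact, tail_nat]
  rw [DualPair.evA, ← reassoc_of% (cup_nat (copairing A) (g.hom ▷ M.X)),
    ← reassoc_of% (cup_nat (copairing A) ((dualObj M).X ◁ f.hom)),
    ← MonoidalCategory.whiskerLeft_comp_assoc, ← MonoidalCategory.whiskerLeft_comp_assoc,
    ← reassoc_of% h1, ← reassoc_of% h2, h]

theorem twIso_dual (M : SpinLine A) :
    (twIso (dualObj M)).hom = rightAdjointMate (twIso M).hom := by
  apply eq_rightAdjointMate
  rw [twIso, isoMk_hom_hom, twIso, isoMk_hom_hom, twHom_dualObj]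
  exact rightAdjointMate_comp_evaluation (twHom M)

instance : RibbonCategory (SpinLine A) where
  twist := twIso
  twist_naturality f := hom_ext (twHom_nat _ f)
  twist_tensor := twIso_tensor
  twist_unit := twIso_unit
  twist_dual := twIso_dual

theorem dualPair_evA (M : SpinLine A) : (dualPair M).evA = M.evA := by
  have h : lact (dualObj M) M ≫ (dualPair M).ev = M.actEv := M.tail_dualAct_ev
  rw [DualPair.evA, h, evA]
  simp [cup]
  rfl

theorem dualPair_coevA (M : SpinLine A) : (dualPair M).coevA = M.coevA := by
  rw [DualPair.coevA, coevA, tail]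
  rfl

namespace DualPair

variable {M D : SpinLine A} (P : DualPair M D)

theorem coevHom_opp : P.coevHom.hom ≫ braidHom M D ≫ (tensorMap (𝟙 D) (twIso M).hom).hom =
    P.coevA ≫ deg M D ≫ (β_ M.X D.X).hom ≫ D.X ◁ twHom M ≫ proj D M := by
  have h2 := proj_tensorMap (𝟙 D) (twIso M).hom
  rw [id_hom, id_tensorHom] at h2
  change (P.coevA ≫ proj M D) ≫ braidHom M D ≫ (tensorMap (𝟙 D) (twIso M).hom).hom = _
  refine (Category.assoc _ _ _).trans (congrArg (P.coevA ≫ ·) ?_)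
  exact ((reassoc_of% (proj_braidHom M D)) _).trans (congrArg (deg M D ≫ (β_ M.X D.X).hom ≫ ·) h2)

theorem evHom_opp : (tensorMap (twIso M).hom (𝟙 D)).hom ≫ braidHom M D ≫ P.evHom.hom =
    incl M D ≫ twHom M ▷ D.X ≫ deg M D ≫ (β_ M.X D.X).hom ≫ P.evA := by
  have h2 := proj_tensorMap (twIso M).hom (𝟙 D)
  rw [id_hom, tensorHom_id] at h2
  have h3 : proj M D ≫ braidHom M D ≫ P.evHat = deg M D ≫ (β_ M.X D.X).hom ≫ P.evA := by
    rw [reassoc_of% (proj_braidHom M D), P.proj_evHat]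
  have h4 : proj M D ≫ (tensorMap (twIso M).hom (𝟙 D)).hom ≫ braidHom M D ≫ P.evHat =
      twHom M ▷ D.X ≫ deg M D ≫ (β_ M.X D.X).hom ≫ P.evA :=
    ((reassoc_of% h2) _).trans (congrArg (twHom M ▷ D.X ≫ ·) h3)
  rw [← h4, ← Category.assoc (incl M D), incl_proj]
  exact (Category.id_comp _).symm

end DualPair

theorem oppCoev_hom (M : SpinLine A) :
    (oppCoev M).hom = M.oppCoevA ≫ proj M.dualObj M := by
  have h : M.oppCoevA = (ρ_ A).inv ≫ A ◁ (η_ M.X (M.X)ᘁ ≫ (β_ M.X (M.X)ᘁ).hom ≫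
      (M.X)ᘁ ◁ twist M.X) ≫ tail M.dualAct M.X ≫ (M.X)ᘁ ◁ M.t := by
    rw [oppCoevA, MonoidalCategory.tensorHom_def, oppCoev, tail]
    simp only [Category.assoc]
  refine ((dualPair M).coevHom_opp).trans ((dualPair M).coevA_opp.trans ?_)
  refine Eq.trans ?_ (congrArg (· ≫ proj M.dualObj M) h.symm)
  refine Eq.trans ?_ (Category.assoc _ _ _).symm
  refine congrArg ((ρ_ A).inv ≫ ·) (Eq.trans ?_ (Category.assoc _ _ _).symm)
  exact congrArg (A ◁ _ ≫ ·) (Category.assoc _ _ _).symm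

theorem oppEv_hom (M : SpinLine A) :
    (oppEv M).hom = incl M M.dualObj ≫ M.oppEvA := by
  refine ((dualPair M).evHom_opp).trans ?_
  refine congrArg (incl M M.dualObj ≫ ·) ((dualPair M).evA_opp.trans ?_)
  have h : M.oppEvA = cop A (M.X ⊗ (M.X)ᘁ) ≫ A ◁ (tail M.ρ (M.X)ᘁ ≫ M.t ▷ (M.X)ᘁ ≫
      twist M.X ▷ (M.X)ᘁ ≫ (β_ M.X (M.X)ᘁ).hom ≫ ε_ M.X (M.X)ᘁ) ≫ (ρ_ A).hom := by
    rw [oppEvA, oppEv, tail]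
    simp [cup]
  exact h.symm

/-- The underlying objects of unit and dual are A and the dual in C, so both identifications are
identities. On a pure defect the sums over degrees defining braiding and twist collapse to one term
because the grading idempotent of that degree is the identity. -/
theorem isSpinRibbonStructure : IsSpinRibbonStructure A incl proj (Iso.refl A)
    (fun M => Iso.refl (M.X)ᘁ) where
  incl_proj := incl_proj
  proj_incl := proj_incl
  tensor_act M N := by
    rw [← Category.assoc (α_ A M.X N.X).inv]
    exact tensor_ρ M N
  tensor_t := tensor_t
  tensor_hom := tensorMap_hom
  unit_act := by
    change μ[A] ≫ 𝟙 A = A ◁ 𝟙 A ≫ μ[A]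
    simp
  unit_t := by
    rw [nakayama_eq_twist]
    change twist A ≫ 𝟙 A = 𝟙 A ≫ twist A
    simp
  associator M N P := rfl
  left_unitor M := by
    change leftHom M = inclU M ≫ 𝟙 A ▷ M.X ≫ M.ρ
    rw [id_whiskerRight, Category.id_comp, leftHom]
  right_unitor M := by
    change rightHom M = inclV M ≫ M.X ◁ 𝟙 A ≫ (β_ A M.X).inv ≫ M.ρ
    rw [MonoidalCategory.whiskerLeft_id, Category.id_comp, rightHom]
  braiding M N ν h := by
    change braidHom M N = _
    rw [braidHom, deg_of_isPure M N ν h, BraidedCategory.braiding_naturality_right_assoc]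
  dual_act M := by
    change M.dualAct ≫ 𝟙 (M.X)ᘁ = A ◁ 𝟙 (M.X)ᘁ ≫ M.dualAct
    simp
  dual_t M := by
    change rightAdjointMate M.t ≫ 𝟙 (M.X)ᘁ = 𝟙 (M.X)ᘁ ≫ rightAdjointMate M.t
    simp
  coev M := by
    change 𝟙 A ≫ (dualPair M).coevA ≫ proj M (dualObj M) =
      M.coevA ≫ M.X ◁ 𝟙 (M.X)ᘁ ≫ proj M (dualObj M)
    rw [dualPair_coevA, MonoidalCategory.whiskerLeft_id]
    exact (Category.id_comp _).trans (congrArg (M.coevA ≫ ·) (Category.id_comp _).symm)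
  ev M := by
    change (incl (dualObj M) M ≫ (dualPair M).evA) ≫ 𝟙 A =
      incl (dualObj M) M ≫ 𝟙 (M.X)ᘁ ▷ M.X ≫ M.evA
    rw [dualPair_evA, id_whiskerRight]
    exact (Category.comp_id _).trans (congrArg (incl (dualObj M) M ≫ ·) (Category.id_comp _).symm)
  twist M ν h := by
    change twHom M = _
    have h1 := e_twHom M ν
    rw [e_of_isPure M ν h, Category.id_comp, Category.id_comp] at h1
    rw [h1, twist_nat]
  opp_coev M := by
    change 𝟙 A ≫ (oppCoev M).hom = M.oppCoevA ≫ 𝟙 (M.X)ᘁ ▷ M.X ≫ proj (dualObj M) M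
    rw [oppCoev_hom, id_whiskerRight]
    exact (Category.id_comp _).trans (congrArg (M.oppCoevA ≫ ·) (Category.id_comp _).symm)
  opp_ev M := by
    change (oppEv M).hom ≫ 𝟙 A = incl M (dualObj M) ≫ M.X ◁ 𝟙 (M.X)ᘁ ≫ M.oppEvA
    have h : M.X ◁ 𝟙 (M.X)ᘁ ≫ M.oppEvA = M.oppEvA := by
      rw [MonoidalCategory.whiskerLeft_id, Category.id_comp]
    exact (Category.comp_id _).trans
      ((oppEv_hom M).trans (congrArg (incl M (dualObj M) ≫ ·) h.symm))

end SpinLine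

end SpinDefects

end

theorem mainTheorem5
    {k : Type w} [Field k] (hk : (2 : k) ≠ 0)
    {C : Type u} [Category.{v} C] [Preadditive C] [Linear k C] [HasFiniteBiproducts C]
    [IsIdempotentComplete C] [MonoidalCategory C] [MonoidalPreadditive C] [MonoidalLinear k C]
    [BraidedCategory C] [RightRigidCategory C] [SpinDefects.RibbonCategory C]
    (hunit : Function.Bijective (fun c : k => c • 𝟙 (𝟙_ C)))
    (A : C) [MonObj A] [ComonObj A] [SpinDefects.IsFrobenius A] [IsCommMonObj A]
    (hsep : Δ[A] ≫ μ[A] = 𝟙 A)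
    (hspecial : ∃ c : k, c ≠ 0 ∧ η[A] ≫ ε[A] = c • 𝟙 (𝟙_ C)) :
    (∀ M : SpinDefects.SpinLine A, M.IsSumOfPure) ∧
    ∃ (_ : MonoidalCategory (SpinDefects.SpinLine A))
      (_ : BraidedCategory (SpinDefects.SpinLine A))
      (_ : RightRigidCategory (SpinDefects.SpinLine A))
      (_ : SpinDefects.RibbonCategory (SpinDefects.SpinLine A))
      (incl : ∀ M N : SpinDefects.SpinLine A, (M ⊗ N).X ⟶ M.X ⊗ N.X)
      (proj : ∀ M N : SpinDefects.SpinLine A, M.X ⊗ N.X ⟶ (M ⊗ N).X)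
      (e : (𝟙_ (SpinDefects.SpinLine A)).X ≅ A)
      (d : ∀ M : SpinDefects.SpinLine A, (Mᘁ).X ≅ (M.X)ᘁ),
      SpinDefects.SpinLine.IsSpinRibbonStructure A incl proj e d := by
  have : SpinDefects.IsSeparableFrobenius A := { comul_mul := hsep }
  exact ⟨SpinDefects.SpinLine.isSumOfPure, inferInstance, inferInstance, inferInstance,
    inferInstance, SpinDefects.SpinLine.incl, SpinDefects.SpinLine.proj, Iso.refl A,
    fun _ => Iso.refl _, SpinDefects.SpinLine.isSpinRibbonStructure⟩
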